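/- A hole in a finite simple graph is an induced cycle of length at least $4$. For $n \ge 8$, let $H_n$ be the following $n$-vertex graph. Write $n = 3k$, $n = 3k+1$ or $n = 3k-1$ with $k \ge 3$. Partition the $n$ vertices into $k$ clusters $B_1,\dots,B_k$, each of size $3$, except that exactly one cluster has size $4$ if $n = 3k+1$, and exactly one cluster has size $2$ if $n = 3k-1$. Two vertices are adjacent in $H_n$ if and only if they lie in clusters $B_i$ and $B_j$ with $j \equiv i \pm 1 \pmod k$. There exists $n_0 \ge 8$ such that, for all $n \ge n_0$, $H_n$ is, up to isomorphism, the unique graph on $n$ vertices with the maximum number of holes. That is, every graph $G$ on $n$ vertices has at most as many holes as $H_n$, with equality if and only if $G$ is isomorphic to $H_n$. -/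

import Mathlib

universe u

/-- A vertex set `S` spans a hole of `G` if the subgraph of `G` induced on `S` is a cycle
of some length `m ≥ 4`. -/
def IsHole {V : Type u} (G : SimpleGraph V) (S : Set V) : Prop :=
  ∃ m : ℕ, 4 ≤ m ∧ Nonempty (G.induce S ≃g SimpleGraph.cycleGraph m)

/-- The number of holes of `G`. An induced subgraph is determined by its vertex set, so holes
are counted by their vertex sets. -/
noncomputable def holeCount {V : Type u} (G : SimpleGraph V) : ℕ :=
  {S : Set V | IsHole G S}.ncard

/-- The empty cyclic braid with `k` clusters of sizes `s 0, …, s (k - 1)`, for `k ≥ 3`: the vertex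
`⟨i, a⟩` is the `a`-th vertex of cluster `i`, and two vertices are adjacent exactly when their
clusters are cyclically consecutive, that is, their indices differ by `1` modulo `k`. -/
def emptyCyclicBraid (k : ℕ) (s : Fin k → ℕ) : SimpleGraph (Σ i : Fin k, Fin (s i)) :=
  (SimpleGraph.cycleGraph k).comap Sigma.fst

/-- The number of clusters of `H_n`: it is `k` for `n = 3k`, `n = 3k + 1` and `n = 3k - 1`. -/
def numClusters (n : ℕ) : ℕ := (n + 1) / 3

/-- The cluster sizes of `H_n`: all are `3`, except that the cluster with index `0` has size `4` if
`n ≡ 1` modulo `3`, and size `2` if `n ≡ 2` modulo `3`. -/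
def clusterSize (n : ℕ) (i : Fin (numClusters n)) : ℕ :=
  if i.val = 0 then (if n % 3 = 1 then 4 else if n % 3 = 2 then 2 else 3) else 3

/-- The vertex type of `H_n`. -/
abbrev ExtremalVertex (n : ℕ) : Type := Σ i : Fin (numClusters n), Fin (clusterSize n i)

/-- The graph `H_n` (meaningful for `n ≥ 8`). -/
def extremalGraph (n : ℕ) : SimpleGraph (ExtremalVertex n) :=
  emptyCyclicBraid (numClusters n) (clusterSize n)

/-- `H_n` has `n` vertices. -/
theorem card_extremalVertex {n : ℕ} (hn : 8 ≤ n) : Fintype.card (ExtremalVertex n) = n := by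
  obtain ⟨j, hj⟩ : ∃ j, numClusters n = j + 1 := ⟨numClusters n - 1, by unfold numClusters; omega⟩
  have h : Fintype.card (ExtremalVertex n) = ∑ i ∈ Finset.range (numClusters n),
      (if i = 0 then (if n % 3 = 1 then 4 else if n % 3 = 2 then 2 else 3) else 3) := by
    rw [Finset.sum_range, Fintype.card_sigma]
    exact Finset.sum_congr rfl fun i _ => Fintype.card_fin _
  rw [h, hj, Finset.sum_range_succ']
  unfold numClusters at hj
  simp
  split_ifs <;> omega

/-! The longest holes of H_n take one vertex from each cluster, and there are `maxProd n` of them.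
Conversely, an induced path is continued by choosing one of the still available neighbours of its
end, and all of these neighbours then become unavailable. Successive branchings use disjoint vertex
sets, so the number of continuations is at most a product of parts of the available set
(`pathCount_le`). Summed over the beginnings of a hole this gives `holeCount_le`: at most `15 *
maxProd n` holes. The rest is a stability argument.

Suppose first that there are at least `maxProd n` holes and that every vertex lies in a fifth of
them. Then all degrees are at most 30 (`degree_le_of_holesThrough`) and there are at least n *
maxProd n / 5 rooted holes, that is, holes listed from a starting vertex. An entropy estimate on the
tree of induced paths (`sum_defects_add_waste_le`) shows that an average rooted hole has boundedly
many places where the branching is not almost evenly threefold, and leaves boundedly many vertices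
undominated. Rerooting holes (`card_farReturn_le`) and exchanging short pieces of them
(`nearBad_of_exchange`) shows that at most places the three options have the same new neighbours.
Hence some stretch of a hole has options that form completely joined triples with no other outward
edges, a segment (`exists_isSegment`).

A hole of length at least five that enters the interior of a segment passes straight through it.
Apart from few exceptions, holes are therefore counted by induced paths leading from one end of the
segment around to the other. By `pathCount_gap` this count loses a constant factor unless the
remaining vertices form a chain of clusters as well. So the graph is a cyclic braid with an optimal
product of cluster sizes, and the numbers of holes of length four decide: edges inside clusters cost
holes, and two clusters of size 2 are worse than one of size 4 (`IsBraid.holeCount_lt_or_iso`).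

It remains to remove the assumption on the vertices. Deleting a vertex that lies in fewer than a
fifth of the holes multiplies the ratio of the number of holes to `maxProd` by more than (4/5)(4/3)
= 16/15. As this ratio never exceeds 15, it is below 16/15 for all large graphs
(`fifteen_mul_holeCount_lt`). One more deletion then excludes such a vertex in a graph with at least
`maxProd n` holes. -/

/-! ### Largest products of parts with a given sum -/

/-- The largest product of positive integers with sum `n`. -/
def maxProd : ℕ → ℕ
  | 0 => 1
  | 1 => 1
  | 2 => 2
  | 3 => 3
  | 4 => 4
  | n + 5 => 3 * maxProd (n + 2)

theorem maxProd_add_three {n : ℕ} (hn : 2 ≤ n) : maxProd (n + 3) = 3 * maxProd n := by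
  obtain ⟨m, rfl⟩ := Nat.exists_eq_add_of_le hn
  rw [show 2 + m + 3 = m + 5 by ring, show 2 + m = m + 2 by ring]
  rw [maxProd]

/-- The recursion of `maxProd` has period three only from 2 on, so inequalities about it reduce to
five base cases and a scaling by 3. -/
theorem induction_step_three {P : ℕ → Prop} (h0 : P 0) (h1 : P 1) (h2 : P 2) (h3 : P 3) (h4 : P 4)
    (hs : ∀ n, 2 ≤ n → P n → P (n + 3)) (n : ℕ) : P n := by
  induction n using Nat.strong_induction_on with
  | _ n ih =>
    match n, ih with
    | 0, _ => exact h0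
    | 1, _ => exact h1
    | 2, _ => exact h2
    | 3, _ => exact h3
    | 4, _ => exact h4
    | n + 5, ih => exact hs (n + 2) (by omega) (ih _ (by omega))

theorem maxProd_pos (n : ℕ) : 0 < maxProd n := by
  induction n using induction_step_three with
  | hs n hn ih => rw [maxProd_add_three hn]; omega
  | _ => decide

/-- The growth factor is smallest, namely 4/3, when a part 3 becomes a part 4. This makes sums of
`maxProd` geometric and measures the loss when a vertex is deleted. -/
theorem four_mul_maxProd_le {n : ℕ} (hn : 1 ≤ n) : 4 * maxProd n ≤ 3 * maxProd (n + 1) := by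
  induction n using induction_step_three with
  | h0 => omega
  | hs n h2 ih =>
    rw [maxProd_add_three h2, show n + 3 + 1 = (n + 1) + 3 by ring, maxProd_add_three (by omega)]
    have := ih (by omega)
    omega
  | _ => decide

theorem maxProd_mono : Monotone maxProd := by
  refine monotone_nat_of_le_succ fun n => ?_
  rcases Nat.eq_zero_or_pos n with rfl | hn
  · decide
  · have := four_mul_maxProd_le hn
    omega

/-- Both sides triple when r grows by 3, so finitely many cases remain. The factor 8/9 is attained
by 2 · 4 against 3 · 3. -/
theorem maxProd_gap_of_lt {e : ℕ} (he : e < 8) (r : ℕ) :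
    e * maxProd r = maxProd (e + r) ∨ 9 * (e * maxProd r) ≤ 8 * maxProd (e + r) := by
  induction r using induction_step_three with
  | hs n hn ih =>
    rw [maxProd_add_three hn, show e + (n + 3) = (e + n) + 3 by ring,
      maxProd_add_three (by omega)]
    rcases ih with h | h
    · left; rw [← h]; ring
    · right; nlinarith
  | _ => interval_cases e <;> decide

/-- A part of size at least 5 is never optimal. Sizes from 8 on reduce to smaller ones because e ≤
3(e - 3). -/
theorem maxProd_gap_of_five_le {e : ℕ} (he : 5 ≤ e) (r : ℕ) :
    9 * (e * maxProd r) ≤ 8 * maxProd (e + r) := by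
  induction e using Nat.strong_induction_on with
  | _ e ih =>
    by_cases h8 : e < 8
    · rcases maxProd_gap_of_lt h8 r with h | h
      · exfalso
        clear ih
        revert h
        induction r using induction_step_three with
        | hs n hn ih =>
          rw [maxProd_add_three hn, show e + (n + 3) = (e + n) + 3 by ring,
            maxProd_add_three (by omega)]
          intro h
          apply ih
          linarith
        | _ => interval_cases e <;> decide
      · exact h
    · have h1 := ih (e - 3) (by omega) (by omega)
      rw [show e + r = (e - 3 + r) + 3 by omega, maxProd_add_three (by omega)]
      have : e * maxProd r ≤ 3 * ((e - 3) * maxProd r) := by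
        rw [← mul_assoc]
        exact Nat.mul_le_mul_right _ (by omega)
      omega

/-- Splitting off a part of size `e` is either optimal or loses a factor `8 / 9`. -/
theorem maxProd_gap (e r : ℕ) :
    e * maxProd r = maxProd (e + r) ∨ 9 * (e * maxProd r) ≤ 8 * maxProd (e + r) := by
  by_cases he : e < 8
  · exact maxProd_gap_of_lt he r
  · exact Or.inr (maxProd_gap_of_five_le (by omega) r)

theorem mul_maxProd_le (e r : ℕ) : e * maxProd r ≤ maxProd (e + r) := by
  rcases maxProd_gap e r with h | h <;> omega

theorem maxProd_mul_le (a b : ℕ) : maxProd a * maxProd b ≤ maxProd (a + b) := by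
  induction a using induction_step_three with
  | h0 => simp [maxProd]
  | h1 => have := mul_maxProd_le 1 b; simpa [maxProd] using this
  | h2 => exact mul_maxProd_le 2 b
  | h3 => exact mul_maxProd_le 3 b
  | h4 => exact mul_maxProd_le 4 b
  | hs n hn ih =>
    rw [maxProd_add_three hn, show n + 3 + b = (n + b) + 3 by ring, maxProd_add_three (by omega)]
    nlinarith

/-- Converts the d² choices of two neighbours of a vertex into the product value of d vertices, at
the cost of a constant. -/
theorem sq_le_five_mul_maxProd (d : ℕ) : d ^ 2 ≤ 5 * maxProd d := by
  induction d using induction_step_three with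
  | hs n hn ih =>
    rw [maxProd_add_three hn]
    by_cases h : n < 5
    · interval_cases n <;> decide
    · nlinarith
  | _ => decide

/-- Exponential growth beats the square; this is what excludes large degrees. -/
theorem maxProd_large {d : ℕ} (hd : 30 ≤ d) : 5 * d ^ 2 < maxProd d := by
  induction d using Nat.strong_induction_on with
  | _ d ih =>
    by_cases h : d < 33
    · interval_cases d <;> decide
    · obtain ⟨e, rfl⟩ : ∃ e, d = e + 3 := ⟨d - 3, by omega⟩
      rw [maxProd_add_three (by omega)]
      have := ih e (by omega) (by omega)
      nlinarith

/-- Geometric series with ratio 3/4: its sum without the leading term is 3. -/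
theorem sum_maxProd_le (n : ℕ) : ∑ i ∈ Finset.range n, maxProd i ≤ 3 * maxProd n := by
  induction n with
  | zero => simp
  | succ n ih =>
    rw [Finset.sum_range_succ]
    rcases Nat.eq_zero_or_pos n with rfl | hn
    · decide
    · have := four_mul_maxProd_le hn
      omega

/-- The cubed form of 3^(n/3) ≤ (3/2) * maxProd n, which translates the entropy bound into
`maxProd`. -/
theorem eight_mul_three_pow_le (n : ℕ) : 8 * 3 ^ n ≤ 27 * maxProd n ^ 3 := by
  induction n using induction_step_three with
  | hs n hn ih =>
    rw [maxProd_add_three hn, pow_add, mul_pow]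
    omega
  | _ => decide

theorem maxProd_add_three_mul {n : ℕ} (hn : 2 ≤ n) (k : ℕ) :
    maxProd (n + 3 * k) = 3 ^ k * maxProd n := by
  induction k with
  | zero => simp
  | succ k ih =>
    rw [show n + 3 * (k + 1) = (n + 3 * k) + 3 by ring, maxProd_add_three (by omega), ih]
    ring

theorem prod_le_maxProd {ι : Type*} (A : Finset ι) (s : ι → ℕ) :
    ∏ i ∈ A, s i ≤ maxProd (∑ i ∈ A, s i) := by
  classical
  induction A using Finset.induction_on with
  | empty => simp [maxProd]
  | insert a A ha ih =>
    rw [Finset.prod_insert ha, Finset.sum_insert ha]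
    exact (Nat.mul_le_mul_left _ ih).trans (mul_maxProd_le _ _)

/-- Every subfamily of an optimal family of parts is optimal. -/
theorem prod_eq_maxProd_of_subset {ι : Type*} [DecidableEq ι] {A B : Finset ι} (s : ι → ℕ)
    (hs : ∀ i ∈ B, 0 < s i) (hAB : A ⊆ B) (hB : ∏ i ∈ B, s i = maxProd (∑ i ∈ B, s i)) :
    ∏ i ∈ A, s i = maxProd (∑ i ∈ A, s i) := by
  refine le_antisymm (prod_le_maxProd A s) ?_
  by_contra! h
  have h1 := prod_le_maxProd (B \ A) s
  have h2 := maxProd_mul_le (∑ i ∈ A, s i) (∑ i ∈ B \ A, s i)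
  rw [← Finset.prod_sdiff hAB, ← Finset.sum_sdiff hAB] at hB
  have h3 : 0 < ∏ i ∈ B \ A, s i :=
    Finset.prod_pos fun i hi => hs i (Finset.sdiff_subset hi)
  rw [add_comm] at hB
  nlinarith

/-! ### Counting induced paths, and stability of the maximum -/

section PathCount

open scoped Classical

variable {V : Type u} (G : SimpleGraph V) (T : Set V)

/-- The number of induced paths that start in `x`, continue inside `W` with at most `k` steps, and
stop at the first vertex of `T`. -/
noncomputable def pathCount : ℕ → V → Finset V → ℕ
  | 0, x, _ => if x ∈ T then 1 else 0
  | k + 1, x, W => if x ∈ T then 1 else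
      ∑ y ∈ W.filter (G.Adj x), pathCount k y (W.filter fun w => ¬ G.Adj x w)

/-- `L` lists clusters that lead from `x` to `T`: every vertex is joined to all of the next cluster
and to no later one, and exactly the vertices of the last cluster are in `T`. -/
def ClusterChain : V → List (Finset V) → Prop
  | x, [] => x ∈ T
  | x, Y :: L => x ∉ T ∧ (∀ y ∈ Y, G.Adj x y ∧ ClusterChain y L) ∧ ∀ Z ∈ L, ∀ z ∈ Z, ¬ G.Adj x z

variable {G T}

theorem pathCount_of_mem {x : V} (hx : x ∈ T) (k : ℕ) (W : Finset V) :
    pathCount G T k x W = 1 := by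
  cases k <;> simp [pathCount, hx]

theorem pathCount_zero_of_notMem {x : V} (hx : x ∉ T) (W : Finset V) :
    pathCount G T 0 x W = 0 := by
  simp [pathCount, hx]

theorem pathCount_succ_of_notMem {x : V} (hx : x ∉ T) (k : ℕ) (W : Finset V) :
    pathCount G T (k + 1) x W =
      ∑ y ∈ W.filter (G.Adj x), pathCount G T k y (W.filter fun w => ¬ G.Adj x w) := by
  simp [pathCount, hx]

theorem card_filter_adj_add (x : V) (W : Finset V) :
    (W.filter (G.Adj x)).card + (W.filter fun w => ¬ G.Adj x w).card = W.card :=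
  Finset.card_filter_add_card_filter_not _

/-- Once one of the neighbours of x is chosen, all of them leave the available set. The branchings
along a path thus use disjoint parts of W. -/
theorem pathCount_le (k : ℕ) (x : V) (W : Finset V) :
    pathCount G T k x W ≤ maxProd W.card := by
  induction k generalizing x W with
  | zero =>
    have := maxProd_pos W.card
    by_cases hx : x ∈ T
    · rw [pathCount_of_mem hx]; omega
    · rw [pathCount_zero_of_notMem hx]; omega
  | succ k ih =>
    have := maxProd_pos W.card
    by_cases hx : x ∈ T
    · rw [pathCount_of_mem hx]; omega
    · rw [pathCount_succ_of_notMem hx]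
      refine (Finset.sum_le_card_nsmul _ _ _ fun y _ => ih y _).trans ?_
      rw [smul_eq_mul, ← card_filter_adj_add (G := G) x W]
      exact mul_maxProd_le _ _

/-- The set H can be entered only from a neighbour of H, and the path starts at a non-neighbour and
finds only non-neighbours outside H. So it never enters H, while outside H it meets no vertex of T.
-/
theorem pathCount_eq_zero (H : Set V) (k : ℕ) (x : V) (U : Finset V) (hx : x ∉ T)
    (hxH : ∀ z ∈ H, ¬ G.Adj x z) (hU : ∀ u ∈ U, u ∈ H ∨ (u ∉ T ∧ ∀ z ∈ H, ¬ G.Adj u z)) :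
    pathCount G T k x U = 0 := by
  induction k generalizing x U with
  | zero => exact pathCount_zero_of_notMem hx _
  | succ k ih =>
    rw [pathCount_succ_of_notMem hx]
    refine Finset.sum_eq_zero fun y hy => ?_
    rw [Finset.mem_filter] at hy
    rcases hU y hy.1 with h | h
    · exact absurd hy.2 (hxH y h)
    · exact ih y _ h.1 h.2 fun u hu => hU u (Finset.mem_filter.1 hu).1

/-- Along a chain, induced paths cannot turn back. -/
theorem pathCount_le_of_clusterChain (L : List (Finset V)) (k : ℕ) (x : V) (U : Finset V)
    (hL : ClusterChain G T x L)
    (hU : ∀ u ∈ U, (∃ Y ∈ L, u ∈ Y) ∨ ((L ≠ [] → u ∉ T) ∧ ∀ Z ∈ L.tail, ∀ z ∈ Z, ¬ G.Adj u z)) :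
    pathCount G T k x U ≤ (L.map fun Y => (Y ∩ U).card).prod := by
  induction L generalizing k x U with
  | nil => rw [pathCount_of_mem hL]; simp
  | cons Y L ih =>
    obtain ⟨hx, hY, hnot⟩ := hL
    cases k with
    | zero => rw [pathCount_zero_of_notMem hx]; exact Nat.zero_le _
    | succ k =>
      rw [pathCount_succ_of_notMem hx, List.map_cons, List.prod_cons, ← smul_eq_mul]
      -- An available neighbour of x outside Y lies in no cluster of the chain. From such a vertex
      -- the later clusters cannot be reached, because those of Y have just been removed.
      have hsub : ∀ y ∈ U.filter (G.Adj x), y ∉ Y →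
          pathCount G T k y (U.filter fun w => ¬ G.Adj x w) = 0 := by
        intro y hy hyY
        rw [Finset.mem_filter] at hy
        rcases hU y hy.1 with ⟨Z, hZ, hyZ⟩ | h
        · rcases List.mem_cons.1 hZ with rfl | hZ
          · exact absurd hyZ hyY
          · exact absurd hy.2 (hnot Z hZ y hyZ)
        · refine pathCount_eq_zero {z | ∃ Z ∈ L, z ∈ Z} k y _ (h.1 (by simp)) ?_ ?_
          · rintro z ⟨Z, hZ, hz⟩
            exact h.2 Z hZ z hz
          · intro u hu
            rw [Finset.mem_filter] at hu
            rcases hU u hu.1 with ⟨Z, hZ, huZ⟩ | h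
            · rcases List.mem_cons.1 hZ with rfl | hZ
              · exact absurd (hY u huZ).1 hu.2
              · exact Or.inl ⟨Z, hZ, huZ⟩
            · exact Or.inr ⟨h.1 (by simp), by rintro z ⟨Z, hZ, hz⟩; exact h.2 Z hZ z hz⟩
      rw [← Finset.sum_filter_add_sum_filter_not _ (· ∈ Y)]
      rw [Finset.sum_eq_zero (s := Finset.filter (fun x => x ∉ Y) _)
        (fun y hy => hsub y (Finset.mem_filter.1 hy).1 (Finset.mem_filter.1 hy).2), add_zero]
      have hcard : (Y ∩ U) = (U.filter (G.Adj x)).filter (· ∈ Y) := by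
        ext y
        simp only [Finset.mem_inter, Finset.mem_filter]
        exact ⟨fun h => ⟨⟨h.2, (hY y h.1).1⟩, h.1⟩, fun h => ⟨h.2, h.1.1⟩⟩
      rw [hcard]
      refine Finset.sum_le_card_nsmul _ _ _ fun y hy => ?_
      rw [Finset.mem_filter] at hy
      refine (ih k y (U.filter fun w => ¬ G.Adj x w) (hY y hy.2).2 ?_).trans ?_
      · intro u hu
        rw [Finset.mem_filter] at hu
        rcases hU u hu.1 with ⟨Z, hZ, huZ⟩ | h
        · rcases List.mem_cons.1 hZ with rfl | hZ
          · exact absurd (hY u huZ).1 hu.2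
          · exact Or.inl ⟨Z, hZ, huZ⟩
        · exact Or.inr ⟨fun _ => h.1 (by simp), fun Z hZ => h.2 Z (List.mem_of_mem_tail hZ)⟩
      · exact List.prod_map_le_prod_map₀ _ _ (fun _ _ => Nat.zero_le _) fun Z _ =>
          Finset.card_le_card (Finset.inter_subset_inter_left (Finset.filter_subset _ _))

/-- The number of pairs: a cluster, and a choice of a vertex of `Z` in it and of vertices of `U` in
all later clusters. -/
noncomputable def entryCount (U Z : Finset V) : List (Finset V) → ℕ
  | [] => 0
  | Y :: L => (Y ∩ Z).card * (L.map fun Y => (Y ∩ U).card).prod + entryCount U Z L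

theorem sum_pathCount_le_entryCount (U Z : Finset V) (L : List (Finset V)) (k : ℕ) (x : V)
    (hL : ClusterChain G T x L) (hne : ∀ Y ∈ L, Y.Nonempty)
    (hU : ∀ u ∈ U, (∃ Y ∈ L, u ∈ Y) ∨ ((L ≠ [] → u ∉ T) ∧ ∀ Z ∈ L.tail, ∀ z ∈ Z, ¬ G.Adj u z)) :
    ∑ p ∈ Z.filter (fun p => ∃ Y ∈ L, p ∈ Y), pathCount G T k p U ≤ entryCount U Z L := by
  induction L generalizing x with
  | nil => simp
  | cons Y L ih =>
    obtain ⟨hx, hY, hnot⟩ := hL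
    obtain ⟨y, hy⟩ := hne Y (by simp)
    have hU' : ∀ u ∈ U, (∃ Y ∈ L, u ∈ Y) ∨
        ((L ≠ [] → u ∉ T) ∧ ∀ Z ∈ L.tail, ∀ z ∈ Z, ¬ G.Adj u z) := by
      intro u hu
      rcases hU u hu with ⟨Z, hZ, huZ⟩ | h
      · rcases List.mem_cons.1 hZ with rfl | hZ
        · right
          have := (hY u huZ).2
          cases L with
          | nil => simp
          | cons Y' L => exact ⟨fun _ => this.1, this.2.2⟩
        · exact Or.inl ⟨Z, hZ, huZ⟩
      · exact Or.inr ⟨fun _ => h.1 (by simp), fun Z hZ => h.2 Z (List.mem_of_mem_tail hZ)⟩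
    have h1 := ih y (hY y hy).2 (fun Z hZ => hne Z (by simp [hZ])) hU'
    have h2 : ∑ p ∈ Y ∩ Z, pathCount G T k p U ≤
        (Y ∩ Z).card * (L.map fun Y => (Y ∩ U).card).prod := by
      rw [← smul_eq_mul]
      refine Finset.sum_le_card_nsmul _ _ _ fun p hp => ?_
      exact pathCount_le_of_clusterChain L k p U (hY p (Finset.mem_inter.1 hp).1).2 hU'
    rw [entryCount]
    refine le_trans ?_ (Nat.add_le_add h2 h1)
    rw [← Finset.sum_union_inter]
    refine le_trans (Finset.sum_le_sum_of_subset ?_) (Nat.le_add_right _ _)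
    intro p hp
    simp only [Finset.mem_filter, List.mem_cons, exists_eq_or_imp, Finset.mem_union,
      Finset.mem_inter] at hp ⊢
    tauto

/-- Sort the choices of one vertex from each cluster by the last cluster whose vertex lies in Z. The
later vertices lie in U and the earlier ones are free; the choices without a vertex of Z account for
the extra product. -/
theorem entryCount_add_le (U Z : Finset V) (L : List (Finset V))
    (hne : ∀ Y ∈ L, 1 ≤ Y.card) (h : ∀ Y ∈ L, (Y ∩ Z).card + (Y ∩ U).card ≤ Y.card) :
    entryCount U Z L + (L.map fun Y => (Y ∩ U).card).prod ≤ (L.map Finset.card).prod := by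
  induction L with
  | nil => simp [entryCount]
  | cons Y L ih =>
    have h1 := ih (fun Y hY => hne Y (by simp [hY])) fun Y hY => h Y (by simp [hY])
    have h2 := h Y (by simp)
    have h3 := hne Y (by simp)
    simp only [entryCount, List.map_cons, List.prod_cons]
    calc _ = ((Y ∩ Z).card + (Y ∩ U).card) * (L.map fun Y => (Y ∩ U).card).prod +
          1 * entryCount U Z L := by ring
      _ ≤ Y.card * (L.map fun Y => (Y ∩ U).card).prod + Y.card * entryCount U Z L :=
          Nat.add_le_add (Nat.mul_le_mul_right _ h2) (Nat.mul_le_mul_right _ h3)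
      _ = Y.card * (entryCount U Z L + (L.map fun Y => (Y ∩ U).card).prod) := by ring
      _ ≤ _ := Nat.mul_le_mul_left _ h1

/-- A cluster of size at most 4 that loses a vertex shrinks at least by the factor 3/4. -/
theorem four_mul_prod_inter_le (U : Finset V) (L : List (Finset V)) (h4 : ∀ Y ∈ L, Y.card ≤ 4)
    (h : ∃ Y ∈ L, (Y ∩ U).card < Y.card) :
    4 * (L.map fun Y => (Y ∩ U).card).prod ≤ 3 * (L.map Finset.card).prod := by
  have hle : ∀ L : List (Finset V),
      (L.map fun Y => (Y ∩ U).card).prod ≤ (L.map Finset.card).prod := fun L =>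
    List.prod_map_le_prod_map₀ _ _ (fun _ _ => Nat.zero_le _) fun Y _ =>
      Finset.card_le_card Finset.inter_subset_left
  induction L with
  | nil => simp at h
  | cons Y L ih =>
    simp only [List.map_cons, List.prod_cons]
    obtain ⟨Z, hZ, hlt⟩ := h
    rcases List.mem_cons.1 hZ with rfl | hZ
    · have h1 : 4 * (Z ∩ U).card ≤ 3 * Z.card := by
        have := h4 Z (by simp)
        omega
      have := hle L
      calc 4 * ((Z ∩ U).card * _) = (4 * (Z ∩ U).card) * _ := by ring
        _ ≤ (3 * Z.card) * _ := Nat.mul_le_mul h1 this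
        _ = _ := by ring
    · have h1 := ih (fun Y hY => h4 Y (by simp [hY])) ⟨Z, hZ, hlt⟩
      have h2 : (Y ∩ U).card ≤ Y.card := Finset.card_le_card Finset.inter_subset_left
      calc 4 * ((Y ∩ U).card * _) = (Y ∩ U).card * (4 * _) := by ring
        _ ≤ Y.card * (3 * _) := Nat.mul_le_mul h2 h1
        _ = _ := by ring

/-- If the available vertices form a chain for one starting vertex, then every other starting
vertex has the same neighbours in it or loses a constant fraction of the paths. -/
theorem clusterChain_or_pathCount_le (L : List (Finset V)) (x y : V) (W : Finset V) (k : ℕ)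
    (hx : ClusterChain G T x L) (hW : ∀ w, w ∈ W ↔ ∃ Y ∈ L, w ∈ Y) (hd : L.Pairwise Disjoint)
    (h2 : ∀ Y ∈ L, 2 ≤ Y.card) (h4 : ∀ Y ∈ L, Y.card ≤ 4) :
    ClusterChain G T y L ∨ 8 * pathCount G T k y W ≤ 7 * (L.map Finset.card).prod := by
  cases L with
  | nil =>
    by_cases hy : y ∈ T
    · exact Or.inl hy
    · right
      have : W = ∅ := Finset.eq_empty_of_forall_notMem fun w hw => by simpa using (hW w).1 hw
      subst this
      cases k with
      | zero => simp [pathCount_zero_of_notMem hy]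
      | succ k => simp [pathCount_succ_of_notMem hy]
  | cons Y L =>
    have hYc := h2 Y (by simp)
    have hYc4 := h4 Y (by simp)
    have hLpos : 1 ≤ (L.map Finset.card).prod := by
      refine Nat.pos_of_ne_zero (List.prod_ne_zero ?_)
      simp only [List.mem_map, not_exists, not_and]
      intro Z hZ h
      have := h2 Z (by simp [hZ])
      omega
    by_cases hy : y ∈ T
    · right
      rw [pathCount_of_mem hy, List.map_cons, List.prod_cons]
      nlinarith
    obtain ⟨hxT, hxY, hxn⟩ := hx
    set Z := W.filter (G.Adj y) with hZ
    by_cases hZY : Z = Y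
    · left
      refine ⟨hy, fun p hp => ⟨?_, (hxY p hp).2⟩, ?_⟩
      · rw [← hZY, hZ, Finset.mem_filter] at hp
        exact hp.2
      · intro X hX z hz hyz
        have : z ∈ Z := Finset.mem_filter.2 ⟨(hW z).2 ⟨X, by simp [hX], hz⟩, hyz⟩
        rw [hZY] at this
        exact Finset.disjoint_left.1 ((List.pairwise_cons.1 hd).1 X hX) this hz
    right
    cases k with
    | zero => rw [pathCount_zero_of_notMem hy]; simp
    | succ k =>
      rw [pathCount_succ_of_notMem hy, ← hZ]
      set U := W.filter fun w => ¬ G.Adj y w with hU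
      have hsum : ∑ p ∈ Z, pathCount G T k p U ≤ entryCount U Z (Y :: L) := by
        refine le_trans (le_of_eq ?_)
          (sum_pathCount_le_entryCount U Z (Y :: L) k x ⟨hxT, hxY, hxn⟩ ?_ ?_)
        · congr 1
          refine (Finset.filter_true_of_mem fun p hp => ?_).symm
          exact (hW p).1 (Finset.mem_filter.1 hp).1
        · intro X hX
          exact Finset.card_pos.1 (by have := h2 X hX; omega)
        · intro u hu
          exact Or.inl ((hW u).1 (Finset.mem_filter.1 hu).1)
      have hcard : ∀ X ∈ Y :: L, (X ∩ Z).card + (X ∩ U).card = X.card := by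
        intro X hX
        rw [← Finset.card_filter_add_card_filter_not (s := X) (G.Adj y)]
        congr 2 <;> ext w <;> simp only [Z, U, Finset.mem_inter, Finset.mem_filter, hW] <;>
          exact ⟨fun h => ⟨h.1, h.2.2⟩, fun h => ⟨h.1, ⟨X, hX, h.1⟩, h.2⟩⟩
      refine (Nat.mul_le_mul_left 8 hsum).trans ?_
      have hle := entryCount_add_le U Z L
        (fun X hX => (h2 X (by simp [hX])).trans' (by norm_num)) fun X hX => (hcard X (by simp [hX])).le
      have hYcard := hcard Y (by simp)
      rw [entryCount, List.map_cons, List.prod_cons]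
      by_cases hhit : ∃ X ∈ L, (X ∩ Z).Nonempty
      · obtain ⟨X, hX, hne⟩ := hhit
        have h3 := four_mul_prod_inter_le U L (fun X hX => h4 X (by simp [hX])) ⟨X, hX, by
          have := hcard X (by simp [hX])
          have := Finset.card_pos.2 hne
          omega⟩
        set v := (L.map fun Y => (Y ∩ U).card).prod
        set P := (L.map Finset.card).prod
        have hz : (Y ∩ Z).card ≤ Y.card := by omega
        set z := (Y ∩ Z).card
        set g := entryCount U Z L
        set c := Y.card
        -- The count z v + g is at most P + (c - 1) v with v ≤ 3P/4, hence at most (1 + 3c) P / 4.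
        -- This is at most 7 c P / 8 as c ≥ 2, with equality for c = 2.
        interval_cases c <;> nlinarith
      · push Not at hhit
        have hg : entryCount U Z L = 0 := by
          have : ∀ L' : List (Finset V), (∀ X ∈ L', X ∩ Z = ∅) → entryCount U Z L' = 0 := by
            intro L'
            induction L' with
            | nil => intro _; rfl
            | cons X L' ih =>
              intro h
              rw [entryCount, h X (by simp), ih fun X hX => h X (by simp [hX])]
              simp
          exact this L hhit
        -- Now Z lies inside Y and differs from it, so at most three quarters of Y can be entered.
        have hlt : (Y ∩ Z).card < Y.card := by
          by_contra! hge
          have h5 : Y ⊆ Z := by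
            rw [← Finset.inter_eq_left]
            exact Finset.eq_of_subset_of_card_le Finset.inter_subset_left hge
          refine hZY (Finset.Subset.antisymm (fun p hp => ?_) h5)
          obtain ⟨X, hX, hpX⟩ := (hW p).1 (Finset.mem_filter.1 hp).1
          rcases List.mem_cons.1 hX with rfl | hX
          · exact hpX
          · have := hhit X hX
            exact absurd (Finset.mem_inter.2 ⟨hpX, hp⟩) (by simp [this])
        set v := (L.map fun Y => (Y ∩ U).card).prod
        set P := (L.map Finset.card).prod
        set z := (Y ∩ Z).card
        set c := Y.card
        rw [hg] at hle ⊢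
        interval_cases c <;> nlinarith

/-- Either almost the maximum number of induced paths is missed by a constant factor, or the
available vertices form a chain of clusters. -/
theorem pathCount_gap (k : ℕ) (x : V) (W : Finset V) (hW1 : W.card ≠ 1) :
    32 * pathCount G T k x W ≤ 31 * maxProd W.card ∨
    ∃ L : List (Finset V), ClusterChain G T x L ∧ (∀ w, w ∈ W ↔ ∃ Y ∈ L, w ∈ Y) ∧
      L.Pairwise Disjoint ∧ (∀ Y ∈ L, 2 ≤ Y.card ∧ Y.card ≤ 4) ∧
      (L.map Finset.card).prod = maxProd W.card := by
  induction k generalizing x W with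
  | zero =>
    by_cases hx : x ∈ T
    · rw [pathCount_of_mem hx]
      rcases Nat.eq_zero_or_pos W.card with h0 | hpos
      · right
        rw [Finset.card_eq_zero] at h0
        subst h0
        exact ⟨[], hx, by simp, by simp, by simp, by simp [maxProd]⟩
      · left
        -- The exclusion of a single available vertex is needed here: a path that stops at once
        -- already attains `maxProd 1 = 1` without using that vertex.
        have := maxProd_mono (show 2 ≤ W.card by omega)
        simp only [maxProd] at this
        omega
    · rw [pathCount_zero_of_notMem hx]; left; omega
  | succ k ih =>
    by_cases hx : x ∈ T
    · rw [pathCount_of_mem hx]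
      rcases Nat.eq_zero_or_pos W.card with h0 | hpos
      · right
        rw [Finset.card_eq_zero] at h0
        subst h0
        exact ⟨[], hx, by simp, by simp, by simp, by simp [maxProd]⟩
      · left
        have := maxProd_mono (show 2 ≤ W.card by omega)
        simp only [maxProd] at this
        omega
    · rw [pathCount_succ_of_notMem hx]
      set Y := W.filter (G.Adj x) with hY
      set W' := W.filter fun w => ¬ G.Adj x w with hW'
      have hc : Y.card + W'.card = W.card := card_filter_adj_add x W
      have hbound : ∀ y ∈ Y, pathCount G T k y W' ≤ maxProd W'.card := fun y _ => pathCount_le _ _ _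
      have hsum : ∑ y ∈ Y, pathCount G T k y W' ≤ Y.card * maxProd W'.card := by
        rw [← smul_eq_mul]
        exact Finset.sum_le_card_nsmul _ _ _ hbound
      rw [← hc]
      rcases maxProd_gap Y.card W'.card with heq | hlt
      swap
      · left; omega
      have hY4 : Y.card ≤ 4 := by
        by_contra! h
        have := maxProd_gap_of_five_le (show 5 ≤ Y.card by omega) W'.card
        have := maxProd_pos (Y.card + W'.card)
        omega
      -- The induction hypothesis excludes this case, but it cannot be optimal either: c * 1 =
      -- maxProd (c + 1) has no solution with c ≤ 4.
      by_cases hW'1 : W'.card = 1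
      · left
        rw [hW'1] at heq hsum hc ⊢
        have : Y.card ≤ 4 := hY4
        interval_cases Y.card <;> simp [maxProd] at heq hsum hc
      by_cases hall : ∀ y ∈ Y, 32 * pathCount G T k y W' ≤ 31 * maxProd W'.card
      · left
        rw [← heq, Finset.mul_sum]
        calc _ ≤ Y.card • (31 * maxProd W'.card) := Finset.sum_le_card_nsmul _ _ _ hall
          _ = _ := by rw [smul_eq_mul]; ring
      push Not at hall
      obtain ⟨y, hy, hygt⟩ := hall
      obtain ⟨L, hL, hLW, hLd, hLc, hLp⟩ := (ih y W' hW'1).resolve_left (by omega)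
      by_cases hchain : ∀ z ∈ Y, ClusterChain G T z L
      · right
        by_cases hY2 : 2 ≤ Y.card
        · refine ⟨Y :: L, ⟨hx, fun z hz => ⟨(Finset.mem_filter.1 hz).2, hchain z hz⟩, ?_⟩, ?_, ?_, ?_, ?_⟩
          · intro Z hZ z hz
            have := (hLW z).2 ⟨Z, hZ, hz⟩
            exact (Finset.mem_filter.1 this).2
          · intro w
            rw [List.exists_mem_cons_iff, ← hLW]
            simp only [Y, W', Finset.mem_filter]
            tauto
          · refine List.pairwise_cons.2 ⟨fun Z hZ => ?_, hLd⟩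
            rw [Finset.disjoint_left]
            intro z hz hzZ
            have := (hLW z).2 ⟨Z, hZ, hzZ⟩
            exact (Finset.mem_filter.1 this).2 (Finset.mem_filter.1 hz).2
          · intro Z hZ
            rcases List.mem_cons.1 hZ with rfl | hZ
            · exact ⟨hY2, hY4⟩
            · exact hLc Z hZ
          · rw [List.map_cons, List.prod_cons, hLp, heq]
        · exfalso
          have h1 : Y.card = 1 := by
            have := Finset.card_pos.2 ⟨y, hy⟩
            omega
          have := four_mul_maxProd_le (n := W'.card) (by omega)
          have := maxProd_pos W'.card
          rw [h1, add_comm] at heq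
          omega
      · left
        push Not at hchain
        obtain ⟨z, hz, hzn⟩ := hchain
        -- One of at most four options loses an eighth of its paths, which is the origin of the
        -- constant 31/32.
        have hz7 := (clusterChain_or_pathCount_le L y z W' k hL hLW hLd (fun Z hZ => (hLc Z hZ).1)
          (fun Z hZ => (hLc Z hZ).2)).resolve_left hzn
        rw [hLp] at hz7
        rw [← Finset.add_sum_erase _ _ hz, ← heq]
        have h3 : ∑ y ∈ Y.erase z, pathCount G T k y W' ≤ (Y.card - 1) * maxProd W'.card := by
          rw [← smul_eq_mul, ← Finset.card_erase_of_mem hz]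
          exact Finset.sum_le_card_nsmul _ _ _ fun y hy => hbound y (Finset.mem_of_mem_erase hy)
        have hpos := Finset.card_pos.2 ⟨z, hz⟩
        interval_cases Y.card <;> omega

end PathCount

/-! ### Holes listed in cyclic order -/

section RootedHole

variable {V : Type u} [Inhabited V] {G : SimpleGraph V}

theorem getElem!_take_of_lt {l : List V} {k i : ℕ} (h : i < k) : (l.take k)[i]! = l[i]! := by
  simp [List.getElem!_eq_getElem?_getD, h]

theorem getElem!_drop {l : List V} (k i : ℕ) : (l.drop k)[i]! = l[k + i]! := by
  simp [List.getElem!_eq_getElem?_getD, List.getElem?_drop]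

theorem getElem!_append_left' {l l' : List V} {i : ℕ} (h : i < l.length) :
    (l ++ l')[i]! = l[i]! := by
  simp [List.getElem!_eq_getElem?_getD, List.getElem?_append_left h]

theorem getElem!_append_right' {l l' : List V} {i : ℕ} (h : l.length ≤ i) :
    (l ++ l')[i]! = l'[i - l.length]! := by
  simp [List.getElem!_eq_getElem?_getD, List.getElem?_append_right h]

theorem getElem!_rotate {l : List V} (s : ℕ) {i : ℕ} (h : i < l.length) :
    (l.rotate s)[i]! = l[(i + s) % l.length]! := by
  simp [List.getElem!_eq_getElem?_getD, List.getElem?_rotate h]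

theorem getElem!_mem' {l : List V} {i : ℕ} (h : i < l.length) : l[i]! ∈ l := by
  rw [getElem!_pos l i h]; exact List.getElem_mem h

theorem exists_getElem!_eq {l : List V} {v : V} (h : v ∈ l) : ∃ i < l.length, l[i]! = v := by
  obtain ⟨i, hi, rfl⟩ := List.getElem_of_mem h
  exact ⟨i, hi, getElem!_pos l i hi⟩

theorem take_succ_eq_append {l : List V} {i : ℕ} (h : i < l.length) :
    l.take (i + 1) = l.take i ++ [l[i]!] := by
  rw [List.take_succ_eq_append_getElem h, getElem!_pos l i h]

theorem list_ext_getElem! {l l' : List V} (h : l.length = l'.length)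
    (h' : ∀ i < l.length, l[i]! = l'[i]!) : l = l' := by
  refine List.ext_getElem h fun i h1 h2 => ?_
  have := h' i h1
  rwa [getElem!_pos l i h1, getElem!_pos l' i h2] at this

theorem cycleGraph_adj_iff_val {m : ℕ} (hm : 3 ≤ m) (i j : Fin m) :
    (SimpleGraph.cycleGraph m).Adj i j ↔ j.val = i.val + 1 ∨ i.val = j.val + 1 ∨
      (i.val = 0 ∧ j.val + 1 = m) ∨ (j.val = 0 ∧ i.val + 1 = m) := by
  have hsub : ∀ a b : Fin m, (a - b).val = 1 ↔ a.val = b.val + 1 ∨ (a.val = 0 ∧ b.val + 1 = m) := by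
    intro a b
    have ha := a.2
    have hb := b.2
    rw [Fin.val_sub]
    rcases le_or_gt b.val a.val with h | h
    · rw [show m - b.val + a.val = (a.val - b.val) + m by omega, Nat.add_mod_right,
        Nat.mod_eq_of_lt (by omega)]
      omega
    · rw [Nat.mod_eq_of_lt (by omega)]
      omega
  rw [SimpleGraph.cycleGraph_adj', hsub, hsub]
  tauto

/-- A hole, listed in cyclic order from one of its vertices. -/
def IsRootedHole (G : SimpleGraph V) (l : List V) : Prop :=
  4 ≤ l.length ∧ l.Nodup ∧ ∀ i j, i < j → j < l.length →
    (G.Adj l[i]! l[j]! ↔ j = i + 1 ∨ (i = 0 ∧ j + 1 = l.length))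

namespace IsRootedHole

variable {l : List V}

theorem adj_iff (h : IsRootedHole G l) {i j : ℕ} (hi : i < l.length) (hj : j < l.length) :
    G.Adj l[i]! l[j]! ↔ j = i + 1 ∨ i = j + 1 ∨ (i = 0 ∧ j + 1 = l.length) ∨
      (j = 0 ∧ i + 1 = l.length) := by
  have h4 := h.1
  rcases lt_trichotomy i j with hij | rfl | hij
  · rw [h.2.2 i j hij hj]; omega
  · simp; omega
  · rw [G.adj_comm, h.2.2 j i hij hi]; omega

theorem inj (h : IsRootedHole G l) {i j : ℕ} (hi : i < l.length) (hj : j < l.length)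
    (hij : l[i]! = l[j]!) : i = j := by
  rw [getElem!_pos l i hi, getElem!_pos l j hj] at hij
  exact (h.2.1.getElem_inj_iff).1 hij

theorem adj_succ (h : IsRootedHole G l) {i : ℕ} (hi : i + 1 < l.length) :
    G.Adj l[i]! l[i + 1]! :=
  (h.adj_iff (by omega) hi).2 (Or.inl rfl)

theorem rotate (h : IsRootedHole G l) (s : ℕ) : IsRootedHole G (l.rotate s) := by
  have key : ∀ l : List V, IsRootedHole G l → IsRootedHole G (l.rotate 1) := by
    intro l h
    have h4 := h.1
    refine ⟨by rwa [List.length_rotate], List.nodup_rotate.2 h.2.1, fun i j hij hj => ?_⟩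
    rw [List.length_rotate] at hj ⊢
    rw [getElem!_rotate 1 (by omega), getElem!_rotate 1 hj, Nat.mod_eq_of_lt (show i + 1 < _ by omega)]
    by_cases hj1 : j + 1 = l.length
    · rw [hj1, Nat.mod_self, h.adj_iff (by omega) (by omega)]; omega
    · rw [Nat.mod_eq_of_lt (show j + 1 < _ by omega), h.adj_iff (by omega) (by omega)]; omega
  induction s with
  | zero => simpa using h
  | succ s ih => rw [← List.rotate_rotate]; exact key _ ih

theorem reverse (h : IsRootedHole G l) : IsRootedHole G l.reverse := by
  have h4 := h.1
  have hr : ∀ i < l.length, l.reverse[i]! = l[l.length - 1 - i]! := by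
    intro i hi
    rw [getElem!_pos _ _ (by simpa using hi), getElem!_pos _ _ (by omega), List.getElem_reverse]
  refine ⟨by rwa [List.length_reverse], List.nodup_reverse.2 h.2.1, fun i j hij hj => ?_⟩
  rw [List.length_reverse] at hj ⊢
  rw [hr i (by omega), hr j hj, h.adj_iff (by omega) (by omega)]
  omega

theorem isHole (h : IsRootedHole G l) : IsHole G {v | v ∈ l} := by
  classical
  refine ⟨l.length, h.1, ⟨RelIso.symm ⟨(h.2.1.getEquiv l), ?_⟩⟩⟩
  intro i j
  have hi := i.2
  have hj := j.2
  have h1 := h.adj_iff hi hj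
  rw [getElem!_pos l i.val hi, getElem!_pos l j.val hj] at h1
  have h4 := h.1
  rw [cycleGraph_adj_iff_val (by omega), ← h1]
  simp [List.Nodup.getEquiv]

end IsRootedHole

theorem IsHole.exists_list {S : Set V} (hS : IsHole G S) :
    ∃ l : List V, IsRootedHole G l ∧ ∀ w, w ∈ l ↔ w ∈ S := by
  obtain ⟨m, hm, ⟨e⟩⟩ := hS
  have hget : ∀ i (hi : i < m), (List.ofFn fun i : Fin m => (e.symm i : V))[i]! = e.symm ⟨i, hi⟩ := by
    intro i hi
    rw [getElem!_pos _ _ (by simpa using hi), List.getElem_ofFn]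
  refine ⟨List.ofFn fun i : Fin m => (e.symm i : V), ⟨by simpa using hm, ?_, ?_⟩, ?_⟩
  · exact List.nodup_ofFn.2 fun i j hij => e.symm.injective (Subtype.ext hij)
  · intro i j hij hj
    rw [List.length_ofFn] at hj ⊢
    have h1 : (G.induce S).Adj (e.symm ⟨i, by omega⟩) (e.symm ⟨j, hj⟩) ↔
        (SimpleGraph.cycleGraph m).Adj ⟨i, by omega⟩ ⟨j, hj⟩ := e.symm.map_adj_iff
    rw [cycleGraph_adj_iff_val (by omega)] at h1
    rw [hget i (by omega), hget j hj]
    refine Iff.trans h1 ?_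
    simp only
    omega
  · intro w
    rw [List.mem_ofFn]
    constructor
    · rintro ⟨i, rfl⟩
      exact (e.symm i).2
    · intro hw
      exact ⟨e ⟨w, hw⟩, by simp⟩

/-- A hole can be listed so that a given vertex comes at a given place. -/
theorem IsHole.exists_list_getElem {S : Set V} (hS : IsHole G S) {v : V} (hv : v ∈ S) {k : ℕ}
    (hk : k < 4) : ∃ l : List V, IsRootedHole G l ∧ (∀ w, w ∈ l ↔ w ∈ S) ∧ l[k]! = v := by
  obtain ⟨l, hl, hlS⟩ := hS.exists_list
  obtain ⟨i, hi, rfl⟩ := exists_getElem!_eq ((hlS v).2 hv)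
  have h4 := hl.1
  refine ⟨l.rotate (i + (l.length - k)), hl.rotate _, fun w => by rw [List.mem_rotate, hlS], ?_⟩
  rw [getElem!_rotate _ (by omega), show k + (i + (l.length - k)) = i + l.length by omega,
    Nat.add_mod_right, Nat.mod_eq_of_lt hi]

end RootedHole

/-! ### Upper bounds for the number of holes -/

section HoleBounds

open scoped Classical

variable {V : Type u} {G : SimpleGraph V}

/-- The induced paths counted by `pathCount`, listed without their first vertex. -/
def ValidPath (G : SimpleGraph V) (T : Set V) : V → Finset V → List V → Prop
  | x, _, [] => x ∈ T
  | x, W, y :: p => x ∉ T ∧ y ∈ W ∧ G.Adj x y ∧ ValidPath G T y (W.filter fun w => ¬ G.Adj x w) p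

/-- A path is determined by its first vertex and its tail, and the tail is a path from there with
the neighbours of x removed. This matches the recursion of `pathCount`; the step budget only has to
bound the lengths. -/
theorem card_le_pathCount [Inhabited V] {T : Set V} (k : ℕ) (x : V) (W : Finset V)
    (A : Finset (List V)) (hA : ∀ p ∈ A, ValidPath G T x W p ∧ p.length ≤ k) :
    A.card ≤ pathCount G T k x W := by
  induction k generalizing x W A with
  | zero =>
    have h0 : A ⊆ {[]} := fun p hp => by simpa using (hA p hp).2
    by_cases hx : x ∈ T
    · rw [pathCount_of_mem hx]
      simpa using Finset.card_le_card h0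
    · rw [pathCount_zero_of_notMem hx, Nat.le_zero, Finset.card_eq_zero]
      refine Finset.eq_empty_of_forall_notMem fun p hp => hx ?_
      have h1 := (hA p hp).1
      rw [Finset.mem_singleton.1 (h0 hp)] at h1
      exact h1
  | succ k ih =>
    by_cases hx : x ∈ T
    · rw [pathCount_of_mem hx]
      have h0 : A ⊆ {[]} := by
        intro p hp
        rcases p with _ | ⟨y, p⟩
        · simp
        · exact absurd hx (hA _ hp).1.1
      simpa using Finset.card_le_card h0
    · rw [pathCount_succ_of_notMem hx]
      have hcons : ∀ p ∈ A, ∃ y q, p = y :: q ∧ y ∈ W ∧ G.Adj x y ∧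
          ValidPath G T y (W.filter fun w => ¬ G.Adj x w) q ∧ q.length ≤ k := by
        intro p hp
        have := hA p hp
        rcases p with _ | ⟨y, p⟩
        · exact absurd this.1 hx
        · exact ⟨y, p, rfl, this.1.2.1, this.1.2.2.1, this.1.2.2.2, by simpa using this.2⟩
      rw [Finset.card_eq_sum_card_fiberwise (f := List.headI) (t := W.filter (G.Adj x))]
      · refine Finset.sum_le_sum fun y hy => ?_
        refine le_trans (le_of_eq ?_) (ih y _ ((A.filter fun p => p.headI = y).image List.tail) ?_)
        · refine (Finset.card_image_of_injOn ?_).symm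
          intro p hp q hq hpq
          simp only [Finset.coe_filter, Set.mem_ofPred_eq] at hp hq
          obtain ⟨a, p, rfl, -⟩ := hcons p hp.1
          obtain ⟨b, q, rfl, -⟩ := hcons q hq.1
          simp only [List.headI_cons, List.tail_cons] at *
          rw [hp.2, hq.2, hpq]
        · intro q hq
          rw [Finset.mem_image] at hq
          obtain ⟨p, hp, rfl⟩ := hq
          rw [Finset.mem_filter] at hp
          obtain ⟨a, p, rfl, -, -, h⟩ := hcons p hp.1
          simp only [List.headI_cons, List.tail_cons] at *
          rw [← hp.2]
          exact h
      · intro p hp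
        obtain ⟨a, p, rfl, h1, h2, -⟩ := hcons p hp
        simp [h1, h2]

/-- The number of holes inside `U` through `v`. -/
noncomputable def holesThrough (G : SimpleGraph V) (U : Finset V) (v : V) : ℕ :=
  {S : Set V | IsHole G S ∧ S ⊆ U ∧ v ∈ S}.ncard

theorem holesThrough_univ [Fintype V] (v : V) :
    holesThrough G Finset.univ v = {S : Set V | IsHole G S ∧ v ∈ S}.ncard := by
  simp [holesThrough]

variable [Inhabited V]

/-- The vertices beyond l[i + 1] are not neighbours of l[i] when i is an inner place, so they stay
available. The path must not stop early, hence T is met by the last vertex only. -/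
theorem IsRootedHole.validPath {l : List V} (hl : IsRootedHole G l) {T : Set V} {W : Finset V} {i : ℕ}
    (hi : 1 ≤ i) (hil : i < l.length) (hW : ∀ k, i < k → k < l.length → l[k]! ∈ W)
    (hT : ∀ k, i ≤ k → k < l.length → (l[k]! ∈ T ↔ k + 1 = l.length)) :
    ValidPath G T l[i]! W (l.drop (i + 1)) := by
  induction h : l.length - i generalizing i W with
  | zero => omega
  | succ m ih =>
    by_cases hlast : i + 1 = l.length
    · rw [hlast, List.drop_length]
      exact (hT i le_rfl hil).2 hlast
    · rw [List.drop_eq_getElem_cons (show i + 1 < l.length by omega), ← getElem!_pos l (i + 1)]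
      refine ⟨fun h => hlast ((hT i le_rfl hil).1 h), hW _ (by omega) (by omega),
        hl.adj_succ (by omega), ?_⟩
      refine ih (by omega) (by omega) ?_ (fun k hk => hT k (by omega)) (by omega)
      intro k hk hkl
      rw [Finset.mem_filter, hl.adj_iff hil hkl]
      exact ⟨hW k (by omega) hkl, by omega⟩

theorem eq_cons_cons_cons_drop {l : List V} (hl : 3 ≤ l.length) :
    l = l[0]! :: l[1]! :: l[2]! :: l.drop 3 := by
  rcases l with _ | ⟨a, _ | ⟨b, _ | ⟨c, l⟩⟩⟩ <;> simp at hl ⊢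

variable [Fintype V]

theorem IsRootedHole.length_le {l : List V} (hl : IsRootedHole G l) : l.length ≤ Fintype.card V :=
  hl.2.1.length_le_card

/-- The first three vertices are fixed, and the rest of the listing is an induced path from a. -/
theorem card_le_pathCount_of_isRootedHole (b v a : V) (T : Set V) (W : Finset V)
    (A : Finset (List V)) (hA : ∀ l ∈ A, IsRootedHole G l ∧ l[0]! = b ∧ l[1]! = v ∧ l[2]! = a)
    (hW : ∀ l ∈ A, ∀ k, 3 ≤ k → k < l.length → l[k]! ∈ W)
    (hT : ∀ l ∈ A, ∀ k, 2 ≤ k → k < l.length → (l[k]! ∈ T ↔ k + 1 = l.length)) :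
    A.card ≤ pathCount G T (Fintype.card V) a W := by
  refine le_trans (le_of_eq ?_) (card_le_pathCount _ a W (A.image (List.drop 3)) ?_)
  · refine (Finset.card_image_of_injOn fun l hl l' hl' h => ?_).symm
    have h1 := hA l hl
    have h2 := hA l' hl'
    have h3 := h1.1.1
    have h4 := h2.1.1
    rw [eq_cons_cons_cons_drop (show 3 ≤ l.length by omega),
      eq_cons_cons_cons_drop (show 3 ≤ l'.length by omega)]
    rw [h1.2.1, h1.2.2.1, h1.2.2.2, h2.2.1, h2.2.2.1, h2.2.2.2]
    simpa using h
  · intro p hp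
    obtain ⟨l, hl, rfl⟩ := Finset.mem_image.1 hp
    have h1 := hA l hl
    have h4 := h1.1.1
    have hlen := h1.1.length_le
    refine ⟨?_, by rw [List.length_drop]; omega⟩
    rw [← h1.2.2.2]
    exact h1.1.validPath (by omega) (by omega) (fun k hk => hW l hl k hk) (hT l hl)

/-- The rooted holes of a graph. -/
noncomputable def rootedHoles (G : SimpleGraph V) : Finset (List V) :=
  Set.Finite.toFinset (s := {l | IsRootedHole G l})
    ((List.finite_length_le V (Fintype.card V)).subset fun _ hl => IsRootedHole.length_le hl)

@[simp]
theorem mem_rootedHoles {l : List V} : l ∈ rootedHoles G ↔ IsRootedHole G l := by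
  simp [rootedHoles]

/-- The vertex v is put at place 1, not 0, so that its two neighbours in the hole are l[0] and l[2].
-/
theorem holesThrough_le_card (U : Finset V) (v : V) :
    holesThrough G U v ≤
      ((rootedHoles G).filter fun l => (∀ w ∈ l, w ∈ U) ∧ l[1]! = v).card := by
  have h : ∀ S : Set V, ∃ l : List V, IsHole G S → v ∈ S →
      IsRootedHole G l ∧ (∀ w, w ∈ l ↔ w ∈ S) ∧ l[1]! = v := by
    intro S
    by_cases hS : IsHole G S ∧ v ∈ S
    · obtain ⟨l, hl⟩ := hS.1.exists_list_getElem hS.2 (k := 1) (by norm_num)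
      exact ⟨l, fun _ _ => hl⟩
    · exact ⟨[], fun h1 h2 => absurd ⟨h1, h2⟩ hS⟩
  choose f hf using h
  rw [holesThrough, ← Set.ncard_coe_finset]
  refine Set.ncard_le_ncard_of_injOn f ?_ ?_ (Finset.finite_toSet _)
  · rintro S ⟨hS, hSU, hv⟩
    obtain ⟨h1, h2, h3⟩ := hf S hS hv
    simp only [Finset.coe_filter, mem_rootedHoles, Set.mem_ofPred_eq]
    exact ⟨h1, fun w hw => hSU ((h2 w).1 hw), h3⟩
  · rintro S ⟨hS, hSU, hv⟩ S' ⟨hS', hSU', hv'⟩ h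
    ext w
    rw [← (hf S hS hv).2.1, ← (hf S' hS' hv').2.1, h]

/-- There are at most d² choices for the two neighbours b and a of v in the hole. The remaining
vertices form an induced path from a that stops at the first neighbour of b and avoids v and all its
neighbours. -/
theorem holesThrough_le (U : Finset V) (v : V) (hv : v ∈ U) :
    holesThrough G U v ≤ (U.filter (G.Adj v)).card ^ 2 *
      maxProd (U.card - 1 - (U.filter (G.Adj v)).card) := by
  refine (holesThrough_le_card U v).trans ?_
  set N := U.filter (G.Adj v)
  set A := (rootedHoles G).filter fun l => (∀ w ∈ l, w ∈ U) ∧ l[1]! = v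
  have hA : ∀ l ∈ A, IsRootedHole G l ∧ (∀ w ∈ l, w ∈ U) ∧ l[1]! = v := by
    intro l hl
    simpa [A] using hl
  rw [Finset.card_eq_sum_card_fiberwise (f := fun l => (l[0]!, l[2]!)) (t := N ×ˢ N)]
  · rw [sq, ← Finset.card_product, ← smul_eq_mul]
    refine Finset.sum_le_card_nsmul _ _ _ fun ba _ => ?_
    obtain ⟨b, a⟩ := ba
    have hcard : ((U.erase v).filter fun w => ¬ G.Adj v w).card = U.card - 1 - N.card := by
      have h1 := card_filter_adj_add (G := G) v (U.erase v)
      have h2 : (U.erase v).filter (G.Adj v) = N := by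
        ext w
        simp only [N, Finset.mem_filter, Finset.mem_erase]
        exact ⟨fun h => ⟨h.1.2, h.2⟩, fun h => ⟨⟨h.2.ne', h.1⟩, h.2⟩⟩
      rw [h2, Finset.card_erase_of_mem hv] at h1
      omega
    rw [← hcard]
    refine le_trans ?_ (pathCount_le (G := G) (T := {w | G.Adj b w}) (Fintype.card V) a _)
    refine card_le_pathCount_of_isRootedHole b v a _ _ _ ?_ ?_ ?_
    · intro l hl
      simp only [Finset.mem_filter, Prod.mk.injEq] at hl
      exact ⟨(hA l hl.1).1, hl.2.1, (hA l hl.1).2.2, hl.2.2⟩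
    · intro l hl k hk hkl
      rw [Finset.mem_filter] at hl
      obtain ⟨h1, h2, h3⟩ := hA l hl.1
      rw [Finset.mem_filter, Finset.mem_erase, ← h3, h1.adj_iff (by omega) hkl]
      refine ⟨⟨fun h => ?_, h2 _ (getElem!_mem' hkl)⟩, by omega⟩
      have := h1.inj hkl (by omega) h
      omega
    · intro l hl k hk hkl
      simp only [Finset.mem_filter, Prod.mk.injEq] at hl
      obtain ⟨h1, h2, h3⟩ := hA l hl.1
      rw [Set.mem_ofPred_eq, ← hl.2.1, h1.adj_iff (by omega) hkl]
      omega
  · intro l hl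
    obtain ⟨h1, h2, h3⟩ := hA l hl
    have h4 := h1.1
    simp only [N, Finset.coe_product, Set.mem_prod, Finset.mem_coe, Finset.mem_filter, ← h3]
    exact ⟨⟨h2 _ (getElem!_mem' (by omega)), (h1.adj_succ (by omega)).symm⟩,
      h2 _ (getElem!_mem' (by omega)), h1.adj_succ (by omega)⟩

theorem holesThrough_le_five_mul (U : Finset V) (v : V) (hv : v ∈ U) :
    holesThrough G U v ≤ 5 * maxProd (U.card - 1) := by
  refine (holesThrough_le U v hv).trans ?_
  set d := (U.filter (G.Adj v)).card with hd
  have h1 : d ≤ U.card - 1 := by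
    have h2 : U.filter (G.Adj v) ⊆ U.erase v := by
      intro w hw
      rw [Finset.mem_filter] at hw
      exact Finset.mem_erase.2 ⟨hw.2.ne', hw.1⟩
    have := Finset.card_le_card h2
    rwa [Finset.card_erase_of_mem hv] at this
  calc d ^ 2 * maxProd (U.card - 1 - d) ≤ (5 * maxProd d) * maxProd (U.card - 1 - d) :=
        Nat.mul_le_mul_right _ (sq_le_five_mul_maxProd d)
    _ = 5 * (maxProd d * maxProd (U.card - 1 - d)) := by ring
    _ ≤ 5 * maxProd (d + (U.card - 1 - d)) := Nat.mul_le_mul_left _ (maxProd_mul_le _ _)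
    _ = _ := by rw [Nat.add_sub_cancel' h1]

/-- Vertices are added one at a time, each contributing at most 5 times `maxProd` of the number
already present; the geometric sum contributes the factor 3. -/
theorem ncard_holes_subset_le (U : Finset V) :
    {S : Set V | IsHole G S ∧ S ⊆ U}.ncard ≤ 15 * maxProd U.card := by
  have h : {S : Set V | IsHole G S ∧ S ⊆ U}.ncard ≤ ∑ i ∈ Finset.range U.card, 5 * maxProd i := by
    induction U using Finset.induction_on with
    | empty =>
      have : {S : Set V | IsHole G S ∧ S ⊆ ((∅ : Finset V) : Set V)} = ∅ := by
        refine Set.eq_empty_of_forall_notMem ?_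
        rintro S ⟨hS, hSe⟩
        obtain ⟨l, hl, hlS⟩ := hS.exists_list
        have h4 := hl.1
        simpa using hSe ((hlS _).1 (getElem!_mem' (l := l) (i := 0) (by omega)))
      rw [this]; simp
    | insert v U hv ih =>
      rw [Finset.card_insert_of_notMem hv, Finset.sum_range_succ]
      have hsub : {S : Set V | IsHole G S ∧ S ⊆ (insert v U : Finset V)} ⊆
          {S : Set V | IsHole G S ∧ S ⊆ U} ∪
          {S : Set V | IsHole G S ∧ S ⊆ (insert v U : Finset V) ∧ v ∈ S} := by
        rintro S ⟨hS, hSU⟩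
        by_cases hvS : v ∈ S
        · exact Or.inr ⟨hS, hSU, hvS⟩
        · left
          refine ⟨hS, fun w hw => ?_⟩
          rcases Finset.mem_insert.1 (hSU hw) with rfl | h
          · exact absurd hw hvS
          · exact h
      refine (Set.ncard_le_ncard hsub (Set.toFinite _)).trans ((Set.ncard_union_le _ _).trans ?_)
      refine Nat.add_le_add ih ?_
      have := holesThrough_le_five_mul (G := G) (insert v U) v (by simp)
      rwa [Finset.card_insert_of_notMem hv, Nat.add_sub_cancel] at this
  rw [← Finset.mul_sum] at h
  have := sum_maxProd_le U.card
  omega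

theorem holeCount_le : holeCount G ≤ 15 * maxProd (Fintype.card V) := by
  have := ncard_holes_subset_le (G := G) Finset.univ
  simpa [holeCount] using this

/-- If every vertex lies in a fifth of at least `maxProd n` holes, all degrees are bounded. -/
theorem degree_le_of_holesThrough (hM : maxProd (Fintype.card V) ≤ holeCount G)
    (h5 : ∀ v, holeCount G ≤ 5 * holesThrough G Finset.univ v) (v : V) :
    (Finset.univ.filter (G.Adj v)).card ≤ 30 := by
  by_contra! hd
  set d := (Finset.univ.filter (G.Adj v)).card with hdd
  have h1 := holesThrough_le (G := G) Finset.univ v (Finset.mem_univ v)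
  rw [← hdd, Finset.card_univ] at h1
  have h2 := h5 v
  have h3 := maxProd_large (show 30 ≤ d by omega)
  have hdn : d ≤ Fintype.card V - 1 := by
    have h2 : Finset.univ.filter (G.Adj v) ⊆ Finset.univ.erase v := by
      intro w hw
      rw [Finset.mem_filter] at hw
      exact Finset.mem_erase.2 ⟨hw.2.ne', hw.1⟩
    have := Finset.card_le_card h2
    rwa [Finset.card_erase_of_mem (Finset.mem_univ v), Finset.card_univ] at this
  have h4 := maxProd_mul_le d (Fintype.card V - 1 - d)
  have h5 := maxProd_mono (show d + (Fintype.card V - 1 - d) ≤ Fintype.card V by omega)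
  have h6 := maxProd_pos (Fintype.card V - 1 - d)
  nlinarith

/-- Each hole through v has a listing with v at place 1, so summing over v counts rooted holes. -/
theorem card_mul_maxProd_le (hM : maxProd (Fintype.card V) ≤ holeCount G)
    (h5 : ∀ v, holeCount G ≤ 5 * holesThrough G Finset.univ v) :
    Fintype.card V * maxProd (Fintype.card V) ≤ 5 * (rootedHoles G).card := by
  have h1 : (rootedHoles G).card = ∑ v : V, ((rootedHoles G).filter fun l => l[1]! = v).card :=
    Finset.card_eq_sum_card_fiberwise fun _ _ => Finset.mem_coe.2 (Finset.mem_univ _)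
  rw [h1, Finset.mul_sum, ← Finset.card_univ, ← smul_eq_mul]
  refine Finset.card_nsmul_le_sum _ _ _ fun v _ => ?_
  refine (Finset.card_univ (α := V) ▸ hM).trans ((h5 v).trans (Nat.mul_le_mul_left 5 ?_))
  refine (holesThrough_le_card _ v).trans (Finset.card_le_card fun l hl => ?_)
  simp only [Finset.mem_filter] at hl ⊢
  exact ⟨hl.1, hl.2.2⟩

end HoleBounds

/-! ### Entropy of branching trees -/

section BranchingEntropy

open scoped Classical

/-- Gibbs' inequality for counts. -/
theorem sum_mul_log_sub_log_le {ι : Type*} (C : Finset ι) (N : ι → ℕ) (q : ι → ℝ)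
    (hq : ∀ w ∈ C, 0 < q w) (hq1 : ∑ w ∈ C, q w ≤ 1) :
    ∑ w ∈ C, (N w : ℝ) * (Real.log (∑ w ∈ C, N w : ℕ) - Real.log (N w)) ≤
      ∑ w ∈ C, (N w : ℝ) * (- Real.log (q w)) := by
  set S : ℕ := ∑ w ∈ C, N w with hS
  have h : ∀ w ∈ C, (N w : ℝ) * (Real.log S - Real.log (N w)) ≤
      (N w : ℝ) * (- Real.log (q w)) + ((S : ℝ) * q w - N w) := by
    intro w hw
    rcases Nat.eq_zero_or_pos (N w) with h0 | hpos
    · rw [h0]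
      have := hq w hw
      simp only [Nat.cast_zero, zero_mul, zero_add, sub_zero]
      positivity
    · have hN : (0 : ℝ) < N w := by exact_mod_cast hpos
      have hSp : (0 : ℝ) < S := by
        have : N w ≤ S := Finset.single_le_sum (fun _ _ => Nat.zero_le _) hw
        exact_mod_cast (by omega : 0 < S)
      have hl := Real.log_le_sub_one_of_pos (show 0 < (S : ℝ) * q w / N w by
        have := hq w hw; positivity)
      rw [Real.log_div (by have := hq w hw; positivity) hN.ne', Real.log_mul hSp.ne' (hq w hw).ne']
        at hl
      have := mul_le_mul_of_nonneg_left hl hN.le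
      have h2 : (N w : ℝ) * ((S : ℝ) * q w / N w - 1) = (S : ℝ) * q w - N w := by
        field_simp
      rw [h2] at this
      linarith
  refine (Finset.sum_le_sum h).trans ?_
  rw [Finset.sum_add_distrib, Finset.sum_sub_distrib, ← Finset.mul_sum]
  have h3 : (∑ w ∈ C, (N w : ℝ)) = S := by rw [hS]; push_cast; rfl
  rw [h3]
  have : (S : ℝ) * ∑ w ∈ C, q w ≤ S * 1 := mul_le_mul_of_nonneg_left hq1 (Nat.cast_nonneg _)
  linarith

/-- Among positive integers e^(1/e) is largest at 3. The factor 8/9 is attained at e = 2. -/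
theorem cube_le_three_pow (e : ℕ) : e ^ 3 ≤ 3 ^ e ∧ (e ≠ 3 → 9 * e ^ 3 ≤ 8 * 3 ^ e) := by
  by_cases h : e < 5
  · interval_cases e <;> decide
  · have : 9 * e ^ 3 ≤ 8 * 3 ^ e := by
      induction e with
      | zero => omega
      | succ e ih =>
        by_cases he : e < 5
        · have : e = 4 := by omega
          subst this; decide
        · have := ih he
          rw [pow_succ 3 e]
          have h2 : (e + 1) ^ 3 ≤ 3 * e ^ 3 := by nlinarith [sq_nonneg (e : ℤ), sq_nonneg e]
          omega
    exact ⟨by omega, fun _ => this⟩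

theorem log_natCast_le (e : ℕ) (he : 0 < e) :
    Real.log e ≤ e * (Real.log 3 / 3) ∧
      (e ≠ 3 → Real.log e ≤ e * (Real.log 3 / 3) - Real.log (9 / 8) / 3) := by
  have hpos : (0 : ℝ) < e := by exact_mod_cast he
  obtain ⟨h1, h2⟩ := cube_le_three_pow e
  constructor
  · have h : Real.log ((e : ℝ) ^ 3) ≤ Real.log ((3 : ℝ) ^ e) :=
      Real.log_le_log (by positivity) (by exact_mod_cast h1)
    rw [Real.log_pow, Real.log_pow] at h
    push_cast at h
    linarith
  · intro h3
    have h : Real.log ((9 / 8 : ℝ) * (e : ℝ) ^ 3) ≤ Real.log ((3 : ℝ) ^ e) := by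
      refine Real.log_le_log (by positivity) ?_
      have : (9 : ℝ) * (e : ℝ) ^ 3 ≤ 8 * (3 : ℝ) ^ e := by exact_mod_cast h2 h3
      linarith
    rw [Real.log_mul (by norm_num) (by positivity), Real.log_pow, Real.log_pow] at h
    push_cast at h
    linarith

/-- Concerns three options of which one has a share below 1/10. Against the test distribution 1/9,
4/9, 4/9 the cross entropy is log (9/4) plus that share times log 4, which stays below log 3 by the
same margin that a wrong number of options costs. -/
theorem log_low_share :
    Real.log (9 / 4) + Real.log 4 / 10 ≤ Real.log 3 - Real.log (9 / 8) / 3 := by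
  have h : Real.log ((9 / 4 : ℝ) ^ 30 * 4 ^ 3 * (9 / 8) ^ 10) ≤ Real.log ((3 : ℝ) ^ 30) :=
    Real.log_le_log (by positivity) (by norm_num)
  rw [Real.log_mul (by positivity) (by positivity), Real.log_mul (by positivity) (by positivity),
    Real.log_pow, Real.log_pow, Real.log_pow, Real.log_pow] at h
  push_cast at h
  linarith

/-- Branching into other than three options, or very unevenly, costs a constant. -/
theorem sum_mul_log_le {ι : Type*} (C : Finset ι) (N : ι → ℕ) :
    ∑ w ∈ C, (N w : ℝ) * (Real.log (∑ w ∈ C, N w : ℕ) - Real.log (N w)) ≤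
      (∑ w ∈ C, N w : ℕ) * (C.card * (Real.log 3 / 3)) ∧
    ((C.card ≠ 3 ∨ ∃ w ∈ C, 10 * N w < ∑ w ∈ C, N w) →
      ∑ w ∈ C, (N w : ℝ) * (Real.log (∑ w ∈ C, N w : ℕ) - Real.log (N w)) ≤
        (∑ w ∈ C, N w : ℕ) * (C.card * (Real.log 3 / 3) - Real.log (9 / 8) / 3)) := by
  rcases C.eq_empty_or_nonempty with rfl | hne
  · simp
  have hc : 0 < C.card := Finset.card_pos.2 hne
  have hcR : (0 : ℝ) < C.card := by exact_mod_cast hc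
  have hunif := sum_mul_log_sub_log_le C N (fun _ => (C.card : ℝ)⁻¹) (fun _ _ => by positivity)
    (by rw [Finset.sum_const, nsmul_eq_mul, mul_inv_cancel₀ hcR.ne'])
  rw [← Finset.sum_mul, Real.log_inv, neg_neg, ← Nat.cast_sum] at hunif
  obtain ⟨h1, h2⟩ := log_natCast_le C.card hc
  refine ⟨hunif.trans (mul_le_mul_of_nonneg_left h1 (Nat.cast_nonneg _)), fun hdef => ?_⟩
  by_cases h3 : C.card = 3
  swap
  · exact hunif.trans (mul_le_mul_of_nonneg_left (h2 h3) (Nat.cast_nonneg _))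
  obtain ⟨w₀, hw₀, hlow⟩ := hdef.resolve_left (by simpa using h3)
  have hq := sum_mul_log_sub_log_le C N (fun w => if w = w₀ then 1 / 9 else 4 / 9)
    (fun w _ => by split_ifs <;> norm_num) (by
      rw [← Finset.add_sum_erase _ _ hw₀, Finset.sum_congr rfl (g := fun _ => (4 / 9 : ℝ))
        (fun w hw => if_neg (Finset.ne_of_mem_erase hw)), Finset.sum_const,
        Finset.card_erase_of_mem hw₀, h3]
      norm_num)
  refine hq.trans ?_
  rw [← Finset.add_sum_erase _ _ hw₀, if_pos rfl, Finset.sum_congr rfl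
    (g := fun w => (N w : ℝ) * Real.log (9 / 4)) (fun w hw => by
      rw [if_neg (Finset.ne_of_mem_erase hw), ← Real.log_inv]; norm_num), ← Finset.sum_mul]
  have hS : (N w₀ : ℝ) + ∑ w ∈ C.erase w₀, (N w : ℝ) = (∑ w ∈ C, N w : ℕ) := by
    rw [Finset.add_sum_erase C (fun w => (N w : ℝ)) hw₀]; push_cast; rfl
  set S : ℕ := ∑ w ∈ C, N w
  have hlowR : 10 * (N w₀ : ℝ) ≤ S := by exact_mod_cast hlow.le
  have h9 : - Real.log (1 / 9) = Real.log (9 / 4) + Real.log 4 := by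
    rw [← Real.log_mul (by norm_num) (by norm_num), ← Real.log_inv]; norm_num
  have h4 : 0 ≤ Real.log 4 := Real.log_nonneg (by norm_num)
  rw [h9, h3]
  have hls := mul_le_mul_of_nonneg_left log_low_share (Nat.cast_nonneg (α := ℝ) S)
  have h10 := mul_le_mul_of_nonneg_right hlowR h4
  have h11 : (∑ w ∈ C.erase w₀, (N w : ℝ)) = S - N w₀ := by linarith
  rw [h11]
  push_cast
  nlinarith

/-- By log x ≤ x - 1 with x = 3^(r/3) / N, the left side is at most 3^(r/3) - N. -/
theorem mul_sub_log_le_maxProd (N r : ℕ) :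
    (N : ℝ) * (r * (Real.log 3 / 3) - Real.log N) ≤ 3 / 2 * maxProd r := by
  have hexp : Real.exp (r * (Real.log 3 / 3)) ≤ 3 / 2 * maxProd r := by
    refine le_of_pow_le_pow_left₀ (n := 3) (by norm_num) (by positivity) ?_
    rw [← Real.exp_nat_mul, show ((3 : ℕ) : ℝ) * (r * (Real.log 3 / 3)) = r * Real.log 3 by
      push_cast; ring, Real.exp_nat_mul, Real.exp_log (by norm_num), mul_pow]
    have : (8 : ℝ) * 3 ^ r ≤ 27 * (maxProd r : ℝ) ^ 3 := by exact_mod_cast eight_mul_three_pow_le r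
    linarith
  refine le_trans ?_ hexp
  rcases Nat.eq_zero_or_pos N with rfl | hpos
  · simp; positivity
  have hN : (0 : ℝ) < N := by exact_mod_cast hpos
  have h1 := Real.log_le_sub_one_of_pos (show 0 < Real.exp (r * (Real.log 3 / 3)) / N by positivity)
  rw [Real.log_div (by positivity) hN.ne', Real.log_exp] at h1
  have h2 := mul_le_mul_of_nonneg_left h1 hN.le
  have h3 : (N : ℝ) * (Real.exp (r * (Real.log 3 / 3)) / N - 1) =
      Real.exp (r * (Real.log 3 / 3)) - N := by field_simp
  linarith

variable {V : Type u}

/-- The members of `Ω` that extend `τ`. -/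
noncomputable def extensions (Ω : Finset (List V)) (τ : List V) : Finset (List V) :=
  Ω.filter (τ <+: ·)

/-- At `τ` the branching of `Ω` into the options `C τ` is not threefold, or is very uneven. -/
def IsDefect (Ω : Finset (List V)) (C : List V → Finset V) (τ : List V) : Prop :=
  (C τ).card ≠ 3 ∨ ∃ w ∈ C τ, 10 * (extensions Ω (τ ++ [w])).card < (extensions Ω τ).card

variable [Inhabited V]

theorem isPrefix_append_singleton_iff {τ l : List V} {w : V} :
    τ ++ [w] <+: l ↔ τ <+: l ∧ τ.length < l.length ∧ l[τ.length]! = w := by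
  constructor
  · rintro ⟨t, rfl⟩
    refine ⟨⟨[w] ++ t, by simp⟩, by simp, ?_⟩
    rw [List.append_assoc, getElem!_append_right' le_rfl]
    simp
  · rintro ⟨⟨t, rfl⟩, h1, rfl⟩
    rw [getElem!_append_right' le_rfl]
    rcases t with _ | ⟨a, t⟩
    · simp at h1
    · exact ⟨t, by simp⟩

/-- The right side is a potential: N paths extend τ and r τ vertices remain. Branching into c
options lowers r by at least c, and the entropy N log N - Σ N_w log N_w is at most N c (log 3)/3,
less by N log (9/8)/3 at a defect. So the potential pays for each defect, and at a leaf, where N =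
1, what is left of it pays for the wasted vertices. -/
theorem sum_defects_add_waste_le_aux (Ω : Finset (List V)) (C : List V → Finset V) (r waste : List V → ℕ)
    (k₀ : ℕ) (hpf : ∀ l ∈ Ω, ∀ l' ∈ Ω, l <+: l' → l = l')
    (hC : ∀ l ∈ Ω, ∀ i, k₀ ≤ i → i < l.length → l[i]! ∈ C (l.take i))
    (hr : ∀ l ∈ Ω, ∀ i, k₀ ≤ i → i < l.length →
      r (l.take (i + 1)) + (C (l.take i)).card ≤ r (l.take i))
    (hw : ∀ l ∈ Ω, waste l ≤ r l) (m : ℕ) (τ : List V) (hτ : k₀ ≤ τ.length)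
    (hm : ∀ l ∈ extensions Ω τ, l.length ≤ τ.length + m) :
    Real.log (9 / 8) / 3 * (∑ l ∈ extensions Ω τ,
      (((Finset.Ico τ.length l.length).filter fun i => IsDefect Ω C (l.take i)).card + waste l) : ℕ) ≤
    ((extensions Ω τ).card : ℝ) * (r τ * (Real.log 3 / 3) - Real.log (extensions Ω τ).card) := by
  have hδ : 0 ≤ Real.log (9 / 8) / 3 := by
    have := Real.log_nonneg (show (1 : ℝ) ≤ 9 / 8 by norm_num)
    positivity
  have hδl : Real.log (9 / 8) / 3 ≤ Real.log 3 / 3 := by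
    have := Real.log_le_log (show (0 : ℝ) < 9 / 8 by norm_num) (show (9 / 8 : ℝ) ≤ 3 by norm_num)
    linarith
  have hleaf : ∀ τ, (∀ l ∈ extensions Ω τ, l = τ) →
      Real.log (9 / 8) / 3 * (∑ l ∈ extensions Ω τ,
      (((Finset.Ico τ.length l.length).filter fun i => IsDefect Ω C (l.take i)).card + waste l) : ℕ) ≤
      ((extensions Ω τ).card : ℝ) * (r τ * (Real.log 3 / 3) - Real.log (extensions Ω τ).card) := by
    intro τ h
    rcases (extensions Ω τ).eq_empty_or_nonempty with h0 | ⟨l, hl⟩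
    · rw [h0]; simp
    · have hlτ := h l hl
      subst hlτ
      have h1 : extensions Ω l = {l} := by
        ext l'
        rw [Finset.mem_singleton]
        exact ⟨h l', fun h => h ▸ hl⟩
      rw [h1]
      have h2 := hw l (Finset.mem_filter.1 hl).1
      have h3 : (waste l : ℝ) ≤ r l := by exact_mod_cast h2
      simp only [Finset.sum_singleton, Finset.Ico_self, Finset.filter_empty, Finset.card_empty,
        zero_add, Finset.card_singleton, Nat.cast_one, Real.log_one, sub_zero, one_mul]
      calc Real.log (9 / 8) / 3 * (waste l : ℝ) ≤ Real.log 3 / 3 * r l :=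
            mul_le_mul hδl h3 (Nat.cast_nonneg _) (hδ.trans hδl)
        _ = _ := by ring
  induction m generalizing τ with
  | zero =>
    refine hleaf τ fun l hl => ?_
    have h1 := hm l hl
    exact ((Finset.mem_filter.1 hl).2.eq_of_length_le (by omega)).symm
  | succ m ih =>
    by_cases hτΩ : τ ∈ Ω
    · exact hleaf τ fun l hl => (hpf τ hτΩ l (Finset.mem_filter.1 hl).1 (Finset.mem_filter.1 hl).2).symm
    have hprop : ∀ l ∈ extensions Ω τ, l ∈ Ω ∧ τ <+: l ∧ τ.length < l.length := by
      intro l hl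
      obtain ⟨h1, h2⟩ := Finset.mem_filter.1 hl
      refine ⟨h1, h2, lt_of_le_of_ne h2.length_le fun h => hτΩ ?_⟩
      rw [h2.eq_of_length h]
      exact h1
    have hfib : ∀ w, (extensions Ω τ).filter (fun l => l[τ.length]! = w) =
        extensions Ω (τ ++ [w]) := by
      intro w
      ext l
      simp only [extensions, Finset.mem_filter, isPrefix_append_singleton_iff]
      constructor
      · rintro ⟨⟨h1, h2⟩, h3⟩
        exact ⟨h1, h2, (hprop l (Finset.mem_filter.2 ⟨h1, h2⟩)).2.2, h3⟩
      · rintro ⟨h1, h2, -, h3⟩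
        exact ⟨⟨h1, h2⟩, h3⟩
    have htake : ∀ l, τ <+: l → l.take τ.length = τ := fun l h => (List.prefix_iff_eq_take.1 h).symm
    have hmaps : ∀ l ∈ extensions Ω τ, l[τ.length]! ∈ C τ := by
      intro l hl
      obtain ⟨h1, h2, h3⟩ := hprop l hl
      have := hC l h1 τ.length hτ h3
      rwa [htake l h2] at this
    set N : V → ℕ := fun w => (extensions Ω (τ ++ [w])).card with hN
    have hcard : (extensions Ω τ).card = ∑ w ∈ C τ, N w := by
      rw [Finset.card_eq_sum_card_fiberwise (f := fun l : List V => l[τ.length]!) (t := C τ) hmaps]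
      exact Finset.sum_congr rfl fun w _ => by rw [hfib]
    set f : List V → List V → ℕ := fun τ l =>
      ((Finset.Ico τ.length l.length).filter fun i => IsDefect Ω C (l.take i)).card + waste l with hf
    have hsplit : ∑ l ∈ extensions Ω τ, f τ l =
        (if IsDefect Ω C τ then (extensions Ω τ).card else 0) +
          ∑ w ∈ C τ, ∑ l ∈ extensions Ω (τ ++ [w]), f (τ ++ [w]) l := by
      have h1 : ∀ w, ∀ l ∈ extensions Ω (τ ++ [w]), f τ l =
          (if IsDefect Ω C τ then 1 else 0) + f (τ ++ [w]) l := by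
        intro w l hl
        rw [← hfib] at hl
        obtain ⟨h1, h2, h3⟩ := hprop l (Finset.mem_filter.1 hl).1
        simp only [hf, List.length_append, List.length_singleton]
        rw [← Finset.insert_Ico_add_one_left_eq_Ico h3, Finset.filter_insert, htake l h2]
        split_ifs
        · rw [Finset.card_insert_of_notMem (by simp)]; ring
        · ring
      rw [← Finset.sum_fiberwise_of_maps_to hmaps]
      have h2 : ∑ w ∈ C τ, ∑ l ∈ (extensions Ω τ).filter (fun l => l[τ.length]! = w), f τ l =
          ∑ w ∈ C τ, ((if IsDefect Ω C τ then 1 else 0) * N w +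
            ∑ l ∈ extensions Ω (τ ++ [w]), f (τ ++ [w]) l) := by
        refine Finset.sum_congr rfl fun w _ => ?_
        rw [hfib, Finset.sum_congr rfl (h1 w), Finset.sum_add_distrib, Finset.sum_const, smul_eq_mul,
          mul_comm]
      rw [h2, Finset.sum_add_distrib, ← Finset.mul_sum, ← hcard]
      split_ifs <;> simp
    have hchild : ∀ w ∈ C τ, Real.log (9 / 8) / 3 * (∑ l ∈ extensions Ω (τ ++ [w]), f (τ ++ [w]) l : ℕ) ≤
        (N w : ℝ) * ((r τ - (C τ).card) * (Real.log 3 / 3) - Real.log (N w)) := by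
      intro w _
      rcases (extensions Ω (τ ++ [w])).eq_empty_or_nonempty with h0 | ⟨l, hl⟩
      · simp [hN, h0]
      refine (ih (τ ++ [w]) (by rw [List.length_append]; omega) ?_).trans ?_
      · intro l hl
        rw [← hfib] at hl
        have := hm l (Finset.mem_filter.1 hl).1
        rw [List.length_append, List.length_singleton]
        omega
      · refine mul_le_mul_of_nonneg_left ?_ (Nat.cast_nonneg _)
        rw [← hfib, Finset.mem_filter] at hl
        obtain ⟨h1, h2, h3⟩ := hprop l hl.1
        have h4 := hr l h1 τ.length hτ h3
        rw [take_succ_eq_append h3, hl.2, htake l h2] at h4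
        have h5 : (r (τ ++ [w]) : ℝ) + (C τ).card ≤ r τ := by exact_mod_cast h4
        have h6 := mul_le_mul_of_nonneg_right h5 (hδ.trans hδl)
        linarith
    change Real.log (9 / 8) / 3 * (∑ l ∈ extensions Ω τ, f τ l : ℕ) ≤ _
    rw [hsplit, Nat.cast_add, mul_add, Nat.cast_sum, Finset.mul_sum]
    refine (add_le_add_right (Finset.sum_le_sum hchild) _).trans ?_
    have hexpand : ∑ w ∈ C τ, (N w : ℝ) * ((r τ - (C τ).card) * (Real.log 3 / 3) - Real.log (N w)) =
        (extensions Ω τ).card * ((r τ - (C τ).card) * (Real.log 3 / 3) -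
          Real.log (extensions Ω τ).card) +
        ∑ w ∈ C τ, (N w : ℝ) * (Real.log (∑ w ∈ C τ, N w : ℕ) - Real.log (N w)) := by
      rw [← hcard]
      have h7 : ((extensions Ω τ).card : ℝ) = ∑ w ∈ C τ, (N w : ℝ) := by rw [hcard]; push_cast; rfl
      set X := (r τ - ((C τ).card : ℝ)) * (Real.log 3 / 3)
      set Lg := Real.log ((extensions Ω τ).card : ℝ)
      rw [h7, Finset.sum_mul, ← Finset.sum_add_distrib]
      exact Finset.sum_congr rfl fun w _ => by ring
    rw [hexpand]
    obtain ⟨h8, h9⟩ := sum_mul_log_le (C τ) N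
    by_cases hd : IsDefect Ω C τ
    · rw [if_pos hd]
      have h10 := h9 (by
        rcases hd with h | h
        · exact Or.inl h
        · right; rw [← hcard]; exact h)
      rw [← hcard] at h10 ⊢
      linarith
    · rw [if_neg hd]
      rw [← hcard] at h8 ⊢
      push_cast
      linarith

/-- In a large tree of induced paths, few branchings are defective and few vertices are wasted. -/
theorem sum_defects_add_waste_le (Ω : Finset (List V)) (C : List V → Finset V) (r waste : List V → ℕ)
    (k₀ : ℕ) (hpf : ∀ l ∈ Ω, ∀ l' ∈ Ω, l <+: l' → l = l')
    (hC : ∀ l ∈ Ω, ∀ i, k₀ ≤ i → i < l.length → l[i]! ∈ C (l.take i))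
    (hr : ∀ l ∈ Ω, ∀ i, k₀ ≤ i → i < l.length →
      r (l.take (i + 1)) + (C (l.take i)).card ≤ r (l.take i))
    (hw : ∀ l ∈ Ω, waste l ≤ r l) (τ : List V) (hτ : k₀ ≤ τ.length) :
    ∑ l ∈ extensions Ω τ,
      (((Finset.Ico τ.length l.length).filter fun i => IsDefect Ω C (l.take i)).card + waste l) ≤
    41 * maxProd (r τ) := by
  obtain ⟨m, hm⟩ : ∃ m, ∀ l ∈ extensions Ω τ, l.length ≤ m :=
    ⟨(extensions Ω τ).sup List.length, fun l hl => Finset.le_sup (f := List.length) hl⟩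
  have h1 := (sum_defects_add_waste_le_aux Ω C r waste k₀ hpf hC hr hw m τ hτ
    fun l hl => (hm l hl).trans (by omega)).trans (mul_sub_log_le_maxProd _ _)
  have h2 : (1 : ℝ) / 9 ≤ Real.log (9 / 8) := by
    have := Real.one_sub_inv_le_log_of_pos (show (0 : ℝ) < 9 / 8 by norm_num)
    norm_num at this ⊢
    exact this
  set S : ℕ := ∑ l ∈ extensions Ω τ,
      (((Finset.Ico τ.length l.length).filter fun i => IsDefect Ω C (l.take i)).card + waste l)
  -- Since log (9/8)/3 ≥ 1/27, the factor is (3/2) · 27 = 40.5, rounded up.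
  have h3 : (S : ℝ) ≤ 41 * maxProd (r τ) := by
    have h4 := mul_le_mul_of_nonneg_right h2 (Nat.cast_nonneg (α := ℝ) S)
    have h5 : (0 : ℝ) ≤ maxProd (r τ) := Nat.cast_nonneg _
    linarith
  exact_mod_cast h3

end BranchingEntropy

/-! ### Defects and wasted vertices along rooted holes -/

section Traversal

open scoped Classical

variable {V : Type u} {G : SimpleGraph V}

/-- `w` can be reached from `u` in at most `k` steps. -/
def Near (G : SimpleGraph V) (k : ℕ) (u w : V) : Prop := ∃ p : G.Walk u w, p.length ≤ k

theorem Near.refl (k : ℕ) (u : V) : Near G k u u := ⟨.nil, by simp⟩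

theorem Near.symm {k : ℕ} {u w : V} (h : Near G k u w) : Near G k w u := by
  obtain ⟨p, hp⟩ := h
  exact ⟨p.reverse, by simpa using hp⟩

theorem Near.trans {a b : ℕ} {u v w : V} (h : Near G a u v) (h' : Near G b v w) :
    Near G (a + b) u w := by
  obtain ⟨p, hp⟩ := h
  obtain ⟨q, hq⟩ := h'
  exact ⟨p.append q, by rw [SimpleGraph.Walk.length_append]; omega⟩

theorem Near.mono {a b : ℕ} {u v : V} (h : Near G a u v) (hab : a ≤ b) : Near G b u v := by
  obtain ⟨p, hp⟩ := h
  exact ⟨p, by omega⟩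

theorem near_of_adj {u v : V} (h : G.Adj u v) : Near G 1 u v := ⟨h.toWalk, by simp⟩

theorem card_near_le [Fintype V] {D : ℕ} (hD : ∀ v, (Finset.univ.filter (G.Adj v)).card ≤ D) (k : ℕ) (u : V) :
    (Finset.univ.filter (Near G k u)).card ≤ (D + 1) ^ k := by
  induction k generalizing u with
  | zero =>
    have : Finset.univ.filter (Near G 0 u) ⊆ {u} := by
      intro w hw
      obtain ⟨p, hp⟩ := (Finset.mem_filter.1 hw).2
      rw [Finset.mem_singleton, SimpleGraph.Walk.eq_of_length_eq_zero (by omega : p.length = 0)]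
    simpa using Finset.card_le_card this
  | succ k ih =>
    have hsub : Finset.univ.filter (Near G (k + 1) u) ⊆
        (insert u (Finset.univ.filter (G.Adj u))).biUnion fun x => Finset.univ.filter (Near G k x) := by
      intro w hw
      obtain ⟨p, hp⟩ := (Finset.mem_filter.1 hw).2
      rw [Finset.mem_biUnion]
      cases p with
      | nil => exact ⟨u, by simp, by simpa using Near.refl k u⟩
      | @cons _ x _ h q =>
        refine ⟨x, by simp [h], Finset.mem_filter.2 ⟨Finset.mem_univ _, q, ?_⟩⟩
        rw [SimpleGraph.Walk.length_cons] at hp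
        omega
    refine (Finset.card_le_card hsub).trans (Finset.card_biUnion_le.trans ?_)
    refine (Finset.sum_le_card_nsmul _ _ _ fun x _ => ih x).trans ?_
    rw [smul_eq_mul, pow_succ, mul_comm]
    refine Nat.mul_le_mul_left _ ((Finset.card_insert_le _ _).trans ?_)
    have := hD u
    omega

theorem IsRootedHole.near [Inhabited V] {l : List V} (hl : IsRootedHole G l) {a b : ℕ} (hab : a ≤ b) (hb : b < l.length) :
    Near G (b - a) l[a]! l[b]! := by
  induction b, hab using Nat.le_induction with
  | base => exact Near.refl _ _
  | succ b hab ih =>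
    have := (ih (by omega)).trans (near_of_adj (hl.adj_succ hb))
    rwa [show b - a + 1 = b + 1 - a by omega] at this

/-- The last vertex of the shorter listing is adjacent to its first one, which would be a chord of
the longer hole. Hence rooted holes are the leaves of a tree. -/
theorem IsRootedHole.eq_of_prefix [Inhabited V] {l l' : List V} (hl : IsRootedHole G l) (hl' : IsRootedHole G l') (h : l <+: l') : l = l' := by
  refine h.eq_of_length (by_contra fun hne => ?_)
  have hlt := lt_of_le_of_ne h.length_le hne
  have h4 := hl.1
  obtain ⟨t, rfl⟩ := h
  have h1 := (hl.adj_iff (i := 0) (j := l.length - 1) (by omega) (by omega)).2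
    (Or.inr (Or.inr (Or.inl ⟨rfl, by omega⟩)))
  rw [← getElem!_append_left' (l' := t) (show 0 < l.length by omega),
    ← getElem!_append_left' (l' := t) (show l.length - 1 < l.length by omega),
    hl'.adj_iff (by omega) (by omega)] at h1
  omega

variable [Inhabited V] [Fintype V]

/-- The vertices that are equal or adjacent to one of `l[1], …, l[i - 1]`. -/
noncomputable def dominated (G : SimpleGraph V) (l : List V) (i : ℕ) : Finset V :=
  Finset.univ.filter fun w => ∃ k, 1 ≤ k ∧ k < i ∧ (w = l[k]! ∨ G.Adj l[k]! w)

/-- The vertices with which an induced path `l[0], …, l[i]` can be continued. -/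
noncomputable def options (G : SimpleGraph V) (l : List V) (i : ℕ) : Finset V :=
  Finset.univ.filter fun w => G.Adj l[i]! w ∧ w ∉ dominated G l i

/-- The vertices that are never dominated by the inner vertices of `l`. -/
noncomputable def wasted (G : SimpleGraph V) (l : List V) : Finset V :=
  (dominated G l (l.length - 1))ᶜ

/-- The branching of the rooted holes after `l[0], …, l[i]` is defective. -/
def DefectAt (G : SimpleGraph V) (l : List V) (i : ℕ) : Prop :=
  IsDefect (rootedHoles G) (fun τ => options G τ (τ.length - 1)) (l.take (i + 1))

variable {l l' : List V} {i j : ℕ}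

theorem mem_dominated {w : V} :
    w ∈ dominated G l i ↔ ∃ k, 1 ≤ k ∧ k < i ∧ (w = l[k]! ∨ G.Adj l[k]! w) := by
  simp [dominated]

theorem mem_options {w : V} : w ∈ options G l i ↔ G.Adj l[i]! w ∧ w ∉ dominated G l i := by
  simp [options]

theorem dominated_congr (h : ∀ k < i, l[k]! = l'[k]!) : dominated G l i = dominated G l' i := by
  ext w
  simp only [mem_dominated]
  refine exists_congr fun k => and_congr_right fun _ => and_congr_right fun hk => ?_
  rw [h k hk]

theorem options_congr (h : ∀ k ≤ i, l[k]! = l'[k]!) : options G l i = options G l' i := by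
  ext w
  rw [mem_options, mem_options, dominated_congr fun k hk => h k hk.le, h i le_rfl]

theorem dominated_take (h : i ≤ j) : dominated G (l.take j) i = dominated G l i :=
  dominated_congr fun _ hk => getElem!_take_of_lt (by omega)

theorem options_take (h : i < j) : options G (l.take j) i = options G l i :=
  options_congr fun _ hk => getElem!_take_of_lt (by omega)

theorem dominated_mono (h : i ≤ j) : dominated G l i ⊆ dominated G l j := by
  intro w
  simp only [mem_dominated]
  rintro ⟨k, h1, h2, h3⟩
  exact ⟨k, h1, by omega, h3⟩

theorem disjoint_dominated_options : Disjoint (dominated G l i) (options G l i) := by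
  rw [Finset.disjoint_left]
  intro w hw hw'
  exact (mem_options.1 hw').2 hw

namespace IsRootedHole

theorem mem_dominated_self (hl : IsRootedHole G l) (hi : 2 ≤ i) {k : ℕ} (hk : k < i)
    (hkl : k < l.length) :
    l[k]! ∈ dominated G l i := by
  rw [mem_dominated]
  rcases Nat.eq_zero_or_pos k with rfl | hpos
  · exact ⟨1, le_rfl, by omega, Or.inr (hl.adj_succ (i := 0) (by have := hl.1; omega)).symm⟩
  · exact ⟨k, hpos, hk, Or.inl rfl⟩

/-- The vertex l[i] is already dominated by l[i - 1], which requires 2 ≤ i. So only the new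
neighbours of l[i] are added. -/
theorem dominated_succ (hl : IsRootedHole G l) (hi : 2 ≤ i) (hil : i < l.length) :
    dominated G l (i + 1) = dominated G l i ∪ options G l i := by
  ext w
  rw [Finset.mem_union, mem_options]
  constructor
  · intro h
    by_cases hw : w ∈ dominated G l i
    · exact Or.inl hw
    · right
      refine ⟨?_, hw⟩
      obtain ⟨k, h1, h2, h3⟩ := mem_dominated.1 h
      rcases Nat.lt_succ_iff_lt_or_eq.1 h2 with h4 | rfl
      · exact absurd (mem_dominated.2 ⟨k, h1, h4, h3⟩) hw
      · rcases h3 with rfl | h3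
        · refine absurd (mem_dominated.2 ⟨k - 1, by omega, by omega, Or.inr ?_⟩) hw
          have := hl.adj_succ (i := k - 1) (by omega)
          rwa [Nat.sub_add_cancel (by omega)] at this
        · exact h3
  · rintro (h | h)
    · exact dominated_mono (Nat.le_succ i) h
    · exact mem_dominated.2 ⟨i, by omega, by omega, Or.inr h.1⟩

theorem card_dominated_succ (hl : IsRootedHole G l) (hi : 2 ≤ i) (hil : i < l.length) :
    (dominated G l (i + 1)).card = (dominated G l i).card + (options G l i).card := by
  rw [hl.dominated_succ hi hil, Finset.card_union_of_disjoint disjoint_dominated_options]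

theorem getElem_mem_options (hl : IsRootedHole G l) (hi : 1 ≤ i) (hil : i + 1 < l.length) :
    l[i + 1]! ∈ options G l i := by
  rw [mem_options]
  refine ⟨hl.adj_succ hil, fun h => ?_⟩
  obtain ⟨k, h1, h2, h3⟩ := mem_dominated.1 h
  rcases h3 with h3 | h3
  · have := hl.inj hil (by omega) h3
    omega
  · rw [hl.adj_iff (by omega) hil] at h3
    omega

end IsRootedHole

/-- The entropy bound applies to the tree of rooted holes, with the number of vertices not yet
dominated as the remaining resource. A prefix of length i ends at place i - 1, hence the shift of
indices. -/
theorem sum_defects_add_wasted_of_prefix (τ : List V) (hτ : 3 ≤ τ.length) :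
    ∑ l ∈ extensions (rootedHoles G) τ,
      (((Finset.Ico τ.length l.length).filter fun i => DefectAt G l (i - 1)).card +
        (wasted G l).card) ≤ 41 * maxProd (Fintype.card V) := by
  have h := sum_defects_add_waste_le (rootedHoles G) (fun τ => options G τ (τ.length - 1))
    (fun τ => ((dominated G τ (τ.length - 1))ᶜ).card) (fun l => (wasted G l).card) 3
    (fun l hl l' hl' => (mem_rootedHoles.1 hl).eq_of_prefix (mem_rootedHoles.1 hl')) ?_ ?_
    (fun l _ => le_rfl) τ hτ
  · refine le_trans (le_of_eq (Finset.sum_congr rfl fun l _ => ?_))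
      (h.trans (Nat.mul_le_mul_left _ (maxProd_mono (Finset.card_le_univ _))))
    congr 2
    refine Finset.filter_congr fun i hi => ?_
    rw [DefectAt, Nat.sub_add_cancel (by rw [Finset.mem_Ico] at hi; omega)]
  · intro l hl i hi hil
    have := (mem_rootedHoles.1 hl).getElem_mem_options (i := i - 1) (by omega) (by omega)
    rw [Nat.sub_add_cancel (by omega)] at this
    simpa [options_take (show i - 1 < i by omega), Nat.min_eq_left hil.le] using this
  · intro l hl i hi hil
    have h1 := (mem_rootedHoles.1 hl).card_dominated_succ (i := i - 1) (by omega) (by omega)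
    rw [Nat.sub_add_cancel (by omega)] at h1
    simp only [List.length_take, Nat.min_eq_left hil.le, Nat.min_eq_left (show i + 1 ≤ l.length by omega),
      Nat.add_sub_cancel]
    rw [options_take (by omega), dominated_take (by omega), dominated_take (by omega),
      Finset.card_compl, Finset.card_compl]
    have := Finset.card_le_univ (dominated G l i)
    omega

/-- In a graph of bounded degree, defects and wasted vertices of rooted holes are rare. -/
theorem sum_defects_add_wasted_le {D : ℕ} (hD : ∀ v, (Finset.univ.filter (G.Adj v)).card ≤ D) :
    ∑ l ∈ rootedHoles G, (((Finset.Ico 2 (l.length - 1)).filter fun i => DefectAt G l i).card +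
      (wasted G l).card) ≤ 41 * D ^ 2 * (Fintype.card V * maxProd (Fintype.card V)) := by
  set N : V → Finset V := fun v => Finset.univ.filter (G.Adj v)
  -- The first three vertices of a rooted hole are the vertex at place 1 and two of its neighbours;
  -- the bound for a fixed prefix is used for each of these beginnings.
  set P : Finset (Σ _ : V, V × V) := Finset.univ.sigma fun v => N v ×ˢ N v
  have hP : P.card ≤ Fintype.card V * D ^ 2 := by
    rw [Finset.card_sigma, ← Finset.card_univ, ← smul_eq_mul]
    refine Finset.sum_le_card_nsmul _ _ _ fun v _ => ?_
    rw [Finset.card_product, sq]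
    exact Nat.mul_le_mul (hD v) (hD v)
  have hmaps : ∀ l ∈ rootedHoles G, (⟨l[1]!, l[0]!, l[2]!⟩ : Σ _ : V, V × V) ∈ P := by
    intro l hl
    have hl := mem_rootedHoles.1 hl
    have h4 := hl.1
    simp only [P, N, Finset.mem_sigma, Finset.mem_univ, Finset.mem_product, Finset.mem_filter,
      true_and]
    exact ⟨(hl.adj_succ (by omega)).symm, hl.adj_succ (by omega)⟩
  rw [← Finset.sum_fiberwise_of_maps_to hmaps]
  calc _ ≤ ∑ p ∈ P, 41 * maxProd (Fintype.card V) := by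
        refine Finset.sum_le_sum fun p _ => ?_
        refine le_trans ?_ (sum_defects_add_wasted_of_prefix (G := G) [p.2.1, p.1, p.2.2] le_rfl)
        have hsub : (rootedHoles G).filter (fun l => (⟨l[1]!, l[0]!, l[2]!⟩ : Σ _ : V, V × V) = p) ⊆
            extensions (rootedHoles G) [p.2.1, p.1, p.2.2] := by
          intro l hl
          rw [Finset.mem_filter] at hl
          obtain ⟨hl, rfl⟩ := hl
          refine Finset.mem_filter.2 ⟨hl, l.drop 3, ?_⟩
          have h4 := (mem_rootedHoles.1 hl).1
          exact (eq_cons_cons_cons_drop (by omega)).symm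
        refine le_trans (le_of_eq (Finset.sum_congr rfl fun l hl => ?_))
          (Finset.sum_le_sum_of_subset hsub)
        congr 1
        refine Finset.card_bij (fun i _ => i + 1) ?_ (fun _ _ _ _ h => by omega) ?_
        · intro i hi
          simp only [Finset.mem_filter, Finset.mem_Ico, List.length_cons, List.length_nil,
            Nat.add_sub_cancel] at hi ⊢
          exact ⟨by omega, hi.2⟩
        · intro i hi
          simp only [Finset.mem_filter, Finset.mem_Ico, List.length_cons, List.length_nil] at hi
          refine ⟨i - 1, ?_, by omega⟩
          simp only [Finset.mem_filter, Finset.mem_Ico]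
          exact ⟨by omega, hi.2⟩
    _ = P.card * (41 * maxProd (Fintype.card V)) := by rw [Finset.sum_const, smul_eq_mul]
    _ ≤ (Fintype.card V * D ^ 2) * (41 * maxProd (Fintype.card V)) := Nat.mul_le_mul_right _ hP
    _ = _ := by ring

end Traversal

/-! ### Counting places of rooted holes with a given property -/

section PlaceCounting

open scoped Classical

variable {V : Type u} [Inhabited V]

theorem getElem!_rotate_of_lt {l : List V} {s i : ℕ} (h : i + s < l.length) :
    (l.rotate s)[i]! = l[i + s]! := by
  rw [getElem!_rotate s (by omega), Nat.mod_eq_of_lt h]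

variable [Fintype V]

/-- The rooted holes that have a property at a place. -/
noncomputable def places (G : SimpleGraph V) (E : List V → ℕ → Prop) : Finset (List V × ℕ) :=
  (rootedHoles G ×ˢ Finset.range (Fintype.card V)).filter fun p => p.2 < p.1.length ∧ E p.1 p.2

variable {G : SimpleGraph V} {E E' E'' : List V → ℕ → Prop}

theorem mem_places {p : List V × ℕ} :
    p ∈ places G E ↔ IsRootedHole G p.1 ∧ p.2 < p.1.length ∧ E p.1 p.2 := by
  rw [places, Finset.mem_filter, Finset.mem_product, mem_rootedHoles, Finset.mem_range]
  constructor
  · rintro ⟨⟨h1, -⟩, h2, h3⟩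
    exact ⟨h1, h2, h3⟩
  · rintro ⟨h1, h2, h3⟩
    exact ⟨⟨h1, h2.trans_le h1.length_le⟩, h2, h3⟩

theorem card_places_mono (h : ∀ l j, IsRootedHole G l → j < l.length → E l j → E' l j) :
    (places G E).card ≤ (places G E').card := by
  refine Finset.card_le_card fun p hp => ?_
  rw [mem_places] at hp ⊢
  exact ⟨hp.1, hp.2.1, h _ _ hp.1 hp.2.1 hp.2.2⟩

theorem card_places_le_add
    (h : ∀ l j, IsRootedHole G l → j < l.length → E l j → E' l j ∨ E'' l j) :
    (places G E).card ≤ (places G E').card + (places G E'').card := by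
  refine le_trans (Finset.card_le_card fun p hp => ?_) (Finset.card_union_le _ _)
  rw [mem_places] at hp
  rw [Finset.mem_union, mem_places, mem_places]
  rcases h _ _ hp.1 hp.2.1 hp.2.2 with h | h
  · exact Or.inl ⟨hp.1, hp.2.1, h⟩
  · exact Or.inr ⟨hp.1, hp.2.1, h⟩

theorem card_places_eq_sum :
    (places G E).card =
      ∑ l ∈ rootedHoles G, ((Finset.range l.length).filter fun j => E l j).card := by
  rw [Finset.card_eq_sum_card_fiberwise (f := Prod.fst) (t := rootedHoles G)]
  · refine Finset.sum_congr rfl fun l hl => ?_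
    refine Finset.card_bij (fun p _ => p.2) ?_ ?_ ?_
    · intro p hp
      rw [Finset.mem_filter, mem_places] at hp
      obtain ⟨⟨h1, h2, h3⟩, rfl⟩ := hp
      simp [h2, h3]
    · intro p hp q hq h
      exact Prod.ext ((Finset.mem_filter.1 hp).2.trans (Finset.mem_filter.1 hq).2.symm) h
    · intro j hj
      rw [Finset.mem_filter, Finset.mem_range] at hj
      exact ⟨(l, j), Finset.mem_filter.2 ⟨mem_places.2 ⟨mem_rootedHoles.1 hl, hj⟩, rfl⟩, rfl⟩
  · intro p hp
    exact mem_rootedHoles.2 (mem_places.1 hp).1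

/-- Different places carry different vertices, and all of these lie in balls of radius k around B.
-/
theorem card_le_of_forall_near {D : ℕ} (hD : ∀ v, (Finset.univ.filter (G.Adj v)).card ≤ D) (k : ℕ)
    {l : List V} (hl : IsRootedHole G l) {B : Finset V} (J : Finset ℕ)
    (hJ : ∀ j ∈ J, j < l.length ∧ ∃ b ∈ B, Near G k l[j]! b) : J.card ≤ (D + 1) ^ k * B.card := by
  have h1 : J.card = (J.image fun j => l[j]!).card :=
    (Finset.card_image_of_injOn fun i hi j hj h => hl.inj (hJ i hi).1 (hJ j hj).1 h).symm
  have h2 : (J.image fun j => l[j]!) ⊆ B.biUnion fun b => Finset.univ.filter (Near G k b) := by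
    intro w hw
    obtain ⟨j, hj, rfl⟩ := Finset.mem_image.1 hw
    obtain ⟨-, b, hb, hn⟩ := hJ j hj
    exact Finset.mem_biUnion.2 ⟨b, hb, Finset.mem_filter.2 ⟨Finset.mem_univ _, hn.symm⟩⟩
  rw [h1, mul_comm, ← smul_eq_mul]
  exact (Finset.card_le_card h2).trans (Finset.card_biUnion_le.trans
    (Finset.sum_le_card_nsmul _ _ _ fun b _ => card_near_le hD k b))

theorem card_places_le_of_near {D : ℕ} (hD : ∀ v, (Finset.univ.filter (G.Adj v)).card ≤ D) (k : ℕ)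
    {B : List V → Finset V}
    (h : ∀ l j, IsRootedHole G l → j < l.length → E l j → ∃ b ∈ B l, Near G k l[j]! b) :
    (places G E).card ≤ (D + 1) ^ k * ∑ l ∈ rootedHoles G, (B l).card := by
  rw [card_places_eq_sum, Finset.mul_sum]
  refine Finset.sum_le_sum fun l hl => ?_
  have hl := mem_rootedHoles.1 hl
  refine card_le_of_forall_near hD k hl _ fun j hj => ?_
  rw [Finset.mem_filter, Finset.mem_range] at hj
  exact ⟨hj.1, h l j hl hj.1 hj.2⟩

theorem card_places_near_le {D : ℕ} (hD : ∀ v, (Finset.univ.filter (G.Adj v)).card ≤ D) (k : ℕ) :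
    (places G fun l j => ∃ i < l.length, E l i ∧ Near G k l[j]! l[i]!).card ≤
      (D + 1) ^ k * (places G E).card := by
  have h2 : ∑ l ∈ rootedHoles G,
      (((Finset.range l.length).filter fun j => E l j).image (fun j => l[j]!)).card ≤
      (places G E).card := by
    rw [card_places_eq_sum]
    exact Finset.sum_le_sum fun l _ => Finset.card_image_le
  refine (card_places_le_of_near hD k ?_).trans (Nat.mul_le_mul_left _ h2)
  rintro l j hl hj ⟨i, hi, hE, hn⟩
  exact ⟨l[i]!, Finset.mem_image.2 ⟨i, Finset.mem_filter.2 ⟨Finset.mem_range.2 hi, hE⟩, rfl⟩, hn⟩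

/-- Where the branching is not defective, an event that concerns one of the options can be
transferred to the next vertex. -/
theorem card_places_option_le (φ : List V → Prop) :
    (places G fun l j => (j + 1 < l.length ∧ ¬ DefectAt G l j) ∧
      ∃ x ∈ options G l j, φ (l.take (j + 1) ++ [x])).card ≤
    10 * (places G fun l j => j + 1 < l.length ∧ φ (l.take (j + 2))).card := by
  set A := places G fun l j => (j + 1 < l.length ∧ ¬ DefectAt G l j) ∧
      ∃ x ∈ options G l j, φ (l.take (j + 1) ++ [x]) with hA
  set g : List V × ℕ → List V := fun p => p.1.take (p.2 + 1) with hg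
  -- The option x may depend only on the prefix τ. At a place without defect every option has at
  -- least a tenth of the extensions of τ, so replacing those by the extensions of τ ++ [x] costs a
  -- factor 10.
  have hex : ∀ τ : List V, ∃ x : V, τ ∈ A.image g → τ ≠ [] ∧ φ (τ ++ [x]) ∧
      (extensions (rootedHoles G) τ).card ≤ 10 * (extensions (rootedHoles G) (τ ++ [x])).card := by
    intro τ
    by_cases h : τ ∈ A.image g
    · obtain ⟨⟨l, j⟩, hp, rfl⟩ := Finset.mem_image.1 h
      obtain ⟨hl, hj, ⟨hj1, hd⟩, x, hx, hφ⟩ := mem_places.1 hp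
      refine ⟨x, fun _ => ⟨?_, hφ, ?_⟩⟩
      · intro h0
        have h0' := congrArg List.length h0
        simp only [hg, List.length_take, List.length_nil] at h0' hj hj1
        omega
      · by_contra! hlt
        refine hd (Or.inr ⟨x, ?_, hlt⟩)
        dsimp only at hj1 hx ⊢
        rw [List.length_take, Nat.min_eq_left (by omega), Nat.add_sub_cancel, options_take (by omega)]
        exact hx
    · exact ⟨default, fun h' => absurd h' h⟩
  choose x hx using hex
  calc A.card = ∑ τ ∈ A.image g, (A.filter fun p => g p = τ).card :=
        Finset.card_eq_sum_card_image g A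
    _ ≤ ∑ τ ∈ A.image g, 10 * (extensions (rootedHoles G) (τ ++ [x τ])).card := by
        refine Finset.sum_le_sum fun τ hτ => le_trans ?_ (hx τ hτ).2.2
        have hjτ : ∀ p ∈ A.filter (fun p => g p = τ), p.2 + 1 = τ.length := by
          intro p hp
          obtain ⟨hpA, rfl⟩ := Finset.mem_filter.1 hp
          have := (mem_places.1 hpA).2.1
          simp only [hg, List.length_take]
          omega
        refine Finset.card_le_card_of_injOn Prod.fst ?_ ?_
        · intro p hp
          obtain ⟨hpA, rfl⟩ := Finset.mem_filter.1 (Finset.mem_coe.1 hp)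
          exact Finset.mem_coe.2 (Finset.mem_filter.2
            ⟨mem_rootedHoles.2 (mem_places.1 hpA).1, List.take_prefix _ _⟩)
        · intro p hp q hq h
          have h1 := hjτ p hp
          have h2 := hjτ q hq
          exact Prod.ext h (by omega)
    _ = 10 * ((A.image g).sigma fun τ => extensions (rootedHoles G) (τ ++ [x τ])).card := by
        rw [Finset.card_sigma, Finset.mul_sum]
    _ ≤ _ := by
        refine Nat.mul_le_mul_left _ (Finset.card_le_card_of_injOn
          (fun q => (q.2, q.1.length - 1)) ?_ ?_)
        · rintro ⟨τ, l⟩ hq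
          obtain ⟨hτ, hl⟩ := Finset.mem_sigma.1 (Finset.mem_coe.1 hq)
          obtain ⟨hne, hφ, -⟩ := hx τ hτ
          obtain ⟨hl, hpre⟩ := Finset.mem_filter.1 hl
          have hpos := List.length_pos_iff.2 hne
          have hlen := hpre.length_le
          rw [List.length_append, List.length_singleton] at hlen
          refine Finset.mem_coe.2 (mem_places.2 ⟨mem_rootedHoles.1 hl, ?_, ?_, ?_⟩)
          · dsimp only at *; omega
          · dsimp only at *; omega
          · dsimp only at *
            have := List.prefix_iff_eq_take.1 hpre
            rw [List.length_append, List.length_singleton] at this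
            rwa [show τ.length - 1 + 2 = τ.length + 1 by omega, ← this]
        · rintro ⟨τ, l⟩ hq ⟨τ', l'⟩ hq' h
          simp only [Prod.mk.injEq] at h
          obtain ⟨rfl, h⟩ := h
          obtain ⟨hτ, hl⟩ := Finset.mem_sigma.1 (Finset.mem_coe.1 hq)
          obtain ⟨hτ', hl'⟩ := Finset.mem_sigma.1 (Finset.mem_coe.1 hq')
          have hpos := List.length_pos_iff.2 (hx τ hτ).1
          have hpos' := List.length_pos_iff.2 (hx τ' hτ').1
          have h1 := List.prefix_iff_eq_take.1 ((List.prefix_append _ _).trans (Finset.mem_filter.1 hl).2)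
          have h2 := List.prefix_iff_eq_take.1 ((List.prefix_append _ _).trans (Finset.mem_filter.1 hl').2)
          dsimp only at *
          have h3 : τ.length = τ'.length := by omega
          rw [h3, ← h2] at h1
          rw [h1]

/-- The inner places of a rooted hole at which the branching is defective. -/
def InnerDefect (G : SimpleGraph V) (l : List V) (i : ℕ) : Prop :=
  2 ≤ i ∧ i + 1 < l.length ∧ DefectAt G l i

/-- At place `b` the hole `l` meets a neighbour of a vertex that it has met before, but for the last
time at least `t` places earlier. -/
def LongJump (G : SimpleGraph V) (t : ℕ) (l : List V) (b : ℕ) : Prop :=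
  b + 1 < l.length ∧ ∃ x, G.Adj l[b]! x ∧ (∃ a, 1 ≤ a ∧ a + t ≤ b ∧ G.Adj l[a]! x) ∧
    ∀ k, b < k + t → k < b → ¬ G.Adj l[k]! x

/-- At place `i` the hole `l` meets a neighbour of a vertex that it has met `T` places earlier. -/
def FarReturn (G : SimpleGraph V) (T : ℕ) (l : List V) (i : ℕ) : Prop :=
  i + 1 < l.length ∧ ∃ z, G.Adj l[i]! z ∧ ∃ a, 1 ≤ a ∧ a + T ≤ i ∧ G.Adj l[a]! z

theorem card_options_of_not_defectAt {l : List V} {i : ℕ} (hi : i < l.length) (h : ¬ DefectAt G l i) :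
    (options G l i).card = 3 := by
  by_contra hne
  refine h (Or.inl ?_)
  dsimp only
  rwa [List.length_take, Nat.min_eq_left (by omega), Nat.add_sub_cancel, options_take (by omega)]

/-- If the listing starts s ≤ t places before b, then the earlier encounter with x is forgotten. At
l[b] the vertex x is now an option besides the three previous ones, so there are at least four
options. -/
theorem LongJump.defectAt_rotate {l : List V} {t b s : ℕ} (hl : IsRootedHole G l) (ht : 3 ≤ t)
    (h : LongJump G t l b) (hd : ¬ DefectAt G l b) (hs : 2 ≤ s) (hst : s ≤ t) :
    InnerDefect G (l.rotate (b - s)) s := by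
  obtain ⟨hb, x, hbx, ⟨a, ha1, hab, hax⟩, hno⟩ := h
  refine ⟨hs, by rw [List.length_rotate]; omega, ?_⟩
  by_contra hd'
  have h3 := card_options_of_not_defectAt (by omega) hd
  have h3' := card_options_of_not_defectAt (by rw [List.length_rotate]; omega) hd'
  have hget : ∀ k ≤ s, (l.rotate (b - s))[k]! = l[k + (b - s)]! := fun k hk =>
    getElem!_rotate_of_lt (by omega)
  have hlast : (l.rotate (b - s))[s]! = l[b]! := by
    rw [hget s le_rfl, Nat.add_sub_cancel' (by omega)]
  have hsub : insert x (options G l b) ⊆ options G (l.rotate (b - s)) s := by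
    intro w hw
    rw [mem_options, hlast]
    rcases Finset.mem_insert.1 hw with rfl | hw
    · refine ⟨hbx, fun hdom => ?_⟩
      obtain ⟨k, hk1, hk2, hk3⟩ := mem_dominated.1 hdom
      rw [hget k hk2.le] at hk3
      rcases hk3 with rfl | hk3
      · rw [hl.adj_iff (by omega) (by omega)] at hbx hax
        have := hno (b - 2) (by omega) (by omega)
        rw [hl.adj_iff (by omega) (by omega)] at this
        omega
      · exact hno _ (by omega) (by omega) hk3
    · rw [mem_options] at hw
      refine ⟨hw.1, fun hdom => hw.2 ?_⟩
      obtain ⟨k, hk1, hk2, hk3⟩ := mem_dominated.1 hdom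
      rw [hget k hk2.le] at hk3
      exact mem_dominated.2 ⟨k + (b - s), by omega, by omega, hk3⟩
  have hx : x ∉ options G l b := fun hx =>
    (mem_options.1 hx).2 (mem_dominated.2 ⟨a, ha1, by omega, Or.inr hax⟩)
  have := Finset.card_le_card hsub
  rw [Finset.card_insert_of_notMem hx] at this
  omega

/-- Each long jump yields t - 1 rerooted listings with a defect. From the rerooted listing, its
defective place s and the number b, the original is recovered by rotating back. -/
theorem card_longJump_le {t : ℕ} (ht : 3 ≤ t) :
    (t - 1) * (places G fun l b => LongJump G t l b ∧ ¬ DefectAt G l b).card ≤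
      Fintype.card V * (places G (InnerDefect G)).card := by
  set A := places G fun l b => LongJump G t l b ∧ ¬ DefectAt G l b
  have h1 : (Finset.Icc 2 t).card = t - 1 := by rw [Nat.card_Icc]; omega
  rw [← h1, ← Finset.card_range (Fintype.card V), ← Finset.card_product, ← Finset.card_product]
  refine Finset.card_le_card_of_injOn (fun q => (q.2.2, (q.2.1.rotate (q.2.2 - q.1), q.1))) ?_ ?_
  · rintro ⟨s, l, b⟩ hq
    obtain ⟨hs, hp⟩ := Finset.mem_product.1 (Finset.mem_coe.1 hq)
    obtain ⟨hl, hb, hj, hd⟩ := mem_places.1 hp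
    obtain ⟨hs1, hs2⟩ := Finset.mem_Icc.1 hs
    have hin := hj.defectAt_rotate hl ht hd hs1 hs2
    refine Finset.mem_coe.2 (Finset.mem_product.2
      ⟨Finset.mem_range.2 (hb.trans_le hl.length_le), mem_places.2 ⟨hl.rotate _, ?_, hin⟩⟩)
    have := hin.2.1
    dsimp only at *
    omega
  · rintro ⟨s, l, b⟩ hq ⟨s', l', b'⟩ hq' h
    simp only [Prod.mk.injEq] at h
    obtain ⟨rfl, h, rfl⟩ := h
    rw [List.rotate_injective _ h]

/-- Between places a and i the hole meets at most D neighbours of z. Without long jumps nearby,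
consecutive encounters are fewer than t places apart, so i - a could be at most t D. -/
theorem FarReturn.exists_longJump {D t : ℕ} (hD : ∀ v, (Finset.univ.filter (G.Adj v)).card ≤ D)
    (ht : 1 ≤ t) {l : List V} {i : ℕ} (hl : IsRootedHole G l)
    (h : FarReturn G ((D + 1) * t) l i) :
    ∃ b < l.length, LongJump G t l b ∧ Near G 2 l[i]! l[b]! := by
  obtain ⟨hi, z, hiz, a, ha1, hai, haz⟩ := h
  by_contra! hno
  set S := (Finset.Icc a i).filter fun k => G.Adj l[k]! z with hS
  have hcard : S.card ≤ D := by
    refine le_trans (Finset.card_le_card_of_injOn (fun k => l[k]!) (t := Finset.univ.filter (G.Adj z))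
      ?_ ?_) (hD z)
    · intro k hk
      simp only [S, Finset.coe_filter, Set.mem_ofPred_eq, Finset.mem_univ, true_and] at hk ⊢
      exact hk.2.symm
    · intro k hk k' hk' h
      simp only [S, Finset.coe_filter, Set.mem_ofPred_eq, Finset.mem_Icc] at hk hk'
      exact hl.inj (by omega) (by omega) h
  have key : ∀ b, b ∈ S → b ≤ a + t * (S.filter (· < b)).card := by
    intro b
    induction b using Nat.strong_induction_on with
    | _ b ih =>
      intro hb
      obtain ⟨hbI, hbz⟩ := Finset.mem_filter.1 hb
      rw [Finset.mem_Icc] at hbI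
      by_cases hba : b < a + t
      · rcases Nat.eq_or_lt_of_le hbI.1 with rfl | hlt
        · omega
        · have : 0 < (S.filter (· < b)).card := Finset.card_pos.2 ⟨a, Finset.mem_filter.2
            ⟨Finset.mem_filter.2 ⟨Finset.mem_Icc.2 ⟨le_rfl, by omega⟩, haz⟩, hlt⟩⟩
          nlinarith
      · have hnj : ¬ LongJump G t l b := fun hj =>
          hno b (by omega) hj ((near_of_adj hiz).trans (near_of_adj hbz.symm))
        have hk : ∃ k, b < k + t ∧ k < b ∧ G.Adj l[k]! z := by
          by_contra! hk
          exact hnj ⟨by omega, z, hbz, ⟨a, ha1, by omega, haz⟩, hk⟩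
        obtain ⟨k, hk1, hk2, hk3⟩ := hk
        have hkS : k ∈ S := Finset.mem_filter.2 ⟨Finset.mem_Icc.2 ⟨by omega, by omega⟩, hk3⟩
        have h1 := ih k hk2 hkS
        have h2 : (S.filter (· < k)).card + 1 ≤ (S.filter (· < b)).card := by
          rw [← Finset.card_insert_of_notMem (a := k) (by simp)]
          refine Finset.card_le_card fun j hj => ?_
          rcases Finset.mem_insert.1 hj with rfl | hj
          · exact Finset.mem_filter.2 ⟨hkS, hk2⟩
          · have := Finset.mem_filter.1 hj
            exact Finset.mem_filter.2 ⟨this.1, by omega⟩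
        nlinarith
  have h1 := key i (Finset.mem_filter.2 ⟨Finset.mem_Icc.2 ⟨by nlinarith, le_rfl⟩, hiz⟩)
  have h2 : (S.filter (· < i)).card ≤ D := (Finset.card_filter_le _ _).trans hcard
  nlinarith

/-- For graphs with many rooted holes this makes far returns rare: the factor of order n / t is
small compared with the number of places of a hole once t is large. -/
theorem card_farReturn_le {D t : ℕ} (hD : ∀ v, (Finset.univ.filter (G.Adj v)).card ≤ D)
    (ht : 3 ≤ t) :
    (t - 1) * (places G (FarReturn G ((D + 1) * t))).card ≤
      (D + 1) ^ 2 * ((Fintype.card V + (t - 1)) * (places G (InnerDefect G)).card) := by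
  have h1 : (places G (FarReturn G ((D + 1) * t))).card ≤
      (D + 1) ^ 2 * (places G (LongJump G t)).card := by
    refine le_trans (card_places_mono fun l i hl _ h => ?_) (card_places_near_le hD 2)
    exact h.exists_longJump hD (by omega) hl
  have h2 : (places G (LongJump G t)).card ≤
      (places G fun l b => LongJump G t l b ∧ ¬ DefectAt G l b).card +
        (places G (InnerDefect G)).card := by
    refine card_places_le_add fun l b _ _ h => ?_
    by_cases hd : DefectAt G l b
    · obtain ⟨a, ha, hab, -⟩ := h.2.choose_spec.2.1
      exact Or.inr ⟨by omega, h.1, hd⟩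
    · exact Or.inl ⟨h, hd⟩
  have h3 := card_longJump_le (G := G) ht
  calc _ ≤ (t - 1) * ((D + 1) ^ 2 * (places G (LongJump G t)).card) := Nat.mul_le_mul_left _ h1
    _ ≤ (t - 1) * ((D + 1) ^ 2 * ((places G fun l b => LongJump G t l b ∧ ¬ DefectAt G l b).card +
        (places G (InnerDefect G)).card)) :=
        Nat.mul_le_mul_left _ (Nat.mul_le_mul_left _ h2)
    _ = (D + 1) ^ 2 * ((t - 1) * (places G fun l b => LongJump G t l b ∧ ¬ DefectAt G l b).card +
        (t - 1) * (places G (InnerDefect G)).card) := by ring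
    _ ≤ (D + 1) ^ 2 * (Fintype.card V * (places G (InnerDefect G)).card +
        (t - 1) * (places G (InnerDefect G)).card) :=
        Nat.mul_le_mul_left _ (Nat.add_le_add_right h3 _)
    _ = _ := by ring

end PlaceCounting

/-! ### Bad vertices and shortcuts of holes -/

section Shortcuts

open scoped Classical

variable {V : Type u}

/-- The lists of length at most `t` with entries in `B`. -/
noncomputable def listsIn (B : Finset V) : ℕ → Finset (List V)
  | 0 => {[]}
  | t + 1 => insert [] ((B ×ˢ listsIn B t).image fun p => p.1 :: p.2)

theorem mem_listsIn {B : Finset V} {t : ℕ} {q : List V} (hq : q.length ≤ t) (h : ∀ x ∈ q, x ∈ B) :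
    q ∈ listsIn B t := by
  induction t generalizing q with
  | zero => simp [listsIn, List.length_eq_zero_iff.1 (Nat.le_zero.1 hq)]
  | succ t ih =>
    cases q with
    | nil => simp [listsIn]
    | cons a q =>
      refine Finset.mem_insert_of_mem (Finset.mem_image.2 ⟨(a, q), Finset.mem_product.2
        ⟨h a (by simp), ih ?_ fun x hx => h x (by simp [hx])⟩, rfl⟩)
      simpa using hq

theorem card_listsIn_le (B : Finset V) (t : ℕ) : (listsIn B t).card ≤ (B.card + 1) ^ t := by
  induction t with
  | zero => simp [listsIn]
  | succ t ih =>
    refine (Finset.card_insert_le _ _).trans ?_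
    have h1 : ((B ×ˢ listsIn B t).image fun p => p.1 :: p.2).card ≤ B.card * (listsIn B t).card :=
      Finset.card_image_le.trans (Finset.card_product _ _).le
    have h2 : B.card * (listsIn B t).card ≤ B.card * (B.card + 1) ^ t := Nat.mul_le_mul_left _ ih
    have h3 : 1 ≤ (B.card + 1) ^ t := Nat.one_le_pow _ _ (by omega)
    rw [pow_succ]
    nlinarith

theorem length_shortcut {l : List V} {x : V} {j m : ℕ} (hj : j < l.length) (hm : m ≤ l.length) :
    (l.take (j + 1) ++ x :: l.drop m).length = l.length + (j + 2) - m := by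
  simp only [List.length_append, List.length_take, List.length_cons, List.length_drop]
  omega

variable [Inhabited V] {G : SimpleGraph V}

theorem getElem!_shortcut {l : List V} {x : V} {j m : ℕ} (hj : j < l.length) :
    (∀ k ≤ j, (l.take (j + 1) ++ x :: l.drop m)[k]! = l[k]!) ∧
      (l.take (j + 1) ++ x :: l.drop m)[j + 1]! = x ∧
      ∀ k, m ≤ k → k < l.length → (l.take (j + 1) ++ x :: l.drop m)[k + (j + 2) - m]! = l[k]! := by
  have hlen : (l.take (j + 1)).length = j + 1 := by rw [List.length_take]; omega
  refine ⟨fun k hk => ?_, ?_, fun k hk hkl => ?_⟩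
  · rw [getElem!_append_left' (by omega), getElem!_take_of_lt (by omega)]
  · rw [List.getElem!_eq_getElem?_getD, List.getElem?_append_right (by omega), hlen]
    simp
  · rw [List.getElem!_eq_getElem?_getD, List.getElem?_append_right (by omega), hlen,
      show k + (j + 2) - m - (j + 1) = k - m + 1 by omega, List.getElem?_cons_succ,
      List.getElem?_drop, show m + (k - m) = k by omega, List.getElem!_eq_getElem?_getD]

theorem IsRootedHole.shortcut {l : List V} (hl : IsRootedHole G l) {x : V} {j m : ℕ} (hj : 2 ≤ j)
    (hjm : j + 2 ≤ m) (hm : m < l.length) (hx : x ∉ l)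
    (hadj : ∀ k < l.length, k ≤ j ∨ m ≤ k → (G.Adj x l[k]! ↔ k = j ∨ k = m)) :
    IsRootedHole G (l.take (j + 1) ++ x :: l.drop m) := by
  obtain ⟨g1, g2, g3⟩ := getElem!_shortcut (x := x) (m := m) (show j < l.length by omega)
  have hlen := length_shortcut (x := x) (show j < l.length by omega) hm.le
  set q := l.take (j + 1) ++ x :: l.drop m with hq
  have hsub : (l.take (j + 1) ++ l.drop m).Sublist l := by
    conv_rhs => rw [← List.take_append_drop (j + 1) l]
    refine List.Sublist.append (List.Sublist.refl _) ?_
    rw [show l.drop m = (l.drop (j + 1)).drop (m - (j + 1)) by rw [List.drop_drop]; congr 1; omega]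
    exact List.drop_sublist _ _
  refine ⟨by omega, ?_, ?_⟩
  · rw [hq, List.perm_middle.nodup_iff, List.nodup_cons]
    exact ⟨fun h => hx (hsub.subset h), hl.2.1.sublist hsub⟩
  · intro a b hab hb
    have hcase : ∀ k < q.length, k ≤ j ∧ q[k]! = l[k]! ∨ k = j + 1 ∧ q[k]! = x ∨
        j + 2 ≤ k ∧ k + m - (j + 2) < l.length ∧ q[k]! = l[k + m - (j + 2)]! := by
      intro k hk
      rcases le_or_gt k j with h | h
      · exact Or.inl ⟨h, g1 k h⟩
      · rcases Nat.eq_or_lt_of_le h with rfl | h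
        · exact Or.inr (Or.inl ⟨rfl, g2⟩)
        · refine Or.inr (Or.inr ⟨h, by omega, ?_⟩)
          rw [← g3 (k + m - (j + 2)) (by omega) (by omega)]
          congr 1
          omega
    rcases hcase a (by omega) with ⟨ha, ha'⟩ | ⟨rfl, ha'⟩ | ⟨ha, ha2, ha'⟩ <;>
    rcases hcase b hb with ⟨hb1, hb'⟩ | ⟨rfl, hb'⟩ | ⟨hb1, hb2, hb'⟩ <;>
    (try (exfalso; omega)) <;> rw [ha', hb']
    · rw [hl.adj_iff (by omega) (by omega)]; omega
    · rw [SimpleGraph.adj_comm, hadj a (by omega) (Or.inl ha)]; omega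
    · rw [hl.adj_iff (by omega) (by omega)]; omega
    · rw [hadj _ hb2 (Or.inr (by omega))]; omega
    · rw [hl.adj_iff (by omega) (by omega)]; omega

variable [Fintype V]

/-- The ends of a rooted hole, the vertices at which the branching is defective, and the vertices
that are wasted. -/
noncomputable def badVertices (G : SimpleGraph V) (l : List V) : Finset V :=
  (((Finset.Ico 2 (l.length - 1)).filter fun i => DefectAt G l i).image fun i => l[i]!) ∪
    wasted G l ∪ {l[0]!, l[1]!, l[l.length - 1]!, l[l.length - 2]!}

/-- The place `j` of `l` is near to a bad vertex. -/
def NearBad (G : SimpleGraph V) (R : ℕ) (l : List V) (j : ℕ) : Prop :=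
  ∃ b ∈ badVertices G l, Near G R l[j]! b

theorem card_nearBad_le {D : ℕ} (hD : ∀ v, (Finset.univ.filter (G.Adj v)).card ≤ D) (R : ℕ) :
    (places G (NearBad G R)).card ≤ (D + 1) ^ R *
      (41 * D ^ 2 * (Fintype.card V * maxProd (Fintype.card V)) + 4 * (rootedHoles G).card) := by
  refine (card_places_le_of_near hD R (B := badVertices G) fun l j _ _ h => h).trans
    (Nat.mul_le_mul_left _ ?_)
  refine le_trans ?_ (Nat.add_le_add_right (sum_defects_add_wasted_le hD) _)
  rw [mul_comm 4, ← smul_eq_mul, ← Finset.sum_const, ← Finset.sum_add_distrib]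
  refine Finset.sum_le_sum fun l _ => (Finset.card_union_le _ _).trans (Nat.add_le_add
    ((Finset.card_union_le _ _).trans (Nat.add_le_add_right Finset.card_image_le _)) ?_)
  exact Finset.card_le_four

theorem card_innerDefect_le {D : ℕ} (hD : ∀ v, (Finset.univ.filter (G.Adj v)).card ≤ D) :
    (places G (InnerDefect G)).card ≤
      41 * D ^ 2 * (Fintype.card V * maxProd (Fintype.card V)) := by
  rw [card_places_eq_sum]
  refine le_trans (Finset.sum_le_sum fun l _ => ?_) (sum_defects_add_wasted_le hD)
  refine le_trans (Finset.card_le_card fun i hi => ?_) (Nat.le_add_right _ _)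
  rw [Finset.mem_filter] at hi ⊢
  obtain ⟨-, h1, h2, h3⟩ := hi
  exact ⟨Finset.mem_Ico.2 ⟨h1, by omega⟩, h3⟩

theorem not_nearBad_iff {R : ℕ} {l : List V} {j : ℕ} :
    ¬ NearBad G R l j ↔ ∀ b ∈ badVertices G l, ¬ Near G R l[j]! b := by
  rw [NearBad]
  push Not
  rfl

section Clean

variable {R : ℕ} {l : List V} {i j : ℕ}

theorem inner_of_not_nearBad (h : ¬ NearBad G R l j) (hi : i < l.length)
    (hn : Near G R l[j]! l[i]!) : 2 ≤ i ∧ i + 2 < l.length := by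
  rw [not_nearBad_iff] at h
  have key : ∀ k, l[k]! ∈ badVertices G l → i ≠ k := by
    rintro k hk rfl
    exact h _ hk hn
  have h0 := key 0 (by simp [badVertices])
  have h1 := key 1 (by simp [badVertices])
  have h2 := key (l.length - 1) (by simp [badVertices])
  have h3 := key (l.length - 2) (by simp [badVertices])
  omega

theorem not_defectAt_of_not_nearBad (h : ¬ NearBad G R l j) (hi : i < l.length)
    (hn : Near G R l[j]! l[i]!) : ¬ DefectAt G l i := by
  obtain ⟨h1, h2⟩ := inner_of_not_nearBad h hi hn
  intro hd
  refine not_nearBad_iff.1 h _ (Finset.mem_union_left _ (Finset.mem_union_left _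
    (Finset.mem_image.2 ⟨i, Finset.mem_filter.2 ⟨Finset.mem_Ico.2 ⟨h1, by omega⟩, hd⟩, rfl⟩))) hn

theorem card_options_of_not_nearBad (h : ¬ NearBad G R l j) (hi : i < l.length)
    (hn : Near G R l[j]! l[i]!) : (options G l i).card = 3 :=
  card_options_of_not_defectAt hi (not_defectAt_of_not_nearBad h hi hn)

theorem notMem_wasted_of_not_nearBad (h : ¬ NearBad G R l j) {w : V} (hn : Near G R l[j]! w) :
    w ∉ wasted G l := fun hw =>
  not_nearBad_iff.1 h _ (Finset.mem_union_left _ (Finset.mem_union_right _ hw)) hn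

end Clean

/-- The option `x` at place `j` is adjacent to a later vertex of the hole. -/
def Shortcut (G : SimpleGraph V) (l : List V) (j : ℕ) : Prop :=
  ∃ x ∈ options G l j, x ≠ l[j + 1]! ∧ ∃ m, j + 3 ≤ m ∧ m < l.length ∧ G.Adj x l[m]!

/-- The replacement of a segment after place `j` by one vertex gives a hole for which the place `j`
is near to a bad vertex. -/
def BadShortcut (G : SimpleGraph V) (R T : ℕ) (l : List V) (j : ℕ) : Prop :=
  ∃ l' : List V, ∃ q : List V, IsRootedHole G l' ∧ j < l'.length ∧ NearBad G R l' j ∧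
    q.length ≤ T ∧ (∀ x ∈ q, Near G T l'[j]! x) ∧ l = l'.take (j + 1) ++ (q ++ l'.drop (j + 2))

/-- The hole l is recovered from the shortened hole, the place and the removed segment. That segment
is a list of bounded length in a ball around the place, so the map is boundedly many to one. -/
theorem card_badShortcut_le {D : ℕ} (hD : ∀ v, (Finset.univ.filter (G.Adj v)).card ≤ D)
    (R T : ℕ) :
    (places G (BadShortcut G R T)).card ≤
      ((D + 1) ^ T + 1) ^ T * (places G (NearBad G R)).card := by
  have hex : ∀ p : List V × ℕ, ∃ r : List V × List V, p ∈ places G (BadShortcut G R T) →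
      IsRootedHole G r.1 ∧ p.2 < r.1.length ∧ NearBad G R r.1 p.2 ∧ r.2.length ≤ T ∧
      (∀ x ∈ r.2, Near G T r.1[p.2]! x) ∧
        p.1 = r.1.take (p.2 + 1) ++ (r.2 ++ r.1.drop (p.2 + 2)) := by
    intro p
    by_cases hp : p ∈ places G (BadShortcut G R T)
    · obtain ⟨-, -, l', q, h⟩ := mem_places.1 hp
      exact ⟨(l', q), fun _ => h⟩
    · exact ⟨default, fun h => absurd h hp⟩
  choose r hr using hex
  rw [mul_comm]
  have hcard : ∀ p ∈ places G (NearBad G R),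
      (listsIn (Finset.univ.filter (Near G T p.1[p.2]!)) T).card ≤ ((D + 1) ^ T + 1) ^ T := by
    intro p _
    exact (card_listsIn_le _ _).trans (Nat.pow_le_pow_left (Nat.succ_le_succ (card_near_le hD T _)) _)
  rw [← smul_eq_mul]
  refine le_trans ?_ (Finset.sum_le_card_nsmul _ _ _ hcard)
  rw [← Finset.card_sigma]
  refine Finset.card_le_card_of_injOn (fun p => ⟨((r p).1, p.2), (r p).2⟩) ?_ ?_
  · intro p hp
    obtain ⟨h1, h2, h3, h4, h5, -⟩ := hr p hp
    exact Finset.mem_coe.2 (Finset.mem_sigma.2 ⟨mem_places.2 ⟨h1, h2, h3⟩, mem_listsIn h4 fun x hx =>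
      Finset.mem_filter.2 ⟨Finset.mem_univ _, h5 x hx⟩⟩)
  · intro p hp p' hp' h
    simp only [Sigma.mk.injEq, Prod.mk.injEq, heq_eq_eq] at h
    obtain ⟨⟨h1, h2⟩, h3⟩ := h
    refine Prod.ext ?_ h2
    rw [(hr p hp).2.2.2.2.2, (hr p' hp').2.2.2.2.2, h1, h2, h3]

theorem card_dominated_add_sum {l : List V} (hl : IsRootedHole G l) {i j : ℕ} (hi : 2 ≤ i)
    (hij : i ≤ j) (hj : j ≤ l.length) :
    (dominated G l j).card =
      (dominated G l i).card + ∑ k ∈ Finset.Ico i j, (options G l k).card := by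
  induction j, hij using Nat.le_induction with
  | base => simp
  | succ j hij ih =>
    rw [hl.card_dominated_succ (by omega) (by omega), ih (by omega), Finset.sum_Ico_succ_top hij,
      add_assoc]

/-- Every vertex not dominated by place i is either an option at exactly one later place or wasted.
-/
theorem card_eq_add_sum_add_wasted {l : List V} (hl : IsRootedHole G l) {i : ℕ} (hi : 2 ≤ i)
    (hil : i < l.length) :
    Fintype.card V = (dominated G l i).card +
      ∑ k ∈ Finset.Ico i (l.length - 1), (options G l k).card + (wasted G l).card := by
  rw [← card_dominated_add_sum hl hi (by omega) (by omega), wasted, Finset.card_add_card_compl]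

end Shortcuts

/-! ### Exchanging segments: options with the same new neighbours -/

section Exchange

open scoped Classical

variable {V : Type u} [Inhabited V] {G : SimpleGraph V}

theorem exists_last_adj {l : List V} {x : V} {m : ℕ} (hm : m < l.length) (h : G.Adj x l[m]!) :
    ∃ k, m ≤ k ∧ k < l.length ∧ G.Adj x l[k]! ∧ ∀ i, k < i → i < l.length → ¬ G.Adj x l[i]! := by
  have hne : ((Finset.Ico m l.length).filter fun i => G.Adj x l[i]!).Nonempty :=
    ⟨m, Finset.mem_filter.2 ⟨Finset.mem_Ico.2 ⟨le_rfl, hm⟩, h⟩⟩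
  obtain ⟨k, hk, hmax⟩ := Finset.exists_max_image _ id hne
  obtain ⟨h1, h2⟩ := Finset.mem_filter.1 hk
  rw [Finset.mem_Ico] at h1
  refine ⟨k, h1.1, h1.2, h2, fun i hi hil hadj => ?_⟩
  have : i ≤ k := hmax i (Finset.mem_filter.2 ⟨Finset.mem_Ico.2 ⟨by omega, hil⟩, hadj⟩)
  omega

variable [Fintype V]

/-- If a segment of a hole is replaced by a single vertex, and the surroundings are without bad
vertices before and after, then only one vertex is replaced. -/
theorem nearBad_of_exchange {l l' : List V} (hl : IsRootedHole G l) (hl' : IsRootedHole G l')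
    {x : V} {j m T R : ℕ} (hj : 2 ≤ j) (hjm : j + 3 ≤ m) (hm : m + 2 < l.length) (hmT : m < j + T)
    (hR : T + 3 ≤ R) (hjx : G.Adj l[j]! x) (hlen : l'.length = l.length + (j + 2) - m)
    (h1 : ∀ k ≤ j, l'[k]! = l[k]!) (h2 : l'[j + 1]! = x)
    (h3 : ∀ k, m ≤ k → k < l.length → l'[k + (j + 2) - m]! = l[k]!) (hc : ¬ NearBad G R l j) :
    NearBad G R l' j := by
  by_contra hc'
  have hjj : l'[j]! = l[j]! := h1 j le_rfl
  have hnear : ∀ k, j < k → k < m → Near G T l[j]! l[k]! := fun k hk hkm =>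
    (hl.near hk.le (by omega)).mono (by omega)
  have hnx : Near G 1 l[j]! x := near_of_adj hjx
  have hstep : ∀ {v w : V}, Near G T l[j]! v → w = v ∨ G.Adj v w → Near G (T + 1) l[j]! w := by
    rintro v w hv (rfl | h)
    · exact hv.mono (Nat.le_succ _)
    · exact hv.trans (near_of_adj h)
  have hsub1 : ∀ i, m ≤ i → i < l.length → ∀ w ∈ dominated G l i, w ∉ dominated G l' (i + (j + 2) - m) →
      Near G (T + 1) l[j]! w := by
    intro i hi hil w hw hw'
    obtain ⟨k, hk1, hki, hk⟩ := mem_dominated.1 hw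
    rcases le_or_gt k j with hkj | hkj
    · exact absurd (mem_dominated.2 ⟨k, hk1, by omega, by rwa [h1 k hkj]⟩) hw'
    · rcases lt_or_ge k m with hkm | hkm
      · exact hstep (hnear k hkj hkm) hk
      · exact absurd (mem_dominated.2 ⟨k + (j + 2) - m, by omega, by omega,
          by rwa [h3 k hkm (by omega)]⟩) hw'
  have hsub2 : ∀ i, m ≤ i → i < l.length → ∀ w ∈ dominated G l' (i + (j + 2) - m), w ∉ dominated G l i →
      Near G (T + 1) l[j]! w := by
    intro i hi hil w hw' hw
    obtain ⟨k, hk1, hki, hk⟩ := mem_dominated.1 hw'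
    rcases le_or_gt k j with hkj | hkj
    · exact absurd (mem_dominated.2 ⟨k, hk1, by omega, by rwa [← h1 k hkj]⟩) hw
    · rcases Nat.eq_or_lt_of_le hkj with rfl | hkj
      · rw [h2] at hk
        exact hstep (hnx.mono (by omega)) hk
      · refine absurd (mem_dominated.2 ⟨k + m - (j + 2), by omega, by omega, ?_⟩) hw
        rwa [← h3 (k + m - (j + 2)) (by omega) (by omega),
          show k + m - (j + 2) + (j + 2) - m = k by omega]
  have hdom : dominated G l j = dominated G l' j := dominated_congr fun k hk => (h1 k hk.le).symm
  -- The two dominated sets differ only near l[j], and there neither hole has wasted vertices.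
  have hwaste : (wasted G l).card = (wasted G l').card := by
    congr 1
    have e : l'.length - 1 = l.length - 1 + (j + 2) - m := by omega
    ext w
    simp only [wasted, Finset.mem_compl, e]
    constructor
    · intro hw hw'
      exact notMem_wasted_of_not_nearBad hc
        ((hsub2 _ (by omega) (by omega) w hw' hw).mono (by omega)) (Finset.mem_compl.2 hw)
    · intro hw' hw
      have := (hsub1 _ (by omega) (by omega) w hw hw').mono (show T + 1 ≤ R by omega)
      rw [← hjj] at this
      exact notMem_wasted_of_not_nearBad hc' this (Finset.mem_compl.2 (by rwa [e]))
  have hopt : ∀ i, m ≤ i → i < l.length →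
      (options G l i).card = (options G l' (i + (j + 2) - m)).card := by
    intro i hi hil
    by_cases heq : options G l i = options G l' (i + (j + 2) - m)
    · rw [heq]
    · have hi3 := h3 i hi hil
      have hnear : Near G (T + 2) l[j]! l[i]! := by
        by_contra hfar
        refine heq (Finset.ext fun w => ?_)
        rw [mem_options, mem_options, hi3]
        refine and_congr_right fun hw => not_congr ?_
        by_contra hne
        have hw' : Near G (T + 1) l[j]! w := by
          by_cases hwl : w ∈ dominated G l i
          · exact hsub1 i hi hil w hwl fun h => hne (iff_of_true hwl h)
          · exact hsub2 i hi hil w (by_contra fun h => hne (iff_of_false hwl h)) hwl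
        exact hfar (hw'.trans (near_of_adj hw.symm))
      rw [card_options_of_not_nearBad hc hil (hnear.mono (by omega)),
        card_options_of_not_nearBad hc' (by omega) (by
          rw [hi3, hjj]
          exact hnear.mono (by omega))]
  -- Both holes partition all vertices. They agree before place j and have equal numbers of options
  -- after the exchanged part, while that part uses 3(m - j) vertices in one and 6 in the other.
  -- This contradicts m ≥ j + 3.
  have n1 := card_eq_add_sum_add_wasted hl hj (by omega)
  have n2 := card_eq_add_sum_add_wasted hl' hj (by omega)
  rw [← Finset.sum_Ico_consecutive _ (show j ≤ m by omega) (show m ≤ l.length - 1 by omega)] at n1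
  rw [← Finset.sum_Ico_consecutive _ (show j ≤ j + 2 by omega)
    (show j + 2 ≤ l'.length - 1 by omega)] at n2
  have s1 : ∑ k ∈ Finset.Ico j m, (options G l k).card = 3 * (m - j) := by
    rw [Finset.sum_congr rfl fun k hk => ?_, Finset.sum_const, Nat.card_Ico, smul_eq_mul, mul_comm]
    rw [Finset.mem_Ico] at hk
    exact card_options_of_not_nearBad hc (by omega) ((hl.near hk.1 (by omega)).mono (by omega))
  have s2 : ∑ k ∈ Finset.Ico j (j + 2), (options G l' k).card = 6 := by
    have h0 := card_options_of_not_nearBad hc' (i := j) (by omega) (Near.refl _ _)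
    have h1 := card_options_of_not_nearBad hc' (i := j + 1) (by omega)
      ((hl'.near (Nat.le_succ j) (by omega)).mono (by omega))
    rw [Finset.sum_Ico_succ_top (by omega), Finset.sum_Ico_succ_top (by omega), h0, h1]
    simp
  have s3 : ∑ k ∈ Finset.Ico m (l.length - 1), (options G l k).card =
      ∑ k ∈ Finset.Ico (j + 2) (l'.length - 1), (options G l' k).card := by
    refine Finset.sum_bij (fun k _ => k + (j + 2) - m) ?_ ?_ ?_ ?_
    · intro k hk
      rw [Finset.mem_Ico] at hk ⊢
      omega
    · intro a ha b hb h
      rw [Finset.mem_Ico] at ha hb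
      omega
    · intro b hb
      rw [Finset.mem_Ico] at hb
      exact ⟨b + m - (j + 2), Finset.mem_Ico.2 (by omega), by omega⟩
    · intro k hk
      rw [Finset.mem_Ico] at hk
      exact hopt k hk.1 (by omega)
  rw [hdom] at n1
  omega

/-- Let l[m] be the last neighbour of x on the hole. If m is far from j, then x is met again late, a
far return at m. Otherwise x replaces the segment between j and m, and the exchange argument yields
a bad vertex near the new hole. -/
theorem Shortcut.farReturn_or_badShortcut {l : List V} {j T R : ℕ} (hl : IsRootedHole G l)
    (hjl : j < l.length) (hR : T + 3 ≤ R) (hc : ¬ NearBad G R l j) (h : Shortcut G l j) :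
    (∃ m < l.length, FarReturn G T l m ∧ Near G 2 l[j]! l[m]!) ∨ BadShortcut G R T l j := by
  obtain ⟨x, hx, hxj, m₀, hm₀, hm₀l, hxm₀⟩ := h
  obtain ⟨m, hm, hml, hxm, hlast⟩ := exists_last_adj hm₀l hxm₀
  rw [mem_options] at hx
  obtain ⟨hjx, hxd⟩ := hx
  have hnm : Near G 2 l[j]! l[m]! := (near_of_adj hjx).trans (near_of_adj hxm)
  obtain ⟨hj1, hj2⟩ := inner_of_not_nearBad hc hjl (Near.refl _ _)
  obtain ⟨hm1, hm2⟩ := inner_of_not_nearBad hc hml (hnm.mono (by omega))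
  by_cases hT : j + T ≤ m
  · exact Or.inl ⟨m, hml, ⟨by omega, x, hxm.symm, j, by omega, hT, hjx⟩, hnm⟩
  right
  have hxl : x ∉ l := by
    intro hxl
    obtain ⟨k, hk, rfl⟩ := exists_getElem!_eq hxl
    rcases lt_or_ge k j with hkj | hkj
    · exact hxd (hl.mem_dominated_self hj1 hkj hk)
    · rw [hl.adj_iff hjl hk] at hjx
      have : k ≠ j + 1 := by rintro rfl; exact hxj rfl
      omega
  have hadj : ∀ k < l.length, k ≤ j ∨ m ≤ k → (G.Adj x l[k]! ↔ k = j ∨ k = m) := by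
    intro k hk hkjm
    constructor
    · intro hxk
      by_contra! hne
      rcases hkjm with hkj | hkm
      · rcases Nat.eq_zero_or_pos k with rfl | hpos
        · have := inner_of_not_nearBad (i := 0) hc (by omega)
            (((near_of_adj hjx).trans (near_of_adj hxk)).mono (by omega))
          omega
        · exact hxd (mem_dominated.2 ⟨k, hpos, by omega, Or.inr hxk.symm⟩)
      · exact hlast k (by omega) hk hxk
    · rintro (rfl | rfl)
      · exact hjx.symm
      · exact hxm
  have hl' := hl.shortcut hj1 (show j + 2 ≤ m by omega) hml hxl hadj
  have hlen := length_shortcut (x := x) hjl hml.le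
  obtain ⟨g1, g2, g3⟩ := getElem!_shortcut (x := x) (m := m) hjl
  have htake : (l.take (j + 1)).length = j + 1 := by rw [List.length_take]; omega
  refine ⟨_, (l.take m).drop (j + 1), hl', by omega,
    nearBad_of_exchange hl hl' hj1 (by omega) hm2 (by omega) hR hjx hlen g1 g2 g3 hc, ?_, ?_, ?_⟩
  · rw [List.length_drop, List.length_take]
    omega
  · intro y hy
    obtain ⟨k, hk, rfl⟩ := exists_getElem!_eq hy
    rw [List.length_drop, List.length_take] at hk
    rw [g1 j le_rfl, getElem!_drop, getElem!_take_of_lt (by omega)]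
    exact (hl.near (by omega) (by omega)).mono (by omega)
  · have e1 : (l.take (j + 1) ++ x :: l.drop m).take (j + 1) = l.take (j + 1) := by
      rw [List.take_append_of_le_length htake.ge, List.take_take, min_self]
    have e2 : (l.take (j + 1) ++ x :: l.drop m).drop (j + 2) = l.drop m := by
      rw [List.drop_append, htake, List.drop_of_length_le (by omega), List.nil_append,
        show j + 2 - (j + 1) = 1 by omega]
      rfl
    rw [e1, e2]
    have e3 : l.take (j + 1) = (l.take m).take (j + 1) := by
      rw [List.take_take, Nat.min_eq_left (by omega)]
    rw [e3, ← List.append_assoc, List.take_append_drop, List.take_append_drop]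

/-- Some option `x` at place `j` has a neighbour that is new, and not adjacent to the next vertex. -/
def ExtraNeighbor (G : SimpleGraph V) (l : List V) (j : ℕ) : Prop :=
  ∃ x ∈ options G l j, x ≠ l[j + 1]! ∧
    ∃ y, G.Adj x y ∧ y ∉ dominated G l (j + 1) ∧ ¬ G.Adj l[j + 1]! y

/-- Some option `x` at place `j` is not adjacent to one of the new neighbours of the next vertex. -/
def MissingNeighbor (G : SimpleGraph V) (l : List V) (j : ℕ) : Prop :=
  ∃ x ∈ options G l j, ∃ y, G.Adj l[j + 1]! y ∧ y ∉ dominated G l (j + 1) ∧ ¬ G.Adj x y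

variable {D : ℕ}

theorem card_shortcut_le (hD : ∀ v, (Finset.univ.filter (G.Adj v)).card ≤ D) {T R : ℕ}
    (hR : T + 3 ≤ R) :
    (places G (Shortcut G)).card ≤ (1 + ((D + 1) ^ T + 1) ^ T) * (places G (NearBad G R)).card +
      (D + 1) ^ 2 * (places G (FarReturn G T)).card := by
  have h1 : (places G (Shortcut G)).card ≤ (places G (NearBad G R)).card +
      (places G fun l j => (∃ m < l.length, FarReturn G T l m ∧ Near G 2 l[j]! l[m]!) ∨
        BadShortcut G R T l j).card := by
    refine card_places_le_add fun l j hl hj h => ?_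
    by_cases hc : NearBad G R l j
    · exact Or.inl hc
    · exact Or.inr (h.farReturn_or_badShortcut hl hj hR hc)
  have h2 := card_places_le_add (G := G) (E := fun l j =>
    (∃ m < l.length, FarReturn G T l m ∧ Near G 2 l[j]! l[m]!) ∨ BadShortcut G R T l j)
    (fun l j _ _ h => h)
  have h3 := card_places_near_le hD 2 (E := FarReturn G T)
  have h4 := card_badShortcut_le hD R T
  rw [add_mul, one_mul]
  omega

theorem card_extraNeighbor_le (hD : ∀ v, (Finset.univ.filter (G.Adj v)).card ≤ D) {R : ℕ}
    (hR : 3 ≤ R) :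
    (places G (ExtraNeighbor G)).card ≤ (places G (NearBad G R)).card +
      10 * (D + 1) ^ 6 * (places G (Shortcut G)).card := by
  -- The property φ says that an earlier option x is adjacent to the last vertex of the prefix.
  set φ : List V → Prop := fun τ => ∃ j, j + 4 ≤ τ.length ∧ ∃ x ∈ options G τ j, x ≠ τ[j + 1]! ∧
    G.Adj x τ[τ.length - 1]! with hφ
  set A : List V → ℕ → Prop := fun l i => (i + 1 < l.length ∧ ¬ DefectAt G l i) ∧
      ∃ y ∈ options G l i, φ (l.take (i + 1) ++ [y]) with hA
  have h1 : (places G (ExtraNeighbor G)).card ≤ (places G (NearBad G R)).card +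
      (places G fun l j => ∃ i < l.length, A l i ∧ Near G 3 l[j]! l[i]!).card := by
    refine card_places_le_add fun l j hl hj h => ?_
    by_cases hc : NearBad G R l j
    · exact Or.inl hc
    right
    obtain ⟨x, hx, hxj, y, hxy, hyd, hyj⟩ := h
    obtain ⟨hj1, hj2⟩ := inner_of_not_nearBad hc hj (Near.refl _ _)
    have hjx := (mem_options.1 hx).1
    have hny : Near G 2 l[j]! y := (near_of_adj hjx).trans (near_of_adj hxy)
    have hyw := notMem_wasted_of_not_nearBad hc (hny.mono (by omega))
    rw [wasted, Finset.mem_compl, not_not] at hyw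
    -- The vertex y is not wasted, so it becomes an option at some place i; it is new and not
    -- adjacent to l[j + 1], hence i ≥ j + 2. If the hole continued with y there, x would be a
    -- shortcut, and the transfer lemma counts these events.
    have hex : ∃ i, y ∈ dominated G l (i + 1) ∧ i + 1 < l.length :=
      ⟨l.length - 2, by rwa [show l.length - 2 + 1 = l.length - 1 by omega], by omega⟩
    obtain ⟨hi1, hi2⟩ := Nat.find_spec hex
    have hmin := fun k hk => Nat.find_min hex (m := k) hk
    set i := Nat.find hex
    have hij : j < i := by
      by_contra! h
      exact hyd (dominated_mono (by omega) hi1)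
    have hyi : y ∈ options G l i := by
      rw [hl.dominated_succ (by omega) (by omega), Finset.mem_union] at hi1
      refine hi1.resolve_left fun h => hmin (i - 1) (by omega) ⟨?_, by omega⟩
      rwa [Nat.sub_add_cancel (by omega)]
    have hiy := (mem_options.1 hyi).1
    have hij2 : j + 2 ≤ i := by
      by_contra! h
      have : i = j + 1 := by omega
      rw [this] at hiy
      exact hyj hiy
    have hni : Near G 3 l[j]! l[i]! := hny.trans (near_of_adj hiy.symm)
    refine ⟨i, by omega, ⟨⟨hi2, not_defectAt_of_not_nearBad hc (by omega) (hni.mono hR)⟩, y, hyi, ?_⟩, hni⟩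
    have hlen : (l.take (i + 1)).length = i + 1 := by rw [List.length_take]; omega
    have hget : ∀ k ≤ i, (l.take (i + 1) ++ [y])[k]! = l[k]! := fun k hk => by
      rw [getElem!_append_left' (by omega), getElem!_take_of_lt (by omega)]
    refine ⟨j, by rw [List.length_append, hlen, List.length_singleton]; omega, x, ?_, ?_, ?_⟩
    · rwa [options_congr fun k hk => hget k (by omega)]
    · rwa [hget _ (by omega)]
    · rw [List.length_append, hlen, List.length_singleton, Nat.add_sub_cancel]
      have : (l.take (i + 1) ++ [y])[i + 1]! = y := by
        rw [List.getElem!_eq_getElem?_getD, List.getElem?_append_right (by omega), hlen]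
        simp
      rwa [this]
  have h2 := card_places_near_le hD 3 (E := A)
  have h3 := card_places_option_le (G := G) φ
  have h4 : (places G fun l i => i + 1 < l.length ∧ φ (l.take (i + 2))).card ≤
      (D + 1) ^ 3 * (places G (Shortcut G)).card := by
    refine le_trans (card_places_mono ?_) (card_places_near_le hD 3)
    rintro l i hl hi ⟨hi1, j, hj, x, hx, hxj, hxi⟩
    have hlen : (l.take (i + 2)).length = i + 2 := by rw [List.length_take]; omega
    rw [hlen] at hj hxi
    rw [options_take (by omega)] at hx
    rw [getElem!_take_of_lt (by omega)] at hxj hxi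
    rw [show i + 2 - 1 = i + 1 by omega] at hxi
    refine ⟨j, by omega, ⟨x, hx, hxj, i + 1, by omega, hi1, hxi⟩, ?_⟩
    exact ((near_of_adj (hl.adj_succ hi1)).trans (near_of_adj hxi.symm)).trans
      (near_of_adj (mem_options.1 hx).1.symm)
  calc _ ≤ _ := h1
    _ ≤ (places G (NearBad G R)).card + (D + 1) ^ 3 * (10 * ((D + 1) ^ 3 * (places G (Shortcut G)).card)) :=
        Nat.add_le_add_left (h2.trans (Nat.mul_le_mul_left _ (h3.trans (Nat.mul_le_mul_left _ h4)))) _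
    _ = _ := by ring

theorem card_missingNeighbor_le {R : ℕ} :
    (places G (MissingNeighbor G)).card ≤ (places G (NearBad G R)).card +
      10 * (places G (ExtraNeighbor G)).card := by
  -- Exchange the roles of two options: in a hole that continues with x instead of l[j + 1], the
  -- vertex l[j + 1] is an option with the extra neighbour y.
  set φ : List V → Prop := fun τ => ∃ x ∈ options G τ (τ.length - 2), x ≠ τ[τ.length - 1]! ∧
    ∃ y, G.Adj x y ∧ y ∉ dominated G τ (τ.length - 1) ∧ ¬ G.Adj τ[τ.length - 1]! y with hφ
  have h1 : (places G (MissingNeighbor G)).card ≤ (places G (NearBad G R)).card +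
      (places G fun l j => (j + 1 < l.length ∧ ¬ DefectAt G l j) ∧
        ∃ x ∈ options G l j, φ (l.take (j + 1) ++ [x])).card := by
    refine card_places_le_add fun l j hl hj h => ?_
    by_cases hc : NearBad G R l j
    · exact Or.inl hc
    right
    obtain ⟨x, hx, y, hjy, hyd, hxy⟩ := h
    obtain ⟨hj1, hj2⟩ := inner_of_not_nearBad hc hj (Near.refl _ _)
    refine ⟨⟨by omega, not_defectAt_of_not_nearBad hc hj (Near.refl _ _)⟩, x, hx, ?_⟩
    have hlen : (l.take (j + 1)).length = j + 1 := by rw [List.length_take]; omega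
    have hget : ∀ k ≤ j, (l.take (j + 1) ++ [x])[k]! = l[k]! := fun k hk => by
      rw [getElem!_append_left' (by omega), getElem!_take_of_lt (by omega)]
    have hlast : (l.take (j + 1) ++ [x])[j + 1]! = x := by
      rw [List.getElem!_eq_getElem?_getD, List.getElem?_append_right (by omega), hlen]
      simp
    rw [hφ]
    simp only [List.length_append, hlen, List.length_singleton, Nat.add_sub_cancel,
      show j + 1 + 1 - 2 = j by omega, hlast]
    rw [options_congr hget, dominated_congr fun k hk => hget k (by omega)]
    refine ⟨l[j + 1]!, hl.getElem_mem_options (by omega) (by omega), ?_, y, hjy, hyd, hxy⟩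
    rintro rfl
    exact hxy hjy
  have h2 := card_places_option_le (G := G) φ
  have h3 : (places G fun l j => j + 1 < l.length ∧ φ (l.take (j + 2))).card ≤
      (places G (ExtraNeighbor G)).card := by
    refine card_places_mono ?_
    rintro l j hl hj ⟨hj1, hφ'⟩
    have hlen : (l.take (j + 2)).length = j + 2 := by rw [List.length_take]; omega
    rw [hφ] at hφ'
    simp only [hlen, show j + 2 - 2 = j by omega, show j + 2 - 1 = j + 1 by omega] at hφ'
    rwa [options_take (by omega), dominated_take (by omega), getElem!_take_of_lt (by omega)] at hφ'
  omega

/-- A place that is near to a bad vertex, or where the options do not look alike. -/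
def Flawed (G : SimpleGraph V) (R : ℕ) (l : List V) (j : ℕ) : Prop :=
  NearBad G R l j ∨ ExtraNeighbor G l j ∨ MissingNeighbor G l j

theorem card_flawed_le (hD : ∀ v, (Finset.univ.filter (G.Adj v)).card ≤ D) {T R : ℕ}
    (hR : T + 3 ≤ R) :
    (places G (Flawed G R)).card ≤
      (200 * (D + 1) ^ 6 * (1 + ((D + 1) ^ T + 1) ^ T)) * (places G (NearBad G R)).card +
      200 * (D + 1) ^ 8 * (places G (FarReturn G T)).card := by
  have h1 : (places G (Flawed G R)).card ≤ (places G (NearBad G R)).card +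
      (places G fun l j => ExtraNeighbor G l j ∨ MissingNeighbor G l j).card :=
    card_places_le_add fun l j _ _ h => h
  have h2 : (places G fun l j => ExtraNeighbor G l j ∨ MissingNeighbor G l j).card ≤
      (places G (ExtraNeighbor G)).card + (places G (MissingNeighbor G)).card :=
    card_places_le_add fun l j _ _ h => h
  have h3 := card_missingNeighbor_le (G := G) (R := R)
  have h4 := card_extraNeighbor_le hD (show 3 ≤ R by omega)
  have h5 := card_shortcut_le hD hR
  have h6 : 10 * (D + 1) ^ 6 * (places G (Shortcut G)).card ≤ 10 * (D + 1) ^ 6 * _ :=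
    Nat.mul_le_mul_left _ h5
  set a := (places G (NearBad G R)).card
  set b := (places G (FarReturn G T)).card
  set c := ((D + 1) ^ T + 1) ^ T
  have h7 : 1 ≤ (D + 1) ^ 6 := Nat.one_le_pow _ _ (by omega)
  have e1 : 10 * (D + 1) ^ 6 * ((1 + c) * a + (D + 1) ^ 2 * b) =
      10 * ((D + 1) ^ 6 * (1 + c) * a) + 10 * ((D + 1) ^ 8 * b) := by ring
  have e2 : 200 * (D + 1) ^ 6 * (1 + c) * a + 200 * (D + 1) ^ 8 * b =
      200 * ((D + 1) ^ 6 * (1 + c) * a) + 200 * ((D + 1) ^ 8 * b) := by ring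
  have e3 : a ≤ (D + 1) ^ 6 * (1 + c) * a := Nat.le_mul_of_pos_left _ (by positivity)
  omega

end Exchange

/-! ### Finding a long segment -/

section Segments

open scoped Classical

variable {V : Type u}

/-- Disjoint triples of vertices, consecutive ones completely joined, such that the neighbours of an
inner triple lie in itself and in the two triples next to it. -/
structure IsSegment (G : SimpleGraph V) (S : ℕ → Finset V) (m : ℕ) : Prop where
  card_eq : ∀ i < m, (S i).card = 3
  disjoint : ∀ i j, i < j → j < m → Disjoint (S i) (S j)
  adj : ∀ i, i + 1 < m → ∀ x ∈ S i, ∀ y ∈ S (i + 1), G.Adj x y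
  mem_of_adj : ∀ i, 1 ≤ i → i + 1 < m → ∀ x ∈ S i, ∀ y, G.Adj x y →
    y ∈ S (i - 1) ∨ y ∈ S i ∨ y ∈ S (i + 1)

variable [Inhabited V] [Fintype V] {G : SimpleGraph V} {D : ℕ}

theorem options_subset_dominated_succ {l : List V} {i : ℕ} (hi : 1 ≤ i) :
    options G l i ⊆ dominated G l (i + 1) := fun _ hw =>
  mem_dominated.2 ⟨i, hi, Nat.lt_succ_self i, Or.inr (mem_options.1 hw).1⟩

theorem adj_iff_of_not_flawed {R : ℕ} {l : List V} {j : ℕ} (h : ¬ Flawed G R l j) {x y : V}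
    (hx : x ∈ options G l j) (hy : y ∉ dominated G l (j + 1)) : G.Adj x y ↔ G.Adj l[j + 1]! y := by
  simp only [Flawed, not_or] at h
  obtain ⟨-, h1, h2⟩ := h
  constructor
  · intro hxy
    by_contra hjy
    by_cases hxj : x = l[j + 1]!
    · rw [hxj] at hxy
      exact hjy hxy
    · exact h1 ⟨x, hx, hxj, y, hxy, hy, hjy⟩
  · intro hjy
    by_contra hxy
    exact h2 ⟨x, hx, y, hjy, hy, hxy⟩

/-- Along a stretch without flaws the option sets have three elements and are disjoint, and all
options at a place have the same new neighbours. The radius m + 3 covers the stretch and the places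
where neighbours of its options were first dominated. -/
theorem isSegment_options {R m p : ℕ} {l : List V} (hl : IsRootedHole G l) (hp : p < l.length)
    (hgood : ∀ k < l.length, Near G (m + 3) l[p]! l[k]! → ¬ Flawed G R l k) :
    IsSegment G (fun i => options G l (p + i)) (m + 1) := by
  have hclean : ∀ k < l.length, Near G (m + 3) l[p]! l[k]! → 2 ≤ k ∧ k + 2 < l.length := fun k hk hn =>
    inner_of_not_nearBad (fun h => hgood k hk hn (Or.inl h)) hk (Near.refl _ _)
  have hrange : ∀ i ≤ m, p + i + 2 < l.length ∧ Near G i l[p]! l[p + i]! := by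
    intro i hi
    induction i with
    | zero => exact ⟨(hclean p hp (Near.refl _ _)).2, Near.refl _ _⟩
    | succ i ih =>
      obtain ⟨h1, h2⟩ := ih (by omega)
      have h3 : Near G (i + 1) l[p]! l[p + (i + 1)]! :=
        h2.trans (near_of_adj (hl.adj_succ (by omega)))
      exact ⟨(hclean _ (by omega) (h3.mono (by omega))).2, h3⟩
  have hp2 := (hclean p hp (Near.refl _ _)).1
  refine ⟨fun i hi => ?_, fun i j hij hj => ?_, fun i hi x hx y hy => ?_, ?_⟩
  · obtain ⟨h1, h2⟩ := hrange i (by omega)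
    exact card_options_of_not_nearBad (fun h => hgood _ (by omega) (h2.mono (by omega)) (Or.inl h))
      (by omega) (Near.refl _ _)
  · exact disjoint_dominated_options.mono_left
      ((options_subset_dominated_succ (by omega)).trans (dominated_mono (by omega)))
  · obtain ⟨h1, h2⟩ := hrange i (by omega)
    obtain ⟨hy1, hy2⟩ := mem_options.1 hy
    exact (adj_iff_of_not_flawed (hgood _ (by omega) (h2.mono (by omega))) hx hy2).2 hy1
  · intro i hi him x hx y hxy
    obtain ⟨h1, h2⟩ := hrange i (by omega)
    obtain ⟨hx1, hx2⟩ := mem_options.1 hx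
    by_cases hy : y ∈ dominated G l (p + i + 1)
    · have hex : ∃ k, y ∈ dominated G l (k + 1) := ⟨_, hy⟩
      have hk := Nat.find_spec hex
      have hmin := fun k hk => Nat.find_min hex (m := k) hk
      have hki : Nat.find hex ≤ p + i := Nat.find_min' hex hy
      set k := Nat.find hex
      obtain ⟨k', hk'1, hk'2, hk'⟩ := mem_dominated.1 hk
      have hnx : Near G 2 l[p + i]! y := (near_of_adj hx1).trans (near_of_adj hxy)
      have hny : Near G 3 l[p + i]! l[k']! := by
        rcases hk' with rfl | hk'
        · exact hnx.mono (by omega)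
        · exact hnx.trans (near_of_adj hk'.symm)
      have hk'3 := (hclean k' (by omega) ((h2.trans hny).mono (by omega))).1
      have hkk' : k' = k := by
        by_contra hne
        refine hmin k' (by omega) (mem_dominated.2 ⟨k', hk'1, by omega, hk'⟩)
      rw [hkk'] at hny hk'3
      have hyk : y ∈ options G l k := by
        rw [hl.dominated_succ (by omega) (by omega), Finset.mem_union] at hk
        refine hk.resolve_left fun h => hmin (k - 1) (by omega) ?_
        rwa [Nat.sub_add_cancel (by omega)]
      rcases Nat.eq_or_lt_of_le hki with hki | hki
      · right; left
        rwa [← hki]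
      · left
        by_cases hk1 : k + 1 = p + i
        · rwa [show p + (i - 1) = k by omega]
        · exfalso
          have hxk : x ∉ dominated G l (k + 1) := fun h => hx2 (dominated_mono (by omega) h)
          -- An option y two or more places earlier shares its new neighbour x with l[k + 1], so x
          -- would have been dominated before.
          have := (adj_iff_of_not_flawed (hgood k (by omega) ((h2.trans hny).mono (by omega)))
            hyk hxk).1 hxy.symm
          exact hx2 (mem_dominated.2 ⟨k + 1, by omega, by omega, Or.inr this⟩)
    · right; right
      rw [← add_assoc, mem_options]
      exact ⟨(adj_iff_of_not_flawed (hgood _ (by omega) (h2.mono (by omega))) hx hy).1 hxy, hy⟩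

/-- Each place dominates at most D + 1 vertices and the rest is wasted, so an average hole has
length of order n / (D + 1). -/
theorem card_mul_card_rootedHoles_le (hD : ∀ v, (Finset.univ.filter (G.Adj v)).card ≤ D) :
    Fintype.card V * (rootedHoles G).card ≤ (D + 1) * (places G fun _ _ => True).card +
      41 * D ^ 2 * (Fintype.card V * maxProd (Fintype.card V)) := by
  refine le_trans ?_ (Nat.add_le_add_left (sum_defects_add_wasted_le hD) _)
  rw [card_places_eq_sum, Finset.mul_sum, ← Finset.sum_add_distrib, mul_comm, ← smul_eq_mul,
    ← Finset.sum_const]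
  refine Finset.sum_le_sum fun l _ => ?_
  have h1 : (dominated G l (l.length - 1)).card ≤ l.length * (D + 1) := by
    have hsub : dominated G l (l.length - 1) ⊆ (Finset.range l.length).biUnion fun k =>
        Finset.univ.filter (Near G 1 l[k]!) := by
      intro w hw
      obtain ⟨k, hk1, hk2, hk⟩ := mem_dominated.1 hw
      refine Finset.mem_biUnion.2 ⟨k, Finset.mem_range.2 (by omega),
        Finset.mem_filter.2 ⟨Finset.mem_univ _, ?_⟩⟩
      rcases hk with rfl | hk
      · exact Near.refl _ _
      · exact near_of_adj hk
    refine (Finset.card_le_card hsub).trans (Finset.card_biUnion_le.trans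
      ((Finset.sum_le_card_nsmul _ _ (D + 1) fun k _ => ?_).trans ?_))
    · simpa using card_near_le hD 1 l[k]!
    · rw [Finset.card_range, smul_eq_mul]
  have h2 : (dominated G l (l.length - 1)).card + (wasted G l).card = Fintype.card V := by
    rw [wasted, Finset.card_add_card_compl]
  rw [Finset.filter_true, Finset.card_range, mul_comm (D + 1)]
  omega

/-- A large graph of bounded degree with many rooted holes contains long segments. -/
theorem exists_isSegment (D m : ℕ) : ∃ n₁ : ℕ, ∀ (V : Type u) [Inhabited V] [Fintype V]
    (G : SimpleGraph V), n₁ ≤ Fintype.card V →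
    (∀ v, (Finset.univ.filter (G.Adj v)).card ≤ D) →
    Fintype.card V * maxProd (Fintype.card V) ≤ 5 * (rootedHoles G).card →
    ∃ S : ℕ → Finset V, IsSegment G S (m + 1) := by
  obtain ⟨d, hd⟩ : ∃ d, d = D + 1 := ⟨_, rfl⟩
  obtain ⟨K, hK⟩ : ∃ K, K = 205 * D ^ 2 := ⟨_, rfl⟩
  obtain ⟨Q, hQ⟩ : ∃ Q, Q = d ^ (m + 4) * (200 * d ^ 8) * (d ^ 2 * K) := ⟨_, rfl⟩
  -- The constant Q collects the factors of the far-return term that do not depend on t. With t - 1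
  -- = 2 Q + 2 this term uses less than about half of all places. T, C and W depend on t but not on
  -- n, so a large n absorbs them.
  obtain ⟨t, ht⟩ : ∃ t, t = 2 * Q + 3 := ⟨_, rfl⟩
  obtain ⟨T, hT⟩ : ∃ T, T = d * t := ⟨_, rfl⟩
  obtain ⟨C, hC⟩ : ∃ C, C = 200 * d ^ 6 * (1 + (d ^ T + 1) ^ T) := ⟨_, rfl⟩
  obtain ⟨W, hW⟩ : ∃ W, W = K + d ^ (m + 4) * C * (d ^ (T + 3) * (K + 4)) := ⟨_, rfl⟩
  refine ⟨(2 * Q + 2) * (W + Q) + 1, fun V _ _ G hn hD hM => ?_⟩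
  by_contra! hno
  obtain ⟨n, hnV⟩ : ∃ n, n = Fintype.card V := ⟨_, rfl⟩
  rw [← hnV] at hn hM
  -- Without a segment, every place of every rooted hole has a flawed place within distance m + 3.
  have hbad : (places G fun _ _ => True).card ≤
      d ^ (m + 3) * (places G (Flawed G (T + 3))).card := by
    rw [hd]
    refine le_trans (card_places_mono fun l j hl hj _ => ?_) (card_places_near_le hD (m + 3))
    by_contra! h
    exact hno _ (isSegment_options hl hj fun k hk hn hf => h k hk hf hn)
  have hflaw := card_flawed_le (G := G) hD (le_refl (T + 3))
  have hnb := card_nearBad_le (G := G) hD (T + 3)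
  have hfar := card_farReturn_le (G := G) hD (show 3 ≤ t by omega)
  have hin := card_innerDefect_le (G := G) hD
  have htot := card_mul_card_rootedHoles_le (G := G) hD
  rw [← hd, ← hC] at hflaw
  rw [← hd, ← hnV] at hnb
  rw [← hd, ← hT, ← hnV, show t - 1 = 2 * Q + 2 by omega] at hfar
  rw [← hd, ← hnV] at htot
  rw [← hnV] at hin
  set P := (places G fun _ _ => True).card
  set F := (places G (Flawed G (T + 3))).card
  set a := (places G (NearBad G (T + 3))).card
  set b := (places G (FarReturn G T)).card
  set I := (places G (InnerDefect G)).card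
  set Ω := (rootedHoles G).card
  have hKΩ : 41 * D ^ 2 * (n * maxProd n) ≤ K * Ω := by
    calc _ ≤ 41 * D ^ 2 * (5 * Ω) := Nat.mul_le_mul_left _ hM
      _ = _ := by rw [hK]; ring
  have hΩ : 0 < Ω := by
    have h1 := maxProd_pos n
    have : 0 < n * maxProd n := Nat.mul_pos (by omega) h1
    omega
  have ha : a ≤ d ^ (T + 3) * (K + 4) * Ω := by
    calc a ≤ d ^ (T + 3) * (K * Ω + 4 * Ω) := hnb.trans (Nat.mul_le_mul_left _ (by omega))
      _ = _ := by ring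
  have hb : (2 * Q + 2) * b ≤ d ^ 2 * K * (n + (2 * Q + 2)) * Ω := by
    calc _ ≤ d ^ 2 * ((n + (2 * Q + 2)) * (K * Ω)) :=
          hfar.trans (Nat.mul_le_mul_left _ (Nat.mul_le_mul_left _ (hin.trans hKΩ)))
      _ = _ := by ring
  have hP : d * P ≤ d ^ (m + 4) * (C * a + 200 * d ^ 8 * b) := by
    calc _ ≤ d * (d ^ (m + 3) * (C * a + 200 * d ^ 8 * b)) :=
          Nat.mul_le_mul_left _ (hbad.trans (Nat.mul_le_mul_left _ hflaw))
      _ = _ := by ring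
  have key : (2 * Q + 2) * (n * Ω) ≤ ((2 * Q + 2) * W + Q * (n + (2 * Q + 2))) * Ω := by
    calc (2 * Q + 2) * (n * Ω) ≤ (2 * Q + 2) * (d ^ (m + 4) * (C * a + 200 * d ^ 8 * b) + K * Ω) :=
          Nat.mul_le_mul_left _ (by omega)
      _ = (2 * Q + 2) * (d ^ (m + 4) * C) * a + d ^ (m + 4) * (200 * d ^ 8) * ((2 * Q + 2) * b) +
          (2 * Q + 2) * K * Ω := by ring
      _ ≤ (2 * Q + 2) * (d ^ (m + 4) * C) * (d ^ (T + 3) * (K + 4) * Ω) +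
          d ^ (m + 4) * (200 * d ^ 8) * (d ^ 2 * K * (n + (2 * Q + 2)) * Ω) +
          (2 * Q + 2) * K * Ω :=
          Nat.add_le_add_right (Nat.add_le_add (Nat.mul_le_mul_left _ ha)
            (Nat.mul_le_mul_left _ hb)) _
      _ = _ := by
        conv_rhs => rw [hW]
        have : Q * (n + (2 * Q + 2)) = d ^ (m + 4) * (200 * d ^ 8) * (d ^ 2 * K) * (n + (2 * Q + 2)) := by
          rw [← hQ]
        rw [this]
        ring
  rw [← mul_assoc] at key
  have key' := Nat.le_of_mul_le_mul_right key hΩ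
  nlinarith
end Segments

/-! ### Holes pass straight through a segment -/

section StraightPassing

open scoped Classical

variable {V : Type u} [Inhabited V] {G : SimpleGraph V} {S : ℕ → Finset V} {c i : ℕ} {l : List V}

theorem IsRootedHole.adj_zero_last (hl : IsRootedHole G l) : G.Adj l[0]! l[l.length - 1]! := by
  have h4 := hl.1
  rw [hl.adj_iff (by omega) (by omega)]
  omega

namespace IsSegment

/-- Every other position of the two neighbours of l[0] creates a chord, as seen from the position of
l[2], or puts four vertices of the hole into one triple. -/
theorem side_of_adj_adj (hS : IsSegment G S c) (hl : IsRootedHole G l) (h5 : 5 ≤ l.length)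
    (hi : 2 ≤ i) (hic : i + 2 < c) (h0 : l[0]! ∈ S i) :
    (l[1]! ∈ S (i + 1) ∧ l[l.length - 1]! ∈ S (i - 1)) ∨
      (l[1]! ∈ S (i - 1) ∧ l[l.length - 1]! ∈ S (i + 1)) := by
  obtain ⟨i, rfl⟩ : ∃ j, i = j + 2 := ⟨i - 2, by omega⟩
  have hxu : G.Adj l[0]! l[1]! := hl.adj_succ (by omega)
  have hxw := hl.adj_zero_last
  have huw : ¬ G.Adj l[1]! l[l.length - 1]! := by rw [hl.adj_iff (by omega) (by omega)]; omega
  have huv : G.Adj l[1]! l[2]! := hl.adj_succ (by omega)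
  have hxv : ¬ G.Adj l[0]! l[2]! := by rw [hl.adj_iff (by omega) (by omega)]; omega
  have hwv : ¬ G.Adj l[l.length - 1]! l[2]! := by rw [hl.adj_iff (by omega) (by omega)]; omega
  have a1 := hS.adj (i) (by omega)
  have a2 := hS.adj (i + 1) (by omega)
  have a3 := hS.adj (i + 2) (by omega)
  have a4 := hS.adj (i + 3) (by omega)
  have n2 := hS.mem_of_adj (i + 1) (by omega) (by omega)
  have n3 := hS.mem_of_adj (i + 2) (by omega) (by omega)
  have n4 := hS.mem_of_adj (i + 3) (by omega) (by omega)
  simp only [Nat.add_sub_cancel, show i + 2 - 1 = i + 1 by omega, show i + 3 - 1 = i + 2 by omega] at *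
  rcases n3 _ h0 _ hxu with hu | hu | hu <;> rcases n3 _ h0 _ hxw with hw | hw | hw
  · exfalso
    rcases n2 _ hu _ huv with hv | hv | hv
    · exact hwv (a1 _ hv _ hw).symm
    · exact hxv (a2 _ hv _ h0).symm
    · exact hwv (a2 _ hw _ hv)
  · exact absurd (a2 _ hu _ hw) huw
  · exact Or.inr ⟨hu, hw⟩
  · exact absurd (a2 _ hw _ hu).symm huw
  · exfalso
    rcases n3 _ hu _ huv with hv | hv | hv
    · exact hxv (a2 _ hv _ h0).symm
    · have hsub : ({l[0]!, l[1]!, l[2]!, l[l.length - 1]!} : Finset V) ⊆ S (i + 2) := by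
        simp [Finset.insert_subset_iff, -List.getElem!_eq_getElem?_getD, *]
      have hinj : ∀ a b, a < l.length → b < l.length → a ≠ b → l[a]! ≠ l[b]! :=
        fun a b ha hb hab h => hab (hl.inj ha hb h)
      have := Finset.card_le_card hsub
      rw [hS.card_eq _ (by omega), Finset.card_insert_of_notMem, Finset.card_insert_of_notMem,
        Finset.card_insert_of_notMem, Finset.card_singleton] at this
      · omega
      · simpa [-List.getElem!_eq_getElem?_getD] using hinj 2 (l.length - 1) (by omega) (by omega) (by omega)
      · simpa [-List.getElem!_eq_getElem?_getD] using ⟨hinj 1 2 (by omega) (by omega) (by omega),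
          hinj 1 (l.length - 1) (by omega) (by omega) (by omega)⟩
      · simpa [-List.getElem!_eq_getElem?_getD] using ⟨hinj 0 1 (by omega) (by omega) (by omega), hinj 0 2 (by omega) (by omega) (by omega),
          hinj 0 (l.length - 1) (by omega) (by omega) (by omega)⟩
    · exact hxv (a3 _ h0 _ hv)
  · exact absurd (a3 _ hu _ hw) huw
  · exact Or.inl ⟨hu, hw⟩
  · exact absurd (a3 _ hw _ hu).symm huw
  · exfalso
    rcases n4 _ hu _ huv with hv | hv | hv
    · exact hwv (a3 _ hv _ hw).symm
    · exact hxv (a3 _ h0 _ hv)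
    · exact hwv (a4 _ hw _ hv)

/-- A second vertex of the same triple would be adjacent to both neighbours of the first, which is
impossible in a hole of length at least five. -/
theorem eq_of_mem_mem (hS : IsSegment G S c) (hl : IsRootedHole G l) (h5 : 5 ≤ l.length)
    (hi : 2 ≤ i) (hic : i + 2 < c) {a b : ℕ} (ha : a < l.length) (hb : b < l.length)
    (hai : l[a]! ∈ S i) (hbi : l[b]! ∈ S i) : a = b := by
  have hlen : (l.rotate a).length = l.length := List.length_rotate ..
  have h0 : (l.rotate a)[0]! = l[a]! := by
    rw [getElem!_rotate a (by omega), zero_add, Nat.mod_eq_of_lt ha]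
  obtain ⟨k, hk, hkb⟩ := exists_getElem!_eq (List.mem_rotate.2 (getElem!_mem' hb) : l[b]! ∈ l.rotate a)
  have hr := hl.rotate a
  have hside := hS.side_of_adj_adj hr (by omega) hi hic (by rwa [h0])
  have a1 := hS.adj (i - 1) (by omega)
  have a2 := hS.adj i (by omega)
  rw [Nat.sub_add_cancel (by omega)] at a1
  rw [← hkb] at hbi
  have h1 : G.Adj (l.rotate a)[k]! (l.rotate a)[1]! ∧
      G.Adj (l.rotate a)[k]! (l.rotate a)[(l.rotate a).length - 1]! := by
    rcases hside with ⟨h1, h2⟩ | ⟨h1, h2⟩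
    · exact ⟨a2 _ hbi _ h1, (a1 _ h2 _ hbi).symm⟩
    · exact ⟨(a1 _ h1 _ hbi).symm, a2 _ hbi _ h2⟩
  rw [hr.adj_iff hk (by omega), hr.adj_iff hk (by omega)] at h1
  have hk0 : k = 0 := by omega
  rw [hk0, h0] at hkb
  exact hl.inj ha hb hkb

theorem exists_mem_of_mem (hS : IsSegment G S c) (hl : IsRootedHole G l) (h5 : 5 ≤ l.length)
    (hi : 2 ≤ i) (hic : i + 2 < c) (h : ∃ v ∈ l, v ∈ S i) :
    (∃ v ∈ l, v ∈ S (i + 1)) ∧ ∃ v ∈ l, v ∈ S (i - 1) := by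
  obtain ⟨v, hv, hvi⟩ := h
  obtain ⟨a, ha, rfl⟩ := exists_getElem!_eq hv
  have hlen : (l.rotate a).length = l.length := List.length_rotate ..
  have h0 : (l.rotate a)[0]! = l[a]! := by
    rw [getElem!_rotate a (by omega), zero_add, Nat.mod_eq_of_lt ha]
  have hside := hS.side_of_adj_adj (hl.rotate a) (by omega) hi hic (by rwa [h0])
  have hmem : ∀ k < l.length, (l.rotate a)[k]! ∈ l := fun k hk =>
    List.mem_rotate.1 (getElem!_mem' (by omega))
  have m1 := hmem 1 (by omega)
  have m2 := hmem ((l.rotate a).length - 1) (by omega)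
  rcases hside with ⟨h1, h2⟩ | ⟨h1, h2⟩
  · exact ⟨⟨_, m1, h1⟩, ⟨_, m2, h2⟩⟩
  · exact ⟨⟨_, m2, h2⟩, ⟨_, m1, h1⟩⟩

theorem exists_mem_of_mem_of_le (hS : IsSegment G S c) (hl : IsRootedHole G l) (h5 : 5 ≤ l.length)
    (hi : 2 ≤ i) (hic : i + 2 < c) (h : ∃ v ∈ l, v ∈ S i) {j : ℕ} (hj : 2 ≤ j) (hjc : j + 2 < c) :
    ∃ v ∈ l, v ∈ S j := by
  rcases le_total i j with hij | hij
  · induction j, hij using Nat.le_induction with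
    | base => exact h
    | succ j hij ih => exact (hS.exists_mem_of_mem hl h5 (by omega) (by omega) (ih (by omega) (by omega))).1
  · obtain ⟨d, rfl⟩ := Nat.exists_eq_add_of_le hij
    clear hij
    induction d generalizing j with
    | zero => exact h
    | succ d ih =>
      have := (hS.exists_mem_of_mem hl h5 (i := j + 1) (by omega) (by omega)
        (ih (by omega) (by omega) (by omega) (by omega) (by rwa [show j + 1 + d = j + (d + 1) by omega]))).2
      rwa [Nat.add_sub_cancel] at this

/-- A hole that meets an inner cluster of a segment can be traversed along the segment. -/
theorem exists_list_getElem (hS : IsSegment G S c) {H : Set V} (hH : IsHole G H) (hH4 : H.ncard ≠ 4)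
    (hi : 3 ≤ i) (hic : i + 2 < c) (h : ∃ v ∈ H, v ∈ S i) :
    ∃ l : List V, IsRootedHole G l ∧ (∀ w, w ∈ l ↔ w ∈ H) ∧ (5 ≤ l.length ∧ l[0]! ∈ S (i - 1) ∧
      l[1]! ∈ S i ∧ l[2]! ∈ S (i + 1) ∧ l[l.length - 1]! ∈ S (i - 2)) := by
  have hlen5 : ∀ l : List V, IsRootedHole G l → (∀ w, w ∈ l ↔ w ∈ H) → 5 ≤ l.length := by
    intro l hl hlH
    have : H = (l.toFinset : Set V) := by
      ext w
      rw [Finset.mem_coe, List.mem_toFinset, hlH]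
    rw [this, Set.ncard_coe_finset, List.toFinset_card_of_nodup hl.2.1] at hH4
    have := hl.1
    omega
  have key : ∀ l : List V, IsRootedHole G l → (∀ w, w ∈ l ↔ w ∈ H) → l[1]! ∈ S i →
      (l[2]! ∈ S (i + 1) ∧ l[0]! ∈ S (i - 1)) ∨ (l[2]! ∈ S (i - 1) ∧ l[0]! ∈ S (i + 1)) := by
    intro l hl hlH h1
    have h5 := hlen5 l hl hlH
    have hlen : (l.rotate 1).length = l.length := List.length_rotate ..
    have e0 : (l.rotate 1)[0]! = l[1]! := getElem!_rotate_of_lt (by omega)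
    have e1 : (l.rotate 1)[1]! = l[2]! := getElem!_rotate_of_lt (by omega)
    have e2 : (l.rotate 1)[(l.rotate 1).length - 1]! = l[0]! := by
      rw [getElem!_rotate 1 (by omega), hlen, Nat.sub_add_cancel (by omega), Nat.mod_self]
    have := hS.side_of_adj_adj (hl.rotate 1) (by omega) (by omega) hic (by rwa [e0])
    rwa [e1, e2] at this
  have hgood : ∃ l : List V, IsRootedHole G l ∧ (∀ w, w ∈ l ↔ w ∈ H) ∧ l[1]! ∈ S i ∧
      l[2]! ∈ S (i + 1) ∧ l[0]! ∈ S (i - 1) := by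
    obtain ⟨v, hv, hvi⟩ := h
    obtain ⟨l, hl, hlH, rfl⟩ := hH.exists_list_getElem hv (k := 1) (by norm_num)
    have h5 := hlen5 l hl hlH
    rcases key l hl hlH hvi with h | h
    · exact ⟨l, hl, hlH, hvi, h⟩
    · have hr : ∀ k ≤ 2, (l.reverse.rotate (l.length - 3))[k]! = l[2 - k]! := by
        intro k hk
        rw [getElem!_rotate_of_lt (by rw [List.length_reverse]; omega),
          getElem!_pos _ _ (by rw [List.length_reverse]; omega), getElem!_pos _ _ (by omega),
          List.getElem_reverse]
        congr 1
        omega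
      refine ⟨l.reverse.rotate (l.length - 3), hl.reverse.rotate _, fun w => ?_, ?_⟩
      · rw [List.mem_rotate, List.mem_reverse, hlH]
      · rw [hr 1 (by omega), hr 2 (by omega), hr 0 (by omega)]
        exact ⟨hvi, h.2, h.1⟩
  obtain ⟨l, hl, hlH, h1, h2, h0⟩ := hgood
  have h5 := hlen5 l hl hlH
  refine ⟨l, hl, hlH, h5, h0, h1, h2, ?_⟩
  rcases hS.side_of_adj_adj hl h5 (by omega) (by omega) h0 with h | h
  · exact h.2
  · exact absurd h.1 (Finset.disjoint_right.1 (hS.disjoint (i - 1 - 1) i (by omega) (by omega)) h1)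

end IsSegment

variable [Fintype V]

theorem exists_finset_rootedHoles {P : Set V → Prop} {Q : List V → Prop}
    (h : ∀ H, P H → ∃ l, IsRootedHole G l ∧ (∀ w, w ∈ l ↔ w ∈ H) ∧ Q l) :
    ∃ A : Finset (List V), (∀ l ∈ A, IsRootedHole G l ∧ Q l) ∧ {H | P H}.ncard ≤ A.card := by
  have h' : ∀ H, ∃ l, P H → IsRootedHole G l ∧ (∀ w, w ∈ l ↔ w ∈ H) ∧ Q l := by
    intro H
    by_cases hH : P H
    · obtain ⟨l, hl⟩ := h H hH
      exact ⟨l, fun _ => hl⟩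
    · exact ⟨[], fun h => absurd h hH⟩
  choose f hf using h'
  refine ⟨(rootedHoles G).filter Q, fun l hl => ?_, ?_⟩
  · rw [Finset.mem_filter, mem_rootedHoles] at hl
    exact hl
  rw [← Set.ncard_coe_finset]
  refine Set.ncard_le_ncard_of_injOn f ?_ ?_ (Finset.finite_toSet _)
  · intro H hH
    obtain ⟨h1, h2, h3⟩ := hf H hH
    exact Finset.mem_coe.2 (Finset.mem_filter.2 ⟨mem_rootedHoles.2 h1, h3⟩)
  · intro H hH H' hH' h
    ext w
    rw [← (hf H hH).2.1, ← (hf H' hH').2.1, h]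

theorem ncard_four_holes_le : {H | IsHole G H ∧ H.ncard = 4}.ncard ≤ Fintype.card V ^ 4 := by
  obtain ⟨A, hA, hle⟩ := exists_finset_rootedHoles (G := G) (P := fun H => IsHole G H ∧ H.ncard = 4)
    (Q := fun l => l.length = 4) (by
      rintro H ⟨hH, hH4⟩
      obtain ⟨l, hl, hlH⟩ := hH.exists_list
      refine ⟨l, hl, hlH, ?_⟩
      have : H = (l.toFinset : Set V) := by
        ext w
        rw [Finset.mem_coe, List.mem_toFinset, hlH]
      rwa [this, Set.ncard_coe_finset, List.toFinset_card_of_nodup hl.2.1] at hH4)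
  refine hle.trans ?_
  have : Fintype.card (Fin 4 → V) = Fintype.card V ^ 4 := by simp
  rw [← this, ← Finset.card_univ]
  refine Finset.card_le_card_of_injOn (fun l i => l[i.val]!) (fun _ _ => by simp) ?_
  intro l hl l' hl' h
  have h1 := (hA l hl).2
  have h2 := (hA l' hl').2
  refine list_ext_getElem! (by omega) fun i hi => ?_
  exact congrFun h (⟨i, by omega⟩ : Fin 4)

/-- Apart from the holes of length four, the holes that meet an inner cluster of a segment are
bounded by the number of ways to return to the segment. -/
theorem IsSegment.ncard_holes_le (hS : IsSegment G S c) (hi : 4 ≤ i) (hic : i + 3 < c) {a₀ : V}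
    (ha₀ : a₀ ∈ S (i + 1)) :
    {H | IsHole G H ∧ H.ncard ≠ 4 ∧ ∃ v ∈ H, v ∈ S i}.ncard ≤
      27 * pathCount G (S (i - 2)) (Fintype.card V) a₀ (S (i - 1) ∪ S i ∪ S (i + 1))ᶜ := by
  set W := (S (i - 1) ∪ S i ∪ S (i + 1))ᶜ with hW
  set n := Fintype.card V
  have hdisj : ∀ a b, a ≠ b → a < c → b < c → ∀ v ∈ S a, v ∉ S b := by
    intro a b hab ha hb v hva hvb
    rcases lt_or_gt_of_ne hab with h | h
    · exact Finset.disjoint_left.1 (hS.disjoint a b h hb) hva hvb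
    · exact Finset.disjoint_left.1 (hS.disjoint b a h ha) hvb hva
  have hn : ∃ n', n = n' + 1 := ⟨n - 1, by have : 0 < n := Fintype.card_pos_iff.2 ⟨a₀⟩; omega⟩
  -- All vertices of the triple have the same neighbours in W, namely those in the next triple, so
  -- the count does not depend on the starting vertex.
  have hcount : ∀ a ∈ S (i + 1), pathCount G (S (i - 2)) n a W = pathCount G (S (i - 2)) n a₀ W := by
    obtain ⟨n', hn⟩ := hn
    have hadj : ∀ a ∈ S (i + 1), ∀ w ∈ W, (G.Adj a w ↔ w ∈ S (i + 2)) := by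
      intro a ha w hw
      simp only [hW, Finset.mem_compl, Finset.mem_union, not_or] at hw
      constructor
      · intro h
        have := hS.mem_of_adj (i + 1) (by omega) (by omega) a ha w h
        rw [Nat.add_sub_cancel] at this
        exact (this.resolve_left hw.1.2).resolve_left hw.2
      · intro h
        exact hS.adj (i + 1) (by omega) a ha w h
    intro a ha
    rw [hn, pathCount_succ_of_notMem (hdisj _ _ (by omega) (by omega) (by omega) a ha),
      pathCount_succ_of_notMem (hdisj _ _ (by omega) (by omega) (by omega) a₀ ha₀)]
    rw [Finset.filter_congr fun w hw => (hadj a ha w hw).trans (hadj a₀ ha₀ w hw).symm,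
      Finset.filter_congr (p := fun w => ¬ G.Adj a w) fun w hw => not_congr
        ((hadj a ha w hw).trans (hadj a₀ ha₀ w hw).symm)]
  obtain ⟨A, hA, hle⟩ := exists_finset_rootedHoles (G := G)
    (P := fun H => IsHole G H ∧ H.ncard ≠ 4 ∧ ∃ v ∈ H, v ∈ S i)
    (Q := fun l => 5 ≤ l.length ∧ l[0]! ∈ S (i - 1) ∧
      l[1]! ∈ S i ∧ l[2]! ∈ S (i + 1) ∧ l[l.length - 1]! ∈ S (i - 2))
    (fun H hH => hS.exists_list_getElem hH.1 hH.2.1 (by omega) (by omega) hH.2.2)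
  refine hle.trans ?_
  have hmaps : ∀ l ∈ A, (l[0]!, l[1]!, l[2]!) ∈ S (i - 1) ×ˢ S i ×ˢ S (i + 1) := by
    intro l hl
    obtain ⟨-, -, h0, h1, h2, -⟩ := hA l hl
    simp [-List.getElem!_eq_getElem?_getD, h0, h1, h2]
  rw [Finset.card_eq_sum_card_fiberwise hmaps]
  have hcard : (S (i - 1) ×ˢ S i ×ˢ S (i + 1)).card = 27 := by
    rw [Finset.card_product, Finset.card_product, hS.card_eq _ (by omega), hS.card_eq _ (by omega),
      hS.card_eq _ (by omega)]
  rw [← hcard, ← smul_eq_mul]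
  refine Finset.sum_le_card_nsmul _ _ _ ?_
  rintro ⟨b, v, a⟩ hp
  simp only [Finset.mem_product] at hp
  rw [← hcount a hp.2.2]
  have hmem : ∀ l ∈ A.filter (fun l => (l[0]!, l[1]!, l[2]!) = (b, v, a)), l ∈ A ∧ l[0]! = b ∧
      l[1]! = v ∧ l[2]! = a := by
    intro l hl
    obtain ⟨h1, h2⟩ := Finset.mem_filter.1 hl
    simp only [Prod.mk.injEq] at h2
    exact ⟨h1, h2⟩
  refine card_le_pathCount_of_isRootedHole b v a _ W _ (fun l hl => ?_) (fun l hl k hk hkl => ?_)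
    (fun l hl k hk hkl => ?_)
  · obtain ⟨h1, h2⟩ := hmem l hl
    exact ⟨(hA l h1).1, h2⟩
  · obtain ⟨hlr, h5, h0, h1, h2, hlast⟩ := hA l (hmem l hl).1
    simp only [hW, Finset.mem_compl, Finset.mem_union, not_or]
    refine ⟨⟨fun h => ?_, fun h => ?_⟩, fun h => ?_⟩
    · have := hS.eq_of_mem_mem hlr h5 (by omega) (by omega) (by omega) hkl h0 h
      omega
    · have := hS.eq_of_mem_mem hlr h5 (by omega) (by omega) (by omega) hkl h1 h
      omega
    · have := hS.eq_of_mem_mem hlr h5 (by omega) (by omega) (by omega) hkl h2 h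
      omega
  · obtain ⟨hlr, h5, h0, h1, h2, hlast⟩ := hA l (hmem l hl).1
    rw [Finset.mem_coe]
    constructor
    · intro h
      have := hS.eq_of_mem_mem hlr h5 (by omega) (by omega) (by omega) hkl hlast h
      omega
    · intro h
      rwa [show k = l.length - 1 by omega]

end StraightPassing

/-! ### From a segment to a cyclic braid -/

section BraidOfSegment

open scoped Classical

/-- Makes the holes of length four negligible even against `maxProd` of the vertices outside seven
triples. -/
theorem exists_pow_four_lt_maxProd : ∃ n₂ : ℕ, ∀ n, n₂ ≤ n → 100 * n ^ 4 < maxProd (n - 21) := by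
  have h := tendsto_pow_const_div_const_pow_of_one_lt 4 (show (1 : ℝ) < 3 by norm_num)
  have h1 : ∀ᶠ k : ℕ in Filter.atTop, (k : ℝ) ^ 4 / 3 ^ k < 1 / (100 * 30 ^ 4) :=
    h.eventually_lt_const (by norm_num)
  obtain ⟨N, hN⟩ := Filter.eventually_atTop.1 h1
  refine ⟨3 * (N + 1) + 26, fun n hn => ?_⟩
  obtain ⟨k, hk⟩ : ∃ k, k = (n - 23) / 3 := ⟨_, rfl⟩
  have h2 := hN k (by omega)
  rw [div_lt_div_iff₀ (by positivity) (by norm_num), one_mul] at h2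
  have h3 : k ^ 4 * (100 * 30 ^ 4) < 3 ^ k := by exact_mod_cast h2
  have h4 : 3 ^ k ≤ maxProd (n - 21) := by
    have h5 := maxProd_add_three_mul (n := 2) le_rfl k
    have h6 : maxProd (2 + 3 * k) ≤ maxProd (n - 21) := maxProd_mono (by omega)
    have h7 := maxProd_pos 2
    nlinarith [Nat.one_le_pow k 3 (by norm_num)]
  have h5 : n ^ 4 ≤ (30 * k) ^ 4 := Nat.pow_le_pow_left (by omega) 4
  rw [mul_pow] at h5
  linarith

theorem prod_map_card_eq {V : Type u} (C : List (Finset V)) :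
    (C.map Finset.card).prod = ∏ i ∈ Finset.range C.length, (C[i]!).card := by
  induction C with
  | nil => simp
  | cons Y C ih =>
    rw [List.length_cons, Finset.prod_range_succ', List.map_cons, List.prod_cons, ih, mul_comm]
    rfl

/-- The numbers `a, b < K` are cyclically consecutive modulo `K`. -/
def CycleAdj (K a b : ℕ) : Prop :=
  b = a + 1 ∨ a = b + 1 ∨ (a = 0 ∧ b + 1 = K) ∨ (b = 0 ∧ a + 1 = K)

/-- Vertices in different clusters, numbered by `f`, are adjacent if and only if the clusters are
cyclically consecutive. Nothing is assumed about adjacencies within a cluster. -/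
structure IsBraid {V : Type u} (G : SimpleGraph V) (K : ℕ) (f : V → ℕ) : Prop where
  lt : ∀ v, f v < K
  adj : ∀ u v, f u ≠ f v → (G.Adj u v ↔ CycleAdj K (f u) (f v))

variable {V : Type u} {G : SimpleGraph V} {S : ℕ → Finset V}

theorem ClusterChain.adj_iff {T : Set V} {x : V} {L : List (Finset V)} (hL : ClusterChain G T x L)
    (hne : ∀ Y ∈ L, Y.Nonempty) :
    (∀ i < L.length, ∀ y ∈ L[i]!, (G.Adj x y ↔ i = 0)) ∧
    (∀ i j, i < j → j < L.length → ∀ y ∈ L[i]!, ∀ z ∈ L[j]!, (G.Adj y z ↔ j = i + 1)) ∧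
    ∀ i < L.length, ∀ y ∈ L[i]!, (y ∈ T ↔ i + 1 = L.length) := by
  induction L generalizing x with
  | nil => simp
  | cons Y L ih =>
    obtain ⟨hx, hY, hnot⟩ := hL
    have hne' : ∀ Z ∈ L, Z.Nonempty := fun Z hZ => hne Z (List.mem_cons_of_mem _ hZ)
    obtain ⟨y₀, hy₀⟩ := hne Y List.mem_cons_self
    have ih₀ := ih (hY y₀ hy₀).2 hne'
    have hs : ∀ i, (Y :: L)[i + 1]! = L[i]! := fun i => rfl
    have h0 : (Y :: L)[0]! = Y := rfl
    refine ⟨fun i hi y hy => ?_, fun i j hij hj y hy z hz => ?_, fun i hi y hy => ?_⟩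
    · cases i with
      | zero => exact iff_of_true (hY y hy).1 rfl
      | succ i =>
        rw [List.length_cons] at hi
        exact iff_of_false (hnot _ (getElem!_mem' (by omega : i < L.length)) y hy) (by omega)
    · obtain ⟨j, rfl⟩ : ∃ k, j = k + 1 := ⟨j - 1, by omega⟩
      rw [List.length_cons] at hj
      cases i with
      | zero =>
        rw [(ih (hY y hy).2 hne').1 j (by omega) z hz]
        omega
      | succ i =>
        rw [ih₀.2.1 i j (by omega) (by omega) y hy z hz]
        omega
    · rw [List.length_cons] at hi ⊢
      cases i with
      | zero =>
        have hy' := (hY y hy).2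
        cases L with
        | nil => exact iff_of_true hy' rfl
        | cons Z L => exact iff_of_false hy'.1 (by simp)
      | succ i =>
        rw [ih₀.2.2 i (by omega) y hy]
        omega

theorem IsSegment.disjoint' {c a b : ℕ} (hS : IsSegment G S c) (hab : a ≠ b) (ha : a < c)
    (hb : b < c) : ∀ v ∈ S a, v ∉ S b := by
  intro v hva hvb
  rcases lt_or_gt_of_ne hab with h | h
  · exact Finset.disjoint_left.1 (hS.disjoint a b h hb) hva hvb
  · exact Finset.disjoint_left.1 (hS.disjoint b a h ha) hvb hva

variable [Fintype V]

/-- If a chain of clusters leads around from one end of a segment to the other, the graph is a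
braid. -/
theorem IsSegment.exists_isBraid {c i : ℕ} (hS : IsSegment G S c) (hi : 4 ≤ i) (hic : i + 3 < c)
    {a₀ : V} (ha₀ : a₀ ∈ S (i + 1)) {L : List (Finset V)} (hL : ClusterChain G (S (i - 2)) a₀ L)
    (hLW : ∀ w, w ∈ (S (i - 1) ∪ S i ∪ S (i + 1))ᶜ ↔ ∃ Y ∈ L, w ∈ Y)
    (hdisj : L.Pairwise Disjoint) (hcard : ∀ Y ∈ L, 2 ≤ Y.card ∧ Y.card ≤ 4) :
    ∃ (K : ℕ) (f : V → ℕ), IsBraid G K f ∧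
      (∀ j < K, 2 ≤ (Finset.univ.filter fun v => f v = j).card ∧
        (Finset.univ.filter fun v => f v = j).card ≤ 4) ∧
      ∏ j ∈ Finset.range K, (Finset.univ.filter fun v => f v = j).card =
        27 * (L.map Finset.card).prod := by
  obtain ⟨k, rfl⟩ : ∃ k, i = k + 2 := ⟨i - 2, by omega⟩
  simp only [Nat.add_sub_cancel, show k + 2 - 1 = k + 1 by omega, show k + 2 + 1 = k + 3 by omega] at *
  obtain ⟨hx, hchain, hlast⟩ := hL.adj_iff fun Y hY => Finset.card_pos.1 (by have := hcard Y hY; omega)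
  have hWmem : ∀ j < L.length, ∀ v ∈ L[j]!, v ∉ S (k + 1) ∧ v ∉ S (k + 2) ∧ v ∉ S (k + 3) := by
    intro j hj v hv
    have := (hLW v).2 ⟨_, getElem!_mem' hj, hv⟩
    simpa [not_or, and_assoc] using this
  have hLne : L.length ≠ 0 := by
    intro h
    rw [List.length_eq_zero_iff.1 h] at hL
    exact hS.disjoint' (show k + 3 ≠ k by omega) (by omega) (by omega) _ ha₀ hL
  -- The three middle triples precede the chain. The vertices of its last cluster are exactly those
  -- of the chain in S k, which closes the cycle.
  set C : List (Finset V) := S (k + 1) :: S (k + 2) :: S (k + 3) :: L with hC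
  have hC3 : ∀ j, C[j + 3]! = L[j]! := fun j => rfl
  have hClen : C.length = L.length + 3 := by simp [hC]
  have hCcase : ∀ j < C.length, j = 0 ∨ j = 1 ∨ j = 2 ∨ ∃ j' < L.length, j = j' + 3 := by
    intro j hj
    by_cases h3 : j < 3
    · omega
    · exact Or.inr (Or.inr (Or.inr ⟨j - 3, by omega, by omega⟩))
  have hLdisj : ∀ a b, a < b → b < L.length → ∀ v ∈ L[a]!, v ∉ L[b]! := by
    intro a b hab hb v hva hvb
    rw [List.pairwise_iff_getElem] at hdisj
    have := hdisj a b (by omega) hb hab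
    rw [← getElem!_pos L a (by omega), ← getElem!_pos L b hb] at this
    exact Finset.disjoint_left.1 this hva hvb
  have hCdisj : ∀ a b, a < b → b < C.length → ∀ v ∈ C[a]!, v ∉ C[b]! := by
    intro a b hab hb v hva hvb
    have d1 := hS.disjoint' (show k + 1 ≠ k + 2 by omega) (by omega) (by omega) v
    have d2 := hS.disjoint' (show k + 1 ≠ k + 3 by omega) (by omega) (by omega) v
    have d3 := hS.disjoint' (show k + 2 ≠ k + 3 by omega) (by omega) (by omega) v
    rcases hCcase a (by omega) with rfl | rfl | rfl | ⟨a, ha, rfl⟩ <;>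
    rcases hCcase b hb with rfl | rfl | rfl | ⟨b, hb', rfl⟩ <;> try omega
    · exact d1 hva hvb
    · exact d2 hva hvb
    · exact (hWmem b hb' v hvb).1 hva
    · exact d3 hva hvb
    · exact (hWmem b hb' v hvb).2.1 hva
    · exact (hWmem b hb' v hvb).2.2 hva
    · exact hLdisj a b (by omega) hb' v hva hvb
  have hCadj : ∀ a b, a < b → b < C.length → ∀ u ∈ C[a]!, ∀ v ∈ C[b]!,
      (G.Adj u v ↔ b = a + 1 ∨ (a = 0 ∧ b + 1 = C.length)) := by
    intro a b hab hb u hu v hv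
    have a0 := hS.adj k (by omega)
    have a1 := hS.adj (k + 1) (by omega)
    have a2 := hS.adj (k + 2) (by omega)
    have a3 := hS.adj (k + 3) (by omega)
    have n1 := hS.mem_of_adj (k + 1) (by omega) (by omega) u
    have n2 := hS.mem_of_adj (k + 2) (by omega) (by omega) u
    have n3 := hS.mem_of_adj (k + 3) (by omega) (by omega)
    simp only [Nat.add_sub_cancel, show k + 2 - 1 = k + 1 by omega, show k + 3 - 1 = k + 2 by omega,
      show k + 1 + 1 = k + 2 by omega, show k + 2 + 1 = k + 3 by omega] at a0 a1 a2 a3 n1 n2 n3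
    rcases hCcase a (by omega) with rfl | rfl | rfl | ⟨a, ha, rfl⟩ <;>
    rcases hCcase b hb with rfl | rfl | rfl | ⟨b, hb', rfl⟩ <;> try omega
    · exact iff_of_true (a1 u hu v hv) (by omega)
    · refine iff_of_false (fun h => ?_) (by omega)
      have hv3 : v ∈ S (k + 3) := hv
      rcases n1 hu v h with h | h | h
      · exact hS.disjoint' (by omega) (by omega) (by omega) v h hv3
      · exact hS.disjoint' (by omega) (by omega) (by omega) v h hv3
      · exact hS.disjoint' (by omega) (by omega) (by omega) v h hv3
    · obtain ⟨w1, w2, w3⟩ := hWmem b hb' v hv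
      have := hlast b hb' v hv
      rw [Finset.mem_coe] at this
      have hadj : G.Adj u v ↔ v ∈ S k := by
        refine ⟨fun h => ?_, fun h => (a0 v h u hu).symm⟩
        rcases n1 hu v h with h | h | h
        · exact h
        · exact absurd h w1
        · exact absurd h w2
      rw [hadj, this]
      omega
    · exact iff_of_true (a2 u hu v hv) (by omega)
    · obtain ⟨w1, w2, w3⟩ := hWmem b hb' v hv
      refine iff_of_false (fun h => ?_) (by omega)
      rcases n2 hu v h with h | h | h
      · exact w1 h
      · exact w2 h
      · exact w3 h
    · obtain ⟨w1, w2, w3⟩ := hWmem b hb' v hv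
      have hadj : ∀ x ∈ S (k + 3), (G.Adj x v ↔ v ∈ S (k + 3 + 1)) := by
        intro x hx
        refine ⟨fun h => ?_, fun h => a3 x hx v h⟩
        rcases n3 x hx v h with h | h | h
        · exact absurd h w2
        · exact absurd h w3
        · exact h
      have := hx b hb' v hv
      rw [hadj a₀ ha₀] at this
      rw [hadj u hu, this]
      omega
    · rw [hchain a b (by omega) hb' u hu v hv]
      omega
  have hex : ∀ v, ∃ j, j < C.length ∧ v ∈ C[j]! := by
    intro v
    by_cases hv : v ∈ (S (k + 1) ∪ S (k + 2) ∪ S (k + 3))ᶜ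
    · obtain ⟨Y, hY, hvY⟩ := (hLW v).1 hv
      obtain ⟨j, hj, rfl⟩ := exists_getElem!_eq hY
      exact ⟨j + 3, by omega, hvY⟩
    · simp only [Finset.mem_compl, not_not, Finset.mem_union] at hv
      rcases hv with (hv | hv) | hv
      · exact ⟨0, by omega, hv⟩
      · exact ⟨1, by omega, hv⟩
      · exact ⟨2, by omega, hv⟩
  choose f hf hfmem using hex
  have hfib : ∀ j < C.length, (Finset.univ.filter fun v => f v = j) = C[j]! := by
    intro j hj
    ext v
    simp only [Finset.mem_filter, Finset.mem_univ, true_and]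
    constructor
    · rintro rfl
      exact hfmem v
    · intro hv
      by_contra hne
      rcases lt_or_gt_of_ne hne with h | h
      · exact hCdisj _ _ h hj v (hfmem v) hv
      · exact hCdisj _ _ h (hf v) v hv (hfmem v)
  refine ⟨C.length, f, ⟨hf, fun u v huv => ?_⟩, fun j hj => ?_, ?_⟩
  · rcases lt_or_gt_of_ne huv with h | h
    · rw [hCadj _ _ h (hf v) u (hfmem u) v (hfmem v), CycleAdj]
      omega
    · rw [SimpleGraph.adj_comm, hCadj _ _ h (hf u) v (hfmem v) u (hfmem u), CycleAdj]
      omega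
  · rw [hfib j hj]
    rcases hCcase j hj with rfl | rfl | rfl | ⟨j, hj', rfl⟩
    · have := hS.card_eq (k + 1) (by omega)
      change 2 ≤ (S (k + 1)).card ∧ (S (k + 1)).card ≤ 4
      omega
    · have := hS.card_eq (k + 2) (by omega)
      change 2 ≤ (S (k + 2)).card ∧ (S (k + 2)).card ≤ 4
      omega
    · have := hS.card_eq (k + 3) (by omega)
      change 2 ≤ (S (k + 3)).card ∧ (S (k + 3)).card ≤ 4
      omega
    · exact hcard _ (getElem!_mem' hj')
  · rw [Finset.prod_congr rfl fun j hj => by rw [hfib j (Finset.mem_range.1 hj)], ← prod_map_card_eq, hC]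
    simp only [List.map_cons, List.prod_cons, hS.card_eq (k + 1) (by omega),
      hS.card_eq (k + 2) (by omega), hS.card_eq (k + 3) (by omega)]
    ring

/-- A graph with a segment of length eleven and many holes is a braid of optimal type. -/
theorem exists_isBraid_of_isSegment : ∃ n₂ : ℕ, ∀ (V : Type u) [Inhabited V] [Fintype V]
    (G : SimpleGraph V) (S : ℕ → Finset V), n₂ ≤ Fintype.card V → IsSegment G S 11 →
    maxProd (Fintype.card V) ≤ holeCount G →
    ∃ (K : ℕ) (f : V → ℕ), IsBraid G K f ∧
      (∀ j < K, 2 ≤ (Finset.univ.filter fun v => f v = j).card ∧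
        (Finset.univ.filter fun v => f v = j).card ≤ 4) ∧
      ∏ j ∈ Finset.range K, (Finset.univ.filter fun v => f v = j).card =
        maxProd (Fintype.card V) := by
  obtain ⟨n₂, hn₂⟩ := exists_pow_four_lt_maxProd
  refine ⟨n₂ + 30, fun V _ _ G S hn hS hM => ?_⟩
  obtain ⟨n, hnV⟩ : ∃ n, n = Fintype.card V := ⟨_, rfl⟩
  have hbig := hn₂ n (by omega)
  obtain ⟨a₀, ha₀⟩ : (S 6).Nonempty := Finset.card_pos.1 (by rw [hS.card_eq 6 (by omega)]; omega)
  have hWcard : ((S 4 ∪ S 5 ∪ S 6)ᶜ).card = n - 9 := by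
    rw [Finset.card_compl, Finset.card_union_of_disjoint, Finset.card_union_of_disjoint,
      hS.card_eq 4 (by omega), hS.card_eq 5 (by omega), hS.card_eq 6 (by omega), hnV]
    · exact hS.disjoint _ _ (by omega) (by omega)
    · rw [Finset.disjoint_union_left]
      exact ⟨hS.disjoint _ _ (by omega) (by omega), hS.disjoint _ _ (by omega) (by omega)⟩
  -- A hole of length at least five that meets one of S 2, …, S 8 also meets S 5. One that misses S
  -- 5 therefore avoids all these 21 vertices.
  set U := ((Finset.Ico 2 9).biUnion S)ᶜ with hU
  have hUcard : U.card = n - 21 := by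
    rw [hU, Finset.card_compl, Finset.card_biUnion, Finset.sum_congr rfl fun i hi =>
      hS.card_eq i (by rw [Finset.mem_Ico] at hi; omega), hnV]
    · simp
    · intro a ha b hb hab
      rw [Finset.mem_coe, Finset.mem_Ico] at ha hb
      rw [Function.onFun, Finset.disjoint_left]
      exact hS.disjoint' hab (by omega) (by omega)
  have h1 := ncard_four_holes_le (G := G)
  have h2 := ncard_holes_subset_le (G := G) U
  have h3 := hS.ncard_holes_le (i := 5) (by omega) (by omega) ha₀
  have hsplit : holeCount G ≤ {H | IsHole G H ∧ H.ncard = 4}.ncard +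
      {H | IsHole G H ∧ H ⊆ U}.ncard +
      {H | IsHole G H ∧ H.ncard ≠ 4 ∧ ∃ v ∈ H, v ∈ S 5}.ncard := by
    refine le_trans (Set.ncard_le_ncard ?_ (Set.toFinite _))
      ((Set.ncard_union_le _ _).trans (Nat.add_le_add_right (Set.ncard_union_le _ _) _))
    intro H hH
    by_cases h4 : H.ncard = 4
    · exact Or.inl (Or.inl ⟨hH, h4⟩)
    by_cases hm : ∃ v ∈ H, v ∈ S 5
    · exact Or.inr ⟨hH, h4, hm⟩
    · refine Or.inl (Or.inr ⟨hH, fun v hv => ?_⟩)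
      by_contra hvU
      rw [Finset.mem_coe, hU, Finset.mem_compl, not_not, Finset.mem_biUnion] at hvU
      obtain ⟨i, hi, hvi⟩ := hvU
      rw [Finset.mem_Ico] at hi
      obtain ⟨l, hl, hlH⟩ := IsHole.exists_list hH
      have h5 : 5 ≤ l.length := by
        have : H = (l.toFinset : Set V) := by
          ext w
          rw [Finset.mem_coe, List.mem_toFinset, hlH]
        rw [this, Set.ncard_coe_finset, List.toFinset_card_of_nodup hl.2.1] at h4
        have := hl.1
        omega
      obtain ⟨w, hw, hw5⟩ := hS.exists_mem_of_mem_of_le hl h5 hi.1 (by omega) ⟨v, (hlH v).2 hv, hvi⟩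
        (j := 5) (by omega) (by omega)
      exact hm ⟨w, (hlH w).1 hw, hw5⟩
  have m1 := maxProd_add_three_mul (n := n - 21) (by omega) 4
  have m2 := maxProd_add_three_mul (n := n - 21) (by omega) 7
  rw [show n - 21 + 3 * 4 = n - 9 by omega] at m1
  rw [show n - 21 + 3 * 7 = n by omega] at m2
  rcases pathCount_gap (G := G) (T := S 3) (Fintype.card V) a₀ (S 4 ∪ S 5 ∪ S 6)ᶜ
    (by rw [hWcard]; omega) with h | ⟨L, hL, hLW, hLd, hLc, hLp⟩
  -- In units of `maxProd (n - 21)`, at least 3^7 = 2187 holes are required. Those through S 5 would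
  -- be at most 27 · 81 · 31/32, a deficit of more than 68, while the others contribute fewer than
  -- 16.
  · exfalso
    rw [hWcard, m1] at h
    rw [hUcard] at h2
    rw [← hnV] at h1 hM
    rw [m2] at hM
    simp only [show 5 - 2 = 3 by omega, show 5 - 1 = 4 by omega, show 5 + 1 = 6 by omega] at h3
    omega
  · obtain ⟨K, f, h1, h2, h3⟩ := hS.exists_isBraid (i := 5) (by omega) (by omega) ha₀ hL hLW hLd hLc
    refine ⟨K, f, h1, h2, ?_⟩
    rw [h3, hLp, hWcard, m1, ← hnV, m2]
    ring

end BraidOfSegment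

/-! ### The holes of an empty cyclic braid -/

section EmptyBraids

open scoped Classical

/-- The graph on `V` in which two vertices are adjacent if and only if the clusters in which they lie
are cyclically consecutive. -/
structure IsEmptyBraid {V : Type u} (G : SimpleGraph V) (K : ℕ) (f : V → ℕ) : Prop where
  lt : ∀ v, f v < K
  adj : ∀ u v, G.Adj u v ↔ CycleAdj K (f u) (f v)

/-- The successor modulo `K`. -/
def cycleNext (K i : ℕ) : ℕ := if i + 1 = K then 0 else i + 1

/-- The predecessor modulo `K`. -/
def cyclePrev (K i : ℕ) : ℕ := if i = 0 then K - 1 else i - 1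

theorem cycleNext_spec {K i : ℕ} :
    (i + 1 = K ∧ cycleNext K i = 0) ∨ (i + 1 ≠ K ∧ cycleNext K i = i + 1) := by
  unfold cycleNext; split_ifs <;> omega

theorem cyclePrev_spec {K i : ℕ} :
    (i = 0 ∧ cyclePrev K i = K - 1) ∨ (i ≠ 0 ∧ cyclePrev K i = i - 1) := by
  unfold cyclePrev; split_ifs <;> omega

/-- The profile of the holes that consist of two vertices of cluster `i` and one vertex of each
adjacent cluster. -/
noncomputable def crossProfile (K i j : ℕ) : ℕ := if j = i then 2 else if CycleAdj K i j then 1 else 0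

/-- The profile of the holes that consist of two vertices of cluster `i` and two vertices of the next
cluster. -/
noncomputable def squareProfile (K i j : ℕ) : ℕ := if j = i ∨ j = cycleNext K i then 2 else 0

variable {V : Type u} {G : SimpleGraph V} {K : ℕ} {f : V → ℕ}

/-- The set `H` has `π j` vertices in each cluster `j < K`. -/
def HasProfile (K : ℕ) (f : V → ℕ) (π : ℕ → ℕ) (H : Finset V) : Prop :=
  ∀ j < K, (H.filter fun v => f v = j).card = π j

theorem card_hasProfile [Fintype V] (hf : ∀ v, f v < K) (π : ℕ → ℕ) :
    (Finset.univ.filter (HasProfile K f π)).card =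
      ∏ j ∈ Finset.range K, ((Finset.univ.filter fun v => f v = j).card).choose (π j) := by
  rw [Finset.prod_congr rfl fun j _ =>
    (Finset.card_powersetCard (π j) (Finset.univ.filter fun v => f v = j)).symm, ← Finset.card_pi]
  refine Finset.card_bij (fun H _ j _ => H.filter fun v => f v = j) ?_ ?_ ?_
  · intro H hH
    rw [Finset.mem_pi]
    intro j hj
    rw [Finset.mem_powersetCard]
    exact ⟨Finset.filter_subset_filter _ (Finset.subset_univ _),
      (Finset.mem_filter.1 hH).2 j (Finset.mem_range.1 hj)⟩
  · intro H _ H' _ h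
    ext v
    have := congrFun (congrFun h (f v)) (Finset.mem_range.2 (hf v))
    have := Finset.ext_iff.1 this v
    simpa using this
  · intro g hg
    rw [Finset.mem_pi] at hg
    have hfil : ∀ j (hj : j ∈ Finset.range K), ((Finset.univ.filter fun v =>
        v ∈ g (f v) (Finset.mem_range.2 (hf v))).filter fun v => f v = j) = g j hj := by
      intro j hj
      ext v
      simp only [Finset.mem_filter, Finset.mem_univ, true_and]
      constructor
      · rintro ⟨hv, rfl⟩
        exact hv
      · intro hv
        have := (Finset.mem_powersetCard.1 (hg j hj)).1 hv
        simp only [Finset.mem_filter, Finset.mem_univ, true_and] at this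
        subst this
        exact ⟨hv, rfl⟩
    refine ⟨Finset.univ.filter fun v => v ∈ g (f v) (Finset.mem_range.2 (hf v)),
      Finset.mem_filter.2 ⟨Finset.mem_univ _, fun j hj => ?_⟩, ?_⟩
    · rw [hfil j (Finset.mem_range.2 hj)]
      exact (Finset.mem_powersetCard.1 (hg j (Finset.mem_range.2 hj))).2
    · funext j hj
      exact hfil j hj

theorem card_filter_quad {u v x y : V} (huv : u ≠ v) (hux : u ≠ x) (huy : u ≠ y) (hvx : v ≠ x)
    (hvy : v ≠ y) (hxy : x ≠ y) (j : ℕ) : (({u, v, x, y} : Finset V).filter fun w => f w = j).card =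
    (if f u = j then 1 else 0) + ((if f v = j then 1 else 0) + ((if f x = j then 1 else 0) +
      (if f y = j then 1 else 0))) := by
  rw [Finset.card_filter, Finset.sum_insert, Finset.sum_insert, Finset.sum_insert,
    Finset.sum_singleton] <;> simp [*]

variable [Inhabited V]

namespace IsEmptyBraid

theorem isHole_quad (h : IsEmptyBraid G K f) (hK : 5 ≤ K) {u v x y : V} (huv : u ≠ v) (hxy : x ≠ y)
    (hf : f u = f v) (hx : CycleAdj K (f u) (f x)) (hy : CycleAdj K (f u) (f y)) :
    IsHole G (({u, v, x, y} : Finset V) : Set V) := by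
  have hlt := h.lt
  have h1 : ¬ CycleAdj K (f u) (f v) := by rw [CycleAdj]; have := hlt u; omega
  have h2 : ¬ CycleAdj K (f x) (f y) := by
    rw [CycleAdj] at *
    have := hlt u
    have := hlt x
    have := hlt y
    omega
  have hl : IsRootedHole G [u, x, v, y] := by
    have n1 : u ≠ x := by rintro rfl; rw [CycleAdj] at hx; have := hlt u; omega
    have n2 : u ≠ y := by rintro rfl; rw [CycleAdj] at hy; have := hlt u; omega
    have n3 : v ≠ x := by rintro rfl; exact h1 hx
    have n4 : v ≠ y := by rintro rfl; exact h1 hy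
    have a1 : G.Adj u x := (h.adj _ _).2 hx
    have a2 : G.Adj u y := (h.adj _ _).2 hy
    have a3 : G.Adj x v := ((h.adj v x).2 (hf ▸ hx)).symm
    have a4 : G.Adj v y := (h.adj v y).2 (hf ▸ hy)
    have b1 : ¬ G.Adj u v := fun ha => h1 ((h.adj _ _).1 ha)
    have b2 : ¬ G.Adj x y := fun ha => h2 ((h.adj _ _).1 ha)
    refine ⟨le_rfl, by simp [huv, hxy, n1, n2, n3.symm, n4], fun i j hij hj => ?_⟩
    simp only [List.length_cons, List.length_nil] at hj
    have hj' : j = 1 ∨ j = 2 ∨ j = 3 := by omega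
    rcases hj' with rfl | rfl | rfl
    · obtain rfl : i = 0 := by omega
      exact iff_of_true a1 (by omega)
    · obtain rfl | rfl : i = 0 ∨ i = 1 := by omega
      · exact iff_of_false b1 (by simp)
      · exact iff_of_true a3 (by simp)
    · obtain rfl | rfl | rfl : i = 0 ∨ i = 1 ∨ i = 2 := by omega
      · exact iff_of_true a2 (by simp)
      · exact iff_of_false b2 (by omega)
      · exact iff_of_true a4 (by omega)
  convert hl.isHole using 1
  ext w
  simp only [Finset.coe_insert, Finset.coe_singleton, Set.mem_insert_iff, Set.mem_singleton_iff,
    Set.mem_ofPred_eq, List.mem_cons, List.not_mem_nil, or_false]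
  tauto

/-- Vertices of one cluster have the same neighbours. Two of them on a hole must be opposite
vertices of a four-cycle. -/
theorem length_eq_four (h : IsEmptyBraid G K f) {l : List V} (hl : IsRootedHole G l) {a b : ℕ}
    (hab : a < b) (hb : b < l.length) (hf : f l[a]! = f l[b]!) : l.length = 4 ∧ b = a + 2 := by
  have h4 := hl.1
  have key : ∀ c < l.length, (G.Adj l[a]! l[c]! ↔ G.Adj l[b]! l[c]!) := fun c _ => by
    rw [h.adj, h.adj, hf]
  have k1 := key (a + 1) (by omega)
  rw [hl.adj_iff (by omega) (by omega), hl.adj_iff (by omega) (by omega)] at k1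
  rcases Nat.eq_zero_or_pos a with rfl | ha
  · have k2 := key (l.length - 1) (by omega)
    rw [hl.adj_iff (by omega) (by omega), hl.adj_iff (by omega) (by omega)] at k2
    omega
  · have k2 := key (a - 1) (by omega)
    rw [hl.adj_iff (by omega) (by omega), hl.adj_iff (by omega) (by omega)] at k2
    omega

/-- If two vertices share a cluster, the hole has length four and its other two vertices lie in
adjacent clusters, either the same or different ones. Otherwise the two neighbours of each vertex
lie in the next and the previous cluster, so the hole goes all the way around. -/
theorem hasProfile_of_isHole (h : IsEmptyBraid G K f) (hK : 5 ≤ K) {H : Finset V}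
    (hH : IsHole G (H : Set V)) : HasProfile K f (fun _ => 1) H ∨
      ∃ i < K, HasProfile K f (crossProfile K i) H ∨ HasProfile K f (squareProfile K i) H := by
  have hlt := h.lt
  by_cases hinj : ∃ u ∈ H, ∃ v ∈ H, u ≠ v ∧ f u = f v
  · right
    obtain ⟨u, hu, v, hv, huv, hfuv⟩ := hinj
    obtain ⟨l, hl, hlH, rfl⟩ := hH.exists_list_getElem (Finset.mem_coe.2 hu) (k := 0) (by norm_num)
    obtain ⟨b, hb, rfl⟩ := exists_getElem!_eq ((hlH v).2 (Finset.mem_coe.2 hv))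
    have hb0 : 0 < b := Nat.pos_of_ne_zero fun h0 => huv (by rw [h0])
    obtain ⟨hlen, rfl⟩ := h.length_eq_four hl hb0 hb hfuv
    have hne : ∀ a b, a < 4 → b < 4 → a ≠ b → l[a]! ≠ l[b]! := fun a b ha hb hab he =>
      hab (hl.inj (by omega) (by omega) he)
    have hHeq : H = {l[0]!, l[2]!, l[1]!, l[3]!} := by
      ext w
      rw [← Finset.mem_coe, ← hlH]
      simp only [Finset.mem_insert, Finset.mem_singleton]
      constructor
      · intro hw
        obtain ⟨k, hk, rfl⟩ := exists_getElem!_eq hw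
        have hk4 : k = 0 ∨ k = 1 ∨ k = 2 ∨ k = 3 := by omega
        rcases hk4 with rfl | rfl | rfl | rfl <;> simp
      · rintro (rfl | rfl | rfl | rfl) <;> exact getElem!_mem' (by omega)
    have hcard : ∀ j, (H.filter fun w => f w = j).card = (if f l[0]! = j then 1 else 0) +
        ((if f l[2]! = j then 1 else 0) + ((if f l[1]! = j then 1 else 0) +
        (if f l[3]! = j then 1 else 0))) := fun j => by
      rw [hHeq]
      exact card_filter_quad (f := f) (hne 0 2 (by omega) (by omega) (by omega))
        (hne 0 1 (by omega) (by omega) (by omega)) (hne 0 3 (by omega) (by omega) (by omega))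
        (hne 2 1 (by omega) (by omega) (by omega)) (hne 2 3 (by omega) (by omega) (by omega))
        (hne 1 3 (by omega) (by omega) (by omega)) j
    have a1 : CycleAdj K (f l[0]!) (f l[1]!) := (h.adj _ _).1 (hl.adj_succ (by omega))
    have a3 : CycleAdj K (f l[0]!) (f l[3]!) :=
      (h.adj _ _).1 ((hl.adj_iff (by omega) (by omega)).2 (by omega))
    have l0 := hlt l[0]!
    have l1 := hlt l[1]!
    have l3 := hlt l[3]!
    simp only [Nat.zero_add] at hfuv
    rw [← hfuv] at hcard
    rw [CycleAdj] at a1 a3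
    by_cases h13 : f l[1]! = f l[3]!
    · rcases cycleNext_spec (K := K) (i := f l[0]!) with hn | hn <;>
      rcases cycleNext_spec (K := K) (i := f l[1]!) with hn' | hn'
      all_goals
        by_cases hnext : f l[1]! = cycleNext K (f l[0]!)
        · refine ⟨_, l0, Or.inr fun j hj => ?_⟩
          rw [hcard, squareProfile]
          split_ifs <;> omega
        · refine ⟨_, l1, Or.inr fun j hj => ?_⟩
          rw [hcard, squareProfile]
          split_ifs <;> omega
    · refine ⟨_, l0, Or.inl fun j hj => ?_⟩
      rw [hcard, crossProfile, CycleAdj]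
      split_ifs <;> omega
  · left
    push Not at hinj
    have hstep : ∀ v ∈ H, ∃ w ∈ H, f w = cycleNext K (f v) := by
      intro v hv
      obtain ⟨l, hl, hlH, rfl⟩ := hH.exists_list_getElem (Finset.mem_coe.2 hv) (k := 1) (by norm_num)
      have h4 := hl.1
      have a1 : CycleAdj K (f l[1]!) (f l[2]!) := (h.adj _ _).1 (hl.adj_succ (by omega))
      have a2 : CycleAdj K (f l[1]!) (f l[0]!) := (h.adj _ _).1 (hl.adj_succ (by omega)).symm
      have m0 : l[0]! ∈ H := (hlH _).1 (getElem!_mem' (by omega))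
      have m2 : l[2]! ∈ H := (hlH _).1 (getElem!_mem' (by omega))
      have hne := hinj _ m0 _ m2 fun he => by
        have := hl.inj (by omega) (by omega) he
        omega
      have l0 := hlt l[0]!
      have l1 := hlt l[1]!
      have l2 := hlt l[2]!
      rw [CycleAdj] at a1 a2
      by_cases hnext : f l[2]! = cycleNext K (f l[1]!)
      · exact ⟨_, m2, hnext⟩
      · refine ⟨_, m0, ?_⟩
        rcases cycleNext_spec (K := K) (i := f l[1]!) with hn | hn <;> omega
    obtain ⟨v₀, hv₀⟩ : H.Nonempty := by
      obtain ⟨l, hl, hlH⟩ := hH.exists_list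
      exact ⟨l[0]!, (hlH _).1 (getElem!_mem' (by have := hl.1; omega))⟩
    have hall : ∀ d, ∃ w ∈ H, f w = (f v₀ + d) % K := by
      intro d
      induction d with
      | zero => exact ⟨v₀, hv₀, by rw [add_zero, Nat.mod_eq_of_lt (hlt _)]⟩
      | succ d ih =>
        obtain ⟨w, hw, hwd⟩ := ih
        obtain ⟨w', hw', hwd'⟩ := hstep w hw
        refine ⟨w', hw', ?_⟩
        rw [hwd', hwd, ← add_assoc, ← Nat.mod_add_mod (f v₀ + d) K 1]
        have := Nat.mod_lt (f v₀ + d) (show 0 < K by omega)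
        rcases cycleNext_spec (K := K) (i := (f v₀ + d) % K) with hn | hn
        · rw [hn.2, hn.1, Nat.mod_self]
        · rw [hn.2]
          exact (Nat.mod_eq_of_lt (by omega)).symm
    intro j hj
    obtain ⟨w, hw, hwj⟩ := hall (j + K - f v₀)
    have hl0 := hlt v₀
    rw [show f v₀ + (j + K - f v₀) = j + K by omega, Nat.add_mod_right, Nat.mod_eq_of_lt hj] at hwj
    rw [Finset.card_eq_one]
    refine ⟨w, Finset.ext fun x => ?_⟩
    rw [Finset.mem_filter, Finset.mem_singleton]
    constructor
    · rintro ⟨hx, hxj⟩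
      by_contra hne
      exact hinj x hx w hw hne (hxj.trans hwj.symm)
    · rintro rfl
      exact ⟨hw, hwj⟩

theorem isHole_of_hasProfile_one (h : IsEmptyBraid G K f) (hK : 5 ≤ K) {H : Finset V}
    (hH : HasProfile K f (fun _ => 1) H) : IsHole G (H : Set V) := by
  have hex : ∀ j, ∃ w, j < K → (H.filter fun v => f v = j) = {w} := by
    intro j
    by_cases hj : j < K
    · obtain ⟨w, hw⟩ := Finset.card_eq_one.1 (hH j hj)
      exact ⟨w, fun _ => hw⟩
    · exact ⟨default, fun h => absurd h hj⟩
  choose g hg using hex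
  have hgH : ∀ j < K, g j ∈ H ∧ f (g j) = j := by
    intro j hj
    have := Finset.mem_singleton_self (g j)
    rw [← hg j hj, Finset.mem_filter] at this
    exact this
  have hget : ∀ j < K, ((List.range K).map g)[j]! = g j := by
    intro j hj
    rw [getElem!_pos _ _ (by simpa using hj)]
    simp
  have hl : IsRootedHole G ((List.range K).map g) := by
    refine ⟨by rw [List.length_map, List.length_range]; omega, ?_, fun i j hij hj => ?_⟩
    · refine List.Nodup.map_on (fun x hx y hy hxy => ?_) List.nodup_range
      rw [List.mem_range] at hx hy
      rw [← (hgH x hx).2, ← (hgH y hy).2, hxy]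
    · rw [List.length_map, List.length_range] at hj ⊢
      rw [hget i (by omega), hget j hj, h.adj, (hgH i (by omega)).2, (hgH j hj).2, CycleAdj]
      omega
  convert hl.isHole using 1
  ext w
  simp only [Finset.mem_coe, Set.mem_ofPred_eq, List.mem_map, List.mem_range]
  constructor
  · intro hw
    have : w ∈ H.filter fun v => f v = f w := Finset.mem_filter.2 ⟨hw, rfl⟩
    rw [hg _ (h.lt w), Finset.mem_singleton] at this
    exact ⟨f w, h.lt w, this.symm⟩
  · rintro ⟨j, hj, rfl⟩
    exact (hgH j hj).1

theorem isHole_of_hasProfile_cross (h : IsEmptyBraid G K f) (hK : 5 ≤ K) {H : Finset V} {i : ℕ}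
    (hi : i < K) (hH : HasProfile K f (crossProfile K i) H) : IsHole G (H : Set V) := by
  have hn := cycleNext_spec (K := K) (i := i)
  have hp := cyclePrev_spec (K := K) (i := i)
  have h2 : (H.filter fun v => f v = i).card = 2 := by rw [hH i hi]; simp [crossProfile]
  have hx : (H.filter fun v => f v = cycleNext K i).card = 1 := by
    rw [hH _ (by omega), crossProfile, CycleAdj]
    split_ifs <;> omega
  have hy : (H.filter fun v => f v = cyclePrev K i).card = 1 := by
    rw [hH _ (by omega), crossProfile, CycleAdj]
    split_ifs <;> omega
  obtain ⟨u, v, huv, huv'⟩ := Finset.card_eq_two.1 h2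
  obtain ⟨x, hx⟩ := Finset.card_eq_one.1 hx
  obtain ⟨y, hy⟩ := Finset.card_eq_one.1 hy
  have hu := Finset.mem_filter.1 (huv'.symm ▸ Finset.mem_insert_self u {v})
  have hv := Finset.mem_filter.1 (huv'.symm ▸ Finset.mem_insert_of_mem (Finset.mem_singleton_self v))
  have hx' := Finset.mem_filter.1 (hx.symm ▸ Finset.mem_singleton_self x)
  have hy' := Finset.mem_filter.1 (hy.symm ▸ Finset.mem_singleton_self y)
  have hHeq : H = {u, v, x, y} := by
    ext w
    simp only [Finset.mem_insert, Finset.mem_singleton]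
    constructor
    · intro hw
      have hpos : 0 < (H.filter fun v => f v = f w).card :=
        Finset.card_pos.2 ⟨w, Finset.mem_filter.2 ⟨hw, rfl⟩⟩
      rw [hH _ (h.lt w), crossProfile, CycleAdj] at hpos
      have hw3 : f w = i ∨ f w = cycleNext K i ∨ f w = cyclePrev K i := by
        have := h.lt w
        split_ifs at hpos <;> omega
      rcases hw3 with hw' | hw' | hw'
      · have : w ∈ H.filter fun v => f v = i := Finset.mem_filter.2 ⟨hw, hw'⟩
        rw [huv'] at this
        simp only [Finset.mem_insert, Finset.mem_singleton] at this
        tauto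
      · have : w ∈ H.filter fun v => f v = cycleNext K i := Finset.mem_filter.2 ⟨hw, hw'⟩
        rw [hx, Finset.mem_singleton] at this
        tauto
      · have : w ∈ H.filter fun v => f v = cyclePrev K i := Finset.mem_filter.2 ⟨hw, hw'⟩
        rw [hy, Finset.mem_singleton] at this
        tauto
    · rintro (rfl | rfl | rfl | rfl)
      exacts [hu.1, hv.1, hx'.1, hy'.1]
  rw [hHeq]
  refine h.isHole_quad hK huv ?_ (hu.2.trans hv.2.symm) ?_ ?_
  · rintro rfl
    have := hx'.2.symm.trans hy'.2
    omega
  · rw [hu.2, hx'.2, CycleAdj]; omega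
  · rw [hu.2, hy'.2, CycleAdj]; omega

theorem isHole_of_hasProfile_square (h : IsEmptyBraid G K f) (hK : 5 ≤ K) {H : Finset V} {i : ℕ}
    (hi : i < K) (hH : HasProfile K f (squareProfile K i) H) : IsHole G (H : Set V) := by
  have hn := cycleNext_spec (K := K) (i := i)
  have h2 : (H.filter fun v => f v = i).card = 2 := by rw [hH i hi]; simp [squareProfile]
  have h2' : (H.filter fun v => f v = cycleNext K i).card = 2 := by
    rw [hH _ (by omega)]; simp [squareProfile]
  obtain ⟨u, v, huv, huv'⟩ := Finset.card_eq_two.1 h2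
  obtain ⟨x, y, hxy, hxy'⟩ := Finset.card_eq_two.1 h2'
  have hu := Finset.mem_filter.1 (huv'.symm ▸ Finset.mem_insert_self u {v})
  have hv := Finset.mem_filter.1 (huv'.symm ▸ Finset.mem_insert_of_mem (Finset.mem_singleton_self v))
  have hx := Finset.mem_filter.1 (hxy'.symm ▸ Finset.mem_insert_self x {y})
  have hy := Finset.mem_filter.1 (hxy'.symm ▸ Finset.mem_insert_of_mem (Finset.mem_singleton_self y))
  have hHeq : H = {u, v, x, y} := by
    ext w
    simp only [Finset.mem_insert, Finset.mem_singleton]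
    constructor
    · intro hw
      have hpos : 0 < (H.filter fun v => f v = f w).card :=
        Finset.card_pos.2 ⟨w, Finset.mem_filter.2 ⟨hw, rfl⟩⟩
      rw [hH _ (h.lt w), squareProfile] at hpos
      have hw3 : f w = i ∨ f w = cycleNext K i := by
        split_ifs at hpos <;> omega
      rcases hw3 with hw' | hw'
      · have : w ∈ H.filter fun v => f v = i := Finset.mem_filter.2 ⟨hw, hw'⟩
        rw [huv'] at this
        simp only [Finset.mem_insert, Finset.mem_singleton] at this
        tauto
      · have : w ∈ H.filter fun v => f v = cycleNext K i := Finset.mem_filter.2 ⟨hw, hw'⟩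
        rw [hxy'] at this
        simp only [Finset.mem_insert, Finset.mem_singleton] at this
        tauto
    · rintro (rfl | rfl | rfl | rfl)
      exacts [hu.1, hv.1, hx.1, hy.1]
  rw [hHeq]
  refine h.isHole_quad hK huv hxy (hu.2.trans hv.2.symm) ?_ ?_
  · rw [hu.2, hx.2, CycleAdj]; omega
  · rw [hu.2, hy.2, CycleAdj]; omega

theorem isHole_iff (h : IsEmptyBraid G K f) (hK : 5 ≤ K) (H : Finset V) :
    IsHole G (H : Set V) ↔ HasProfile K f (fun _ => 1) H ∨
      ∃ i < K, HasProfile K f (crossProfile K i) H ∨ HasProfile K f (squareProfile K i) H := by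
  refine ⟨h.hasProfile_of_isHole hK, ?_⟩
  rintro (h1 | ⟨i, hi, h1 | h1⟩)
  exacts [h.isHole_of_hasProfile_one hK h1, h.isHole_of_hasProfile_cross hK hi h1,
    h.isHole_of_hasProfile_square hK hi h1]

end IsEmptyBraid

end EmptyBraids

/-! ### The number of holes of an empty cyclic braid -/

section CountingBraidHoles

open scoped Classical

variable {V : Type u} [Fintype V] {G G' : SimpleGraph V} {K : ℕ} {f : V → ℕ}

/-- The number of vertices in cluster `j`. -/
noncomputable def clusterCard (f : V → ℕ) (j : ℕ) : ℕ := (Finset.univ.filter fun v => f v = j).card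

theorem prod_choose_crossProfile (hK : 5 ≤ K) {i : ℕ} (hi : i < K) (s : ℕ → ℕ) :
    ∏ j ∈ Finset.range K, (s j).choose (crossProfile K i j) =
      (s i).choose 2 * (s (cyclePrev K i) * s (cycleNext K i)) := by
  have hn := cycleNext_spec (K := K) (i := i)
  have hp := cyclePrev_spec (K := K) (i := i)
  have h1 : crossProfile K i i = 2 := by simp [crossProfile]
  have h2 : crossProfile K i (cycleNext K i) = 1 := by
    rw [crossProfile, CycleAdj]; split_ifs <;> omega
  have h3 : crossProfile K i (cyclePrev K i) = 1 := by
    rw [crossProfile, CycleAdj]; split_ifs <;> omega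
  have hsub : ({i, cyclePrev K i, cycleNext K i} : Finset ℕ) ⊆ Finset.range K := by
    intro j hj
    simp only [Finset.mem_insert, Finset.mem_singleton] at hj
    rw [Finset.mem_range]
    omega
  rw [← Finset.prod_subset hsub, Finset.prod_insert, Finset.prod_insert, Finset.prod_singleton, h1, h2,
    h3, Nat.choose_one_right, Nat.choose_one_right]
  · rw [Finset.mem_singleton]; omega
  · rw [Finset.mem_insert, Finset.mem_singleton]; omega
  · intro j hj hj'
    simp only [Finset.mem_insert, Finset.mem_singleton, not_or] at hj'
    rw [Finset.mem_range] at hj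
    have : crossProfile K i j = 0 := by
      rw [crossProfile, CycleAdj]; split_ifs <;> omega
    rw [this, Nat.choose_zero_right]

theorem prod_choose_squareProfile (hK : 5 ≤ K) {i : ℕ} (hi : i < K) (s : ℕ → ℕ) :
    ∏ j ∈ Finset.range K, (s j).choose (squareProfile K i j) =
      (s i).choose 2 * (s (cycleNext K i)).choose 2 := by
  have hn := cycleNext_spec (K := K) (i := i)
  have h1 : squareProfile K i i = 2 := by simp [squareProfile]
  have h2 : squareProfile K i (cycleNext K i) = 2 := by simp [squareProfile]
  have hsub : ({i, cycleNext K i} : Finset ℕ) ⊆ Finset.range K := by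
    intro j hj
    simp only [Finset.mem_insert, Finset.mem_singleton] at hj
    rw [Finset.mem_range]
    omega
  rw [← Finset.prod_subset hsub, Finset.prod_insert, Finset.prod_singleton, h1, h2]
  · rw [Finset.mem_singleton]; omega
  · intro j hj hj'
    simp only [Finset.mem_insert, Finset.mem_singleton] at hj'
    have : squareProfile K i j = 0 := by rw [squareProfile, if_neg hj']
    rw [this, Nat.choose_zero_right]

theorem disjoint_filter_hasProfile {π π' : ℕ → ℕ} {j : ℕ} (hj : j < K) (h : π j ≠ π' j) :
    Disjoint (Finset.univ.filter (HasProfile K f π)) (Finset.univ.filter (HasProfile K f π')) := by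
  rw [Finset.disjoint_filter]
  intro H _ h1 h2
  exact h ((h1 j hj).symm.trans (h2 j hj))

theorem holeCount_eq_card : holeCount G =
    (Finset.univ.filter fun H : Finset V => IsHole G (H : Set V)).card := by
  rw [holeCount, ← Set.ncard_coe_finset]
  refine Set.ncard_congr (fun S _ => S.toFinset) ?_ ?_ ?_
  · intro S hS
    simpa using hS
  · intro S S' _ _ h
    exact Set.toFinset_inj.1 h
  · intro H hH
    refine ⟨H, ?_, by simp⟩
    simpa using hH

/-- The number of holes of an empty cyclic braid. -/
theorem IsEmptyBraid.holeCount_eq [Inhabited V] (h : IsEmptyBraid G K f) (hK : 5 ≤ K) :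
    holeCount G = ∏ i ∈ Finset.range K, clusterCard f i + ∑ i ∈ Finset.range K,
      ((clusterCard f i).choose 2 * (clusterCard f (cyclePrev K i) * clusterCard f (cycleNext K i)) +
        (clusterCard f i).choose 2 * (clusterCard f (cycleNext K i)).choose 2) := by
  have hunion : (Finset.univ.filter fun H : Finset V => IsHole G (H : Set V)) =
      Finset.univ.filter (HasProfile K f fun _ => 1) ∪ (Finset.range K).biUnion fun i =>
        Finset.univ.filter (HasProfile K f (crossProfile K i)) ∪
          Finset.univ.filter (HasProfile K f (squareProfile K i)) := by
    ext H
    simp only [Finset.mem_filter, Finset.mem_univ, true_and, Finset.mem_union, Finset.mem_biUnion,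
      Finset.mem_range]
    rw [h.isHole_iff hK]
  have c1 : ∀ i, crossProfile K i i = 2 := fun i => by simp [crossProfile]
  have s1 : ∀ i, squareProfile K i i = 2 := fun i => by simp [squareProfile]
  have s2 : ∀ i, squareProfile K i (cycleNext K i) = 2 := fun i => by simp [squareProfile]
  have c2 : ∀ i j, i ≠ j → crossProfile K i j ≠ 2 := fun i j hij => by
    rw [crossProfile]; split_ifs <;> omega
  have s3 : ∀ i j, i ≠ j → cycleNext K i ≠ j → squareProfile K i j ≠ 2 := fun i j hij hij' => by
    rw [squareProfile]; split_ifs <;> omega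
  have hcs : ∀ i j, i < K → j < K → Disjoint (Finset.univ.filter (HasProfile K f (crossProfile K i)))
      (Finset.univ.filter (HasProfile K f (squareProfile K j))) := by
    intro i j hi hj
    have hn := cycleNext_spec (K := K) (i := j)
    by_cases hij : i = j
    · refine disjoint_filter_hasProfile (j := cycleNext K j) (by omega) ?_
      rw [s2]
      exact c2 _ _ (by omega)
    · refine disjoint_filter_hasProfile hj ?_
      rw [s1]
      exact c2 _ _ hij
  rw [holeCount_eq_card, hunion, Finset.card_union_of_disjoint, Finset.card_biUnion,
    card_hasProfile h.lt]
  · congr 1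
    · exact Finset.prod_congr rfl fun j _ => Nat.choose_one_right _
    · refine Finset.sum_congr rfl fun i hi => ?_
      rw [Finset.mem_range] at hi
      rw [Finset.card_union_of_disjoint (hcs i i hi hi), card_hasProfile h.lt, card_hasProfile h.lt]
      congr 1
      · exact prod_choose_crossProfile hK hi (clusterCard f)
      · exact prod_choose_squareProfile hK hi (clusterCard f)
  · intro i hi j hj hij
    rw [Finset.mem_coe, Finset.mem_range] at hi hj
    rw [Function.onFun, Finset.disjoint_union_left, Finset.disjoint_union_right,
      Finset.disjoint_union_right]
    refine ⟨⟨?_, hcs i j hi hj⟩, (hcs j i hj hi).symm, ?_⟩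
    · refine disjoint_filter_hasProfile hi ?_
      rw [c1]
      exact (c2 _ _ hij.symm).symm
    · have hn := cycleNext_spec (K := K) (i := i)
      have hn' := cycleNext_spec (K := K) (i := j)
      by_cases hji : cycleNext K j = i
      · refine disjoint_filter_hasProfile (j := cycleNext K i) (by omega) ?_
        rw [s2]
        exact (s3 _ _ (by omega) (by omega)).symm
      · refine disjoint_filter_hasProfile hi ?_
        rw [s1]
        exact (s3 _ _ hij.symm hji).symm
  · rw [Finset.disjoint_biUnion_right]
    intro i hi
    rw [Finset.mem_range] at hi
    rw [Finset.disjoint_union_right]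
    refine ⟨disjoint_filter_hasProfile hi ?_, disjoint_filter_hasProfile hi ?_⟩
    · rw [c1]; omega
    · rw [s1]; omega

end CountingBraidHoles

/-! ### Edges within the clusters of a braid -/

section InnerEdges

open scoped Classical

variable {V : Type u} {G G' : SimpleGraph V} {K : ℕ} {f : V → ℕ}

theorem IsBraid.exists_isEmptyBraid (h : IsBraid G K f) (hK : 2 ≤ K) :
    ∃ G' : SimpleGraph V, IsEmptyBraid G' K f := by
  refine ⟨SimpleGraph.fromRel fun u v => CycleAdj K (f u) (f v), h.lt, fun u v => ?_⟩
  rw [SimpleGraph.fromRel_adj]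
  have := h.lt u
  constructor
  · rintro ⟨-, h | h⟩
    · exact h
    · rw [CycleAdj] at *
      omega
  · intro h
    refine ⟨?_, Or.inl h⟩
    rintro rfl
    rw [CycleAdj] at h
    omega

theorem not_cycleAdj_self (hK : 2 ≤ K) (a : ℕ) : ¬ CycleAdj K a a := by
  rw [CycleAdj]; omega

theorem IsBraid.isEmptyBraid (h : IsBraid G K f) (hK : 2 ≤ K)
    (hne : ∀ u v, f u = f v → ¬ G.Adj u v) : IsEmptyBraid G K f := by
  refine ⟨h.lt, fun u v => ?_⟩
  by_cases huv : f u = f v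
  · exact iff_of_false (hne u v huv) (huv ▸ not_cycleAdj_self hK _)
  · exact h.adj u v huv

theorem IsBraid.isHole_iff_of_forall (h : IsBraid G K f) (h' : IsEmptyBraid G' K f) (hK : 2 ≤ K)
    {H : Set V} (hH : ∀ u ∈ H, ∀ v ∈ H, f u = f v → ¬ G.Adj u v) : IsHole G H ↔ IsHole G' H := by
  have : G.induce H = G'.induce H := by
    ext ⟨u, hu⟩ ⟨v, hv⟩
    simp only [SimpleGraph.comap_adj, Function.Embedding.subtype_apply]
    rw [h'.adj]
    by_cases huv : f u = f v
    · exact iff_of_false (hH u hu v hv huv) (huv ▸ not_cycleAdj_self hK _)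
    · exact h.adj u v huv
  rw [IsHole, IsHole, this]

variable [Inhabited V]

/-- A hole of a braid that contains an edge within a cluster lies in this cluster. -/
theorem IsBraid.eq_of_isHole (h : IsBraid G K f) {H : Set V} (hH : IsHole G H) {u v : V}
    (hu : u ∈ H) (hv : v ∈ H) (hf : f u = f v) (huv : G.Adj u v) : ∀ w ∈ H, f w = f u := by
  obtain ⟨l, hl, hlH, h0, h1⟩ : ∃ l, IsRootedHole G l ∧ (∀ w, w ∈ l ↔ w ∈ H) ∧ f l[0]! = f u ∧
      f l[1]! = f u := by
    obtain ⟨l, hl, hlH, rfl⟩ := hH.exists_list_getElem hu (k := 0) (by norm_num)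
    obtain ⟨b, hb, rfl⟩ := exists_getElem!_eq ((hlH v).2 hv)
    have h4 := hl.1
    rw [hl.adj_iff (by omega) hb] at huv
    obtain rfl | hb' : b = 1 ∨ b + 1 = l.length := by omega
    · exact ⟨l, hl, hlH, rfl, hf.symm⟩
    · refine ⟨l.rotate b, hl.rotate b, fun w => by rw [List.mem_rotate, hlH], ?_, ?_⟩
      · rw [getElem!_rotate_of_lt (by omega), zero_add, hf]
      · rw [getElem!_rotate _ (by omega), add_comm, hb', Nat.mod_self]
  have key : ∀ j, j + 1 < l.length → f l[j]! = f u ∧ f l[j + 1]! = f u := by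
    intro j
    induction j with
    | zero => exact fun _ => ⟨h0, h1⟩
    | succ j ih =>
      intro hj
      obtain ⟨i1, i2⟩ := ih (by omega)
      refine ⟨i2, by_contra fun hne => ?_⟩
      have ha : G.Adj l[j + 1]! l[j + 1 + 1]! := hl.adj_succ hj
      rw [h.adj _ _ (by rw [i2]; exact fun h => hne h.symm), i2, ← i1,
        ← h.adj _ _ (by rw [i1]; exact fun h => hne h.symm), hl.adj_iff (by omega) hj] at ha
      have := hl.1
      omega
  intro w hw
  obtain ⟨k, hk, rfl⟩ := exists_getElem!_eq ((hlH w).2 hw)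
  by_cases hk1 : k + 1 < l.length
  · exact (key k hk1).1
  · have := (key (k - 1) (by have := hl.1; omega)).2
    rwa [Nat.sub_add_cancel (by have := hl.1; omega)] at this

variable [Fintype V]

/-- A hole with an edge inside a cluster lies in that cluster, so it needs at least four vertices
and is the whole cluster. -/
theorem IsBraid.isHole_or_eq (h : IsBraid G K f) (h' : IsEmptyBraid G' K f) (hK : 2 ≤ K)
    (h4 : ∀ j < K, clusterCard f j ≤ 4) {H : Set V} (hH : IsHole G H) :
    IsHole G' H ∨ ∃ j < K, clusterCard f j = 4 ∧ H = (Finset.univ.filter fun v => f v = j) := by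
  by_cases hex : ∀ u ∈ H, ∀ v ∈ H, f u = f v → ¬ G.Adj u v
  · exact Or.inl ((h.isHole_iff_of_forall h' hK hex).1 hH)
  · right
    push Not at hex
    obtain ⟨u, hu, v, hv, hf, huv⟩ := hex
    have hsub := h.eq_of_isHole hH hu hv hf huv
    obtain ⟨l, hl, hlH⟩ := hH.exists_list
    have hHl : H = (l.toFinset : Set V) := by
      ext w
      rw [Finset.mem_coe, List.mem_toFinset, hlH]
    have hss : l.toFinset ⊆ Finset.univ.filter fun v => f v = f u := by
      intro w hw
      rw [List.mem_toFinset, hlH] at hw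
      exact Finset.mem_filter.2 ⟨Finset.mem_univ _, hsub w hw⟩
    have hc := List.toFinset_card_of_nodup hl.2.1
    have h4l := hl.1
    have hle := h4 _ (h.lt u)
    rw [clusterCard] at hle
    have heq := Finset.eq_of_subset_of_card_le hss (by omega)
    refine ⟨f u, h.lt u, ?_, ?_⟩
    · rw [clusterCard, ← heq]
      have := Finset.card_le_card hss
      omega
    · rw [hHl, heq]

/-- Edges within the clusters of a braid reduce the number of holes. -/
theorem IsBraid.holeCount_lt (h : IsBraid G K f) (h' : IsEmptyBraid G' K f) (hK : 5 ≤ K)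
    (h2 : ∀ j < K, 2 ≤ clusterCard f j ∧ clusterCard f j ≤ 4)
    (hone : ∀ i < K, ∀ j < K, clusterCard f i = 4 → clusterCard f j = 4 → i = j)
    {u v : V} (hf : f u = f v) (huv : G.Adj u v) : holeCount G < holeCount G' := by
  -- At most one hole is gained, the only cluster of size 4. The edge u v destroys two: u, v, a
  -- vertex y of the next cluster and either of two vertices of the previous one.
  obtain ⟨F, hF⟩ : ∃ F : Set V, ∀ H, IsHole G H → IsHole G' H ∨ H = F := by
    by_cases hex : ∃ i < K, clusterCard f i = 4
    · obtain ⟨i, hi, hi4⟩ := hex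
      refine ⟨(Finset.univ.filter fun v => f v = i : Finset V), fun H hH => ?_⟩
      rcases h.isHole_or_eq h' (by omega) (fun j hj => (h2 j hj).2) hH with h0 | ⟨j, hj, hj4, rfl⟩
      · exact Or.inl h0
      · rw [hone i hi j hj hi4 hj4]
        exact Or.inr rfl
    · refine ⟨∅, fun H hH => ?_⟩
      rcases h.isHole_or_eq h' (by omega) (fun j hj => (h2 j hj).2) hH with h0 | ⟨j, hj, hj4, rfl⟩
      · exact Or.inl h0
      · exact absurd ⟨j, hj, hj4⟩ hex
  have hu := h.lt u
  have hn := cycleNext_spec (K := K) (i := f u)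
  have hp := cyclePrev_spec (K := K) (i := f u)
  obtain ⟨y, hy⟩ := Finset.card_pos.1 (show 0 < (Finset.univ.filter fun w =>
    f w = cycleNext K (f u)).card from by have := (h2 (cycleNext K (f u)) (by omega)).1; rw [clusterCard] at this; omega)
  obtain ⟨x, hx, x', hx', hxx⟩ := Finset.one_lt_card.1 (show 1 < (Finset.univ.filter fun w =>
    f w = cyclePrev K (f u)).card from (h2 (cyclePrev K (f u)) (by omega)).1)
  simp only [Finset.mem_filter, Finset.mem_univ, true_and] at hx hx' hy
  have hadjy : CycleAdj K (f u) (f y) := by rw [hy, CycleAdj]; omega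
  have hlost : ∀ z, f z = cyclePrev K (f u) → IsHole G' (({u, v, z, y} : Finset V) : Set V) ∧
      ¬ IsHole G (({u, v, z, y} : Finset V) : Set V) := by
    intro z hz
    refine ⟨h'.isHole_quad hK huv.ne ?_ hf ?_ hadjy, fun hH => ?_⟩
    · rintro rfl
      omega
    · rw [hz, CycleAdj]; omega
    · have := h.eq_of_isHole hH (by simp) (by simp) hf huv y (by simp)
      omega
  have hne : (({u, v, x, y} : Finset V) : Set V) ≠ (({u, v, x', y} : Finset V) : Set V) := by
    intro heq
    have hmem : x ∈ (({u, v, x', y} : Finset V) : Set V) := by rw [← heq]; simp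
    simp only [Finset.coe_insert, Finset.coe_singleton, Set.mem_insert_iff, Set.mem_singleton_iff] at hmem
    rcases hmem with rfl | rfl | h0 | rfl
    · omega
    · omega
    · exact hxx h0
    · omega
  obtain ⟨x1, x2⟩ := hlost x hx
  obtain ⟨y1, y2⟩ := hlost x' hx'
  set X := (({u, v, x, y} : Finset V) : Set V)
  set Y := (({u, v, x', y} : Finset V) : Set V)
  have hsub : {S | IsHole G S} ⊆ insert F ({S | IsHole G' S} \ {X, Y}) := by
    intro S hS
    rcases hF S hS with h0 | h0
    · refine Or.inr ⟨h0, ?_⟩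
      rintro (rfl | rfl)
      · exact x2 hS
      · exact y2 hS
    · exact Or.inl h0
  have hle := (Set.ncard_le_ncard hsub (Set.toFinite _)).trans (Set.ncard_insert_le _ _)
  have hXY : ({X, Y} : Set (Set V)) ⊆ {S | IsHole G' S} := by
    rintro S (rfl | rfl)
    exacts [x1, y1]
  have hd := Set.ncard_sdiff_add_ncard_of_subset hXY (Set.toFinite _)
  rw [Set.ncard_pair hne] at hd
  rw [holeCount, holeCount]
  omega

end InnerEdges

/-! ### Comparing braids with an optimal product of cluster sizes -/

section OptimalBraids

open scoped Classical

/-- Subfamilies of optimal families are optimal, and 4 · 4 < 18, 4 · 2 < 9 and 2 · 2 · 2 < 9. So at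
most one cluster differs from 3, or exactly two do and both have size 2. -/
theorem optimal_sizes {s : ℕ → ℕ} {K : ℕ} (hK : 1 ≤ K) (h2 : ∀ j < K, 2 ≤ s j ∧ s j ≤ 4)
    (hprod : ∏ j ∈ Finset.range K, s j = maxProd (∑ j ∈ Finset.range K, s j)) :
    (∀ i < K, ∀ j < K, s i = 4 → s j = 4 → i = j) ∧
      ((∃ r < K, ∀ j < K, j ≠ r → s j = 3) ∨
        ∃ p < K, ∃ q < K, p ≠ q ∧ s p = 2 ∧ s q = 2 ∧ ∀ j < K, j ≠ p → j ≠ q → s j = 3) := by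
  have hsub : ∀ A ⊆ Finset.range K, ∏ j ∈ A, s j = maxProd (∑ j ∈ A, s j) := fun A hA =>
    prod_eq_maxProd_of_subset s (fun j hj => by have := h2 j (Finset.mem_range.1 hj); omega) hA hprod
  have hpair : ∀ i < K, ∀ j < K, i ≠ j → s i * s j = maxProd (s i + s j) := by
    intro i hi j hj hij
    have := hsub {i, j} (by simp [Finset.insert_subset_iff, hi, hj])
    rwa [Finset.prod_pair hij, Finset.sum_pair hij] at this
  have htriple : ∀ i < K, ∀ j < K, ∀ k < K, i ≠ j → i ≠ k → j ≠ k →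
      s i * (s j * s k) = maxProd (s i + (s j + s k)) := by
    intro i hi j hj k hk hij hik hjk
    have := hsub {i, j, k} (by simp [Finset.insert_subset_iff, hi, hj, hk])
    have hni : i ∉ ({j, k} : Finset ℕ) := by simp [hij, hik]
    rwa [Finset.prod_insert hni, Finset.sum_insert hni, Finset.prod_pair hjk, Finset.sum_pair hjk] at this
  have h44 : maxProd 8 = 18 := rfl
  have h42 : maxProd 6 = 9 := rfl
  have hpair2 : ∀ i < K, ∀ j < K, i ≠ j → s i ≠ 3 → s j ≠ 3 → s i = 2 ∧ s j = 2 := by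
    intro i hi j hj hij hi3 hj3
    have h := hpair i hi j hj hij
    have hi2 := h2 i hi
    have hj2 := h2 j hj
    obtain hi' | hi' : s i = 2 ∨ s i = 4 := by omega
    all_goals obtain hj' | hj' : s j = 2 ∨ s j = 4 := by omega
    all_goals
      rw [hi', hj'] at h
      norm_num [h44, h42] at h
    exact ⟨hi', hj'⟩
  refine ⟨fun i hi j hj hi4 hj4 => ?_, ?_⟩
  · by_contra hij
    have := hpair2 i hi j hj hij (by omega) (by omega)
    omega
  by_cases hr : ∃ r < K, s r ≠ 3
  · obtain ⟨r, hr, hr3⟩ := hr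
    by_cases hq : ∃ q < K, q ≠ r ∧ s q ≠ 3
    · obtain ⟨q, hq, hqr, hq3⟩ := hq
      obtain ⟨r2, q2⟩ := hpair2 r hr q hq hqr.symm hr3 hq3
      refine Or.inr ⟨r, hr, q, hq, hqr.symm, r2, q2, fun j hj hjr hjq => ?_⟩
      by_contra hj3
      have j2 := (hpair2 r hr j hj hjr.symm hr3 hj3).2
      have := htriple r hr q hq j hj hqr.symm hjr.symm hjq.symm
      rw [r2, q2, j2] at this
      norm_num [h42] at this
    · push Not at hq
      exact Or.inl ⟨r, hr, hq⟩
  · push Not at hr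
    exact Or.inl ⟨0, by omega, fun j hj _ => hr j hj⟩

theorem IsHole.image {V : Type*} {W : Type*} {G : SimpleGraph V} {G' : SimpleGraph W} (e : G ≃g G')
    {S : Set V} (hS : IsHole G S) : IsHole G' (e '' S) := by
  obtain ⟨m, hm, ⟨i⟩⟩ := hS
  exact ⟨m, hm, ⟨(e.induce e.injective.injOn.bijOn_image).symm.trans i⟩⟩

theorem holeCount_congr {V : Type*} {W : Type*} {G : SimpleGraph V} {G' : SimpleGraph W}
    (e : G ≃g G') : holeCount G = holeCount G' := by
  rw [holeCount, holeCount]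
  refine Set.ncard_congr (fun S _ => e '' S) (fun S hS => IsHole.image e hS)
    (fun S S' _ _ h => e.injective.image_injective h) fun S hS => ?_
  refine ⟨e ⁻¹' S, ?_, Set.image_preimage_eq _ e.surjective⟩
  have h := IsHole.image e.symm hS
  rwa [show e.symm '' S = e ⁻¹' S from e.toEquiv.symm.image_eq_preimage_symm S] at h

theorem isEmptyBraid_extremalGraph {n : ℕ} (hn : 8 ≤ n) :
    IsEmptyBraid (extremalGraph n) (numClusters n) fun v => v.1.val := by
  refine ⟨fun v => v.1.2, fun u v => ?_⟩
  rw [extremalGraph, emptyCyclicBraid, SimpleGraph.comap_adj,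
    cycleGraph_adj_iff_val (by unfold numClusters; omega), CycleAdj]

theorem clusterCard_extremalGraph {n j : ℕ} (hj : j < numClusters n) :
    clusterCard (fun v : ExtremalVertex n => v.1.val) j = clusterSize n ⟨j, hj⟩ := by
  rw [clusterCard, ← Fintype.card_fin (clusterSize n ⟨j, hj⟩), ← Fintype.card_subtype]
  refine Fintype.card_congr ((Equiv.subtypeEquivRight fun v => ?_).trans
    (Equiv.sigmaSubtype (β := fun i => Fin (clusterSize n i)) (⟨j, hj⟩ : Fin (numClusters n))))
  rw [Fin.ext_iff]

theorem prod_clusterCard_extremalGraph {n : ℕ} (hn : 8 ≤ n) :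
    ∏ j ∈ Finset.range (numClusters n), clusterCard (fun v : ExtremalVertex n => v.1.val) j =
      maxProd n := by
  obtain ⟨k, hk⟩ : ∃ k, numClusters n = k + 1 := ⟨numClusters n - 1, by unfold numClusters; omega⟩
  have hval : ∀ j < numClusters n, clusterCard (fun v : ExtremalVertex n => v.1.val) j =
      if j = 0 then (if n % 3 = 1 then 4 else if n % 3 = 2 then 2 else 3) else 3 := fun j hj => by
    rw [clusterCard_extremalGraph hj, clusterSize]
  rw [Finset.prod_congr rfl fun j hj => hval j (Finset.mem_range.1 hj), hk, Finset.prod_range_succ',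
    Finset.prod_congr rfl fun j _ => if_neg (Nat.succ_ne_zero j), Finset.prod_const, Finset.card_range,
    if_pos rfl]
  unfold numClusters at hk
  split_ifs with h1 h2
  · rw [show n = 4 + 3 * k by omega, maxProd_add_three_mul (by omega)]; rfl
  · rw [show n = 2 + 3 * k by omega, maxProd_add_three_mul (by omega)]; rfl
  · rw [show n = 3 + 3 * k by omega, maxProd_add_three_mul (by omega)]; rfl

theorem maxProd_le_holeCount_extremalGraph {n : ℕ} (hn : 15 ≤ n) :
    maxProd n ≤ holeCount (extremalGraph n) := by
  have : Inhabited (ExtremalVertex n) := by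
    have : 0 < Fintype.card (ExtremalVertex n) := by rw [card_extremalVertex (by omega)]; omega
    exact Classical.inhabited_of_nonempty (Fintype.card_pos_iff.1 this)
  rw [(isEmptyBraid_extremalGraph (by omega)).holeCount_eq (by unfold numClusters; omega),
    prod_clusterCard_extremalGraph (by omega)]
  exact Nat.le_add_right _ _

/-- For n ≡ 1 modulo 3 all clusters have size at least 3, so each index contributes at least 3 · 9 +
3 · 3 = 36 holes of length four. -/
theorem le_holeCount_extremalGraph {n : ℕ} (hn : 15 ≤ n) (hn1 : n % 3 = 1) :
    maxProd n + 36 * numClusters n ≤ holeCount (extremalGraph n) := by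
  have : Inhabited (ExtremalVertex n) := by
    have : 0 < Fintype.card (ExtremalVertex n) := by rw [card_extremalVertex (by omega)]; omega
    exact Classical.inhabited_of_nonempty (Fintype.card_pos_iff.1 this)
  rw [(isEmptyBraid_extremalGraph (by omega)).holeCount_eq (by unfold numClusters; omega),
    prod_clusterCard_extremalGraph (by omega)]
  refine Nat.add_le_add_left ?_ _
  have h3 : ∀ j < numClusters n, 3 ≤ clusterCard (fun v : ExtremalVertex n => v.1.val) j := fun j hj => by
    rw [clusterCard_extremalGraph hj, clusterSize]
    split_ifs <;> omega
  have hc : ∀ a, 3 ≤ a → 3 ≤ a.choose 2 := fun a ha => Nat.choose_le_choose 2 ha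
  have := Finset.card_nsmul_le_sum (Finset.range (numClusters n)) (fun i =>
      ((clusterCard (fun v : ExtremalVertex n => v.1.val) i).choose 2 *
        (clusterCard (fun v : ExtremalVertex n => v.1.val) (cyclePrev (numClusters n) i) *
          clusterCard (fun v : ExtremalVertex n => v.1.val) (cycleNext (numClusters n) i)) +
        (clusterCard (fun v : ExtremalVertex n => v.1.val) i).choose 2 *
          (clusterCard (fun v : ExtremalVertex n => v.1.val) (cycleNext (numClusters n) i)).choose 2))
      36 fun i hi => ?_
  · rwa [Finset.card_range, smul_eq_mul, mul_comm] at this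
  · rw [Finset.mem_range] at hi
    have hn' := cycleNext_spec (K := numClusters n) (i := i)
    have hp := cyclePrev_spec (K := numClusters n) (i := i)
    have k1 := h3 _ hi
    have k2 := h3 (cycleNext (numClusters n) i) (by omega)
    have k3 := h3 (cyclePrev (numClusters n) i) (by omega)
    exact Nat.add_le_add (Nat.mul_le_mul (hc _ k1) (Nat.mul_le_mul k3 k2))
      (Nat.mul_le_mul (hc _ k1) (hc _ k2))

variable {V : Type u} [Fintype V] {G : SimpleGraph V} {K : ℕ} {f : V → ℕ}

theorem card_eq_sum_clusterCard (h : ∀ v, f v < K) :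
    Fintype.card V = ∑ i ∈ Finset.range K, clusterCard f i := by
  rw [← Finset.card_univ]
  exact Finset.card_eq_sum_card_fiberwise fun v _ => Finset.mem_coe.2 (Finset.mem_range.2 (h v))

theorem IsEmptyBraid.nonempty_iso (h : IsEmptyBraid G K f) (hK : 5 ≤ K) {r : ℕ} (hr : r < K)
    (hr2 : 2 ≤ clusterCard f r ∧ clusterCard f r ≤ 4)
    (h3 : ∀ j < K, j ≠ r → clusterCard f j = 3) :
    Nonempty (G ≃g extremalGraph (Fintype.card V)) := by
  obtain ⟨n, hn⟩ : ∃ n, n = Fintype.card V := ⟨_, rfl⟩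
  rw [← hn]
  have hcard : n + 3 = 3 * K + clusterCard f r := by
    rw [hn, card_eq_sum_clusterCard h.lt, ← Finset.add_sum_erase _ _ (Finset.mem_range.2 hr),
      Finset.sum_congr rfl fun j hj => h3 j (Finset.mem_range.1 (Finset.mem_of_mem_erase hj))
        (Finset.ne_of_mem_erase hj), Finset.sum_const, Finset.card_erase_of_mem (Finset.mem_range.2 hr),
      Finset.card_range, smul_eq_mul]
    omega
  obtain rfl : K = numClusters n := by unfold numClusters; omega
  set K := numClusters n with hKn
  have hlt := h.lt
  -- The clusters are rotated so that the exceptional one gets index 0, as in the extremal graph;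
  -- within clusters any bijection will do.
  set f' : V → ℕ := fun v => if r ≤ f v then f v - r else f v + K - r with hf'
  have hspec : ∀ v, (r ≤ f v ∧ f' v = f v - r) ∨ (f v < r ∧ f' v = f v + K - r) := by
    intro v
    simp only [hf']
    split_ifs <;> omega
  have hlt' : ∀ v, f' v < K := fun v => by have := hspec v; have := hlt v; omega
  have hadj : ∀ u v, G.Adj u v ↔ CycleAdj K (f' u) (f' v) := by
    intro u v
    rw [h.adj, CycleAdj, CycleAdj]
    have := hspec u
    have := hspec v
    have := hlt u
    have := hlt v
    omega
  have hfib : ∀ i : Fin K, Fintype.card {v // (⟨f' v, hlt' v⟩ : Fin K) = i} = clusterSize n i := by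
    intro i
    have hi := i.2
    obtain ⟨j, hj, hij⟩ : ∃ j < K, ∀ v, (⟨f' v, hlt' v⟩ : Fin K) = i ↔ f v = j := by
      by_cases hir : i.val + r < K
      · refine ⟨i + r, hir, fun v => ?_⟩
        rw [Fin.ext_iff]
        have := hspec v
        have := hlt v
        dsimp only
        omega
      · refine ⟨i + r - K, by omega, fun v => ?_⟩
        rw [Fin.ext_iff]
        have := hspec v
        have := hlt v
        dsimp only
        omega
    rw [Fintype.card_subtype, Finset.filter_congr fun v _ => hij v]
    change clusterCard f j = _
    rw [clusterSize]
    have hi0 : i.val = 0 ↔ j = r := by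
      obtain ⟨v, hv⟩ := Finset.card_pos.1 (show 0 < (Finset.univ.filter fun v => f v = j).card by
        change 0 < clusterCard f j
        by_cases hjr : j = r
        · rw [hjr]; omega
        · rw [h3 j hj hjr]; omega)
      have hv := (Finset.mem_filter.1 hv).2
      have h1 := (hij v).2 hv
      rw [Fin.ext_iff] at h1
      have := hspec v
      have := hlt v
      dsimp only at h1
      omega
    by_cases hjr : j = r
    · rw [if_pos (hi0.2 hjr), hjr]
      split_ifs <;> omega
    · rw [if_neg (fun h => hjr (hi0.1 h)), h3 j hj hjr]
  let e : V ≃ ExtremalVertex n :=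
    (Equiv.sigmaFiberEquiv fun v => (⟨f' v, hlt' v⟩ : Fin K)).symm.trans
      (Equiv.sigmaCongrRight fun i => Fintype.equivFinOfCardEq (hfib i))
  refine ⟨⟨e, fun {u v} => ?_⟩⟩
  rw [(isEmptyBraid_extremalGraph (n := n) (by omega)).adj, hadj]
  rfl

/-- The products agree, so the holes of length four decide. Here they number at most 2 · 12 + 36 (K
- 2) = 36 K - 48, while the extremal graph has one cluster fewer and at least 36 (K - 1) of them. -/
theorem IsEmptyBraid.holeCount_lt_of_two (h : IsEmptyBraid G K f) (hK : 6 ≤ K)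
    (hprod : ∏ j ∈ Finset.range K, clusterCard f j = maxProd (Fintype.card V)) {p q : ℕ} (hp : p < K)
    (hq : q < K) (hpq : p ≠ q) (hp2 : clusterCard f p = 2) (hq2 : clusterCard f q = 2)
    (h3 : ∀ j < K, j ≠ p → j ≠ q → clusterCard f j = 3) :
    holeCount G < holeCount (extremalGraph (Fintype.card V)) := by
  obtain ⟨n, hn⟩ : ∃ n, n = Fintype.card V := ⟨_, rfl⟩
  rw [← hn] at hprod ⊢
  have hsum : ∀ (a b : ℕ) (g : ℕ → ℕ), g p = a → g q = a → (∀ j < K, j ≠ p → j ≠ q → g j = b) →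
      ∑ j ∈ Finset.range K, g j = 2 * a + (K - 2) * b := by
    intro a b g ha ha' hb
    have hq' : q ∈ (Finset.range K).erase p := Finset.mem_erase.2 ⟨hpq.symm, Finset.mem_range.2 hq⟩
    rw [← Finset.add_sum_erase _ _ (Finset.mem_range.2 hp), ← Finset.add_sum_erase _ _ hq',
      Finset.sum_congr rfl fun j hj => hb j
        (Finset.mem_range.1 (Finset.mem_of_mem_erase (Finset.mem_of_mem_erase hj)))
        (Finset.ne_of_mem_erase (Finset.mem_of_mem_erase hj)) (Finset.ne_of_mem_erase hj),
      Finset.sum_const, Finset.card_erase_of_mem hq',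
      Finset.card_erase_of_mem (Finset.mem_range.2 hp), Finset.card_range, smul_eq_mul, ha, ha',
      show K - 1 - 1 = K - 2 by omega]
    ring
  have hcard : n = 3 * K - 2 := by
    rw [hn, card_eq_sum_clusterCard h.lt, hsum 2 3 _ hp2 hq2 h3]
    omega
  have : Inhabited V := by
    have : 0 < Fintype.card V := by omega
    exact Classical.inhabited_of_nonempty (Fintype.card_pos_iff.1 this)
  have hH := le_holeCount_extremalGraph (n := n) (by omega) (by omega)
  rw [h.holeCount_eq (by omega), hprod]
  have hle3 : ∀ j < K, clusterCard f j ≤ 3 := fun j hj => by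
    by_cases hjp : j = p
    · rw [hjp]; omega
    by_cases hjq : j = q
    · rw [hjq]; omega
    exact (h3 j hj hjp hjq).le
  have hc : ∀ a, a ≤ 3 → a.choose 2 ≤ 3 := fun a ha => Nat.choose_le_choose 2 ha
  have hbound := Finset.sum_le_sum (s := Finset.range K) (f := fun i =>
      ((clusterCard f i).choose 2 * (clusterCard f (cyclePrev K i) * clusterCard f (cycleNext K i)) +
        (clusterCard f i).choose 2 * (clusterCard f (cycleNext K i)).choose 2))
      (g := fun i => (clusterCard f i).choose 2 * (3 * 3) + (clusterCard f i).choose 2 * 3)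
      fun i hi => ?_
  · rw [hsum 12 36 (fun i => (clusterCard f i).choose 2 * (3 * 3) + (clusterCard f i).choose 2 * 3)
      (by simp [hp2]) (by simp [hq2]) fun j hj hjp hjq => by
        simp [h3 j hj hjp hjq]] at hbound
    have hKn : numClusters n = K - 1 := by unfold numClusters; omega
    rw [hKn] at hH
    omega
  · rw [Finset.mem_range] at hi
    have hn' := cycleNext_spec (K := K) (i := i)
    have hp' := cyclePrev_spec (K := K) (i := i)
    have k2 := hle3 (cycleNext K i) (by omega)
    have k3 := hle3 (cyclePrev K i) (by omega)
    exact Nat.add_le_add (Nat.mul_le_mul_left _ (Nat.mul_le_mul k3 k2))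
      (Nat.mul_le_mul_left _ (hc _ k2))

/-- Among the braids of optimal type, only the extremal graph has the maximum number of holes. -/
theorem IsBraid.holeCount_lt_or_iso (h : IsBraid G K f) (hn : 30 ≤ Fintype.card V)
    (h2 : ∀ j < K, 2 ≤ clusterCard f j ∧ clusterCard f j ≤ 4)
    (hprod : ∏ j ∈ Finset.range K, clusterCard f j = maxProd (Fintype.card V)) :
    holeCount G < holeCount (extremalGraph (Fintype.card V)) ∨
      Nonempty (G ≃g extremalGraph (Fintype.card V)) := by
  have hK : 6 ≤ K := by
    have h1 := card_eq_sum_clusterCard h.lt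
    have h2 := Finset.sum_le_card_nsmul (Finset.range K) (fun i => clusterCard f i) 4
      fun j hj => (h2 j (Finset.mem_range.1 hj)).2
    rw [Finset.card_range, smul_eq_mul] at h2
    omega
  have : Inhabited V := by
    have : 0 < Fintype.card V := by omega
    exact Classical.inhabited_of_nonempty (Fintype.card_pos_iff.1 this)
  obtain ⟨hone, hcase⟩ := optimal_sizes (by omega) h2 (by rw [hprod, ← card_eq_sum_clusterCard h.lt])
  have key : ∀ G' : SimpleGraph V, IsEmptyBraid G' K f →
      holeCount G' < holeCount (extremalGraph (Fintype.card V)) ∨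
        Nonempty (G' ≃g extremalGraph (Fintype.card V)) := by
    intro G' h'
    rcases hcase with ⟨r, hr, h3⟩ | ⟨p, hp, q, hq, hpq, hp2, hq2, h3⟩
    · exact Or.inr (h'.nonempty_iso (by omega) hr (h2 r hr) h3)
    · exact Or.inl (h'.holeCount_lt_of_two hK hprod hp hq hpq hp2 hq2 h3)
  by_cases hne : ∃ u v, f u = f v ∧ G.Adj u v
  · obtain ⟨u, v, hf, huv⟩ := hne
    obtain ⟨G', h'⟩ := h.exists_isEmptyBraid (by omega)
    have hlt := h.holeCount_lt h' (by omega) h2 hone hf huv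
    rcases key G' h' with hG | ⟨⟨e⟩⟩
    · exact Or.inl (hlt.trans hG)
    · exact Or.inl (hlt.trans_le (holeCount_congr e).le)
  · push Not at hne
    exact key G (h.isEmptyBraid (by omega) hne)

/-- With sizes at most 4, each index contributes at most 6 · 16 + 6 · 6 = 132 holes of length four.
-/
theorem IsEmptyBraid.holeCount_le [Inhabited V] (h : IsEmptyBraid G K f) (hK : 5 ≤ K)
    (h4 : ∀ j < K, clusterCard f j ≤ 4) :
    holeCount G ≤ ∏ j ∈ Finset.range K, clusterCard f j + 132 * K := by
  rw [h.holeCount_eq hK]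
  refine Nat.add_le_add_left ?_ _
  have hc : ∀ a, a ≤ 4 → a.choose 2 ≤ 6 := fun a ha => Nat.choose_le_choose 2 ha
  refine (Finset.sum_le_card_nsmul _ _ 132 fun i hi => ?_).trans (by
    rw [Finset.card_range, smul_eq_mul, mul_comm])
  rw [Finset.mem_range] at hi
  have hn' := cycleNext_spec (K := K) (i := i)
  have hp' := cyclePrev_spec (K := K) (i := i)
  have k1 := h4 i hi
  have k2 := h4 (cycleNext K i) (by omega)
  have k3 := h4 (cyclePrev K i) (by omega)
  exact Nat.add_le_add (Nat.mul_le_mul (hc _ k1) (Nat.mul_le_mul k3 k2))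
    (Nat.mul_le_mul (hc _ k1) (hc _ k2))

/-- The holes of the extremal graph are hardly more than its longest holes. -/
theorem holeCount_extremalGraph_le {n : ℕ} (hn : 15 ≤ n) :
    holeCount (extremalGraph n) ≤ maxProd n + 132 * n := by
  have : Inhabited (ExtremalVertex n) := by
    have : 0 < Fintype.card (ExtremalVertex n) := by rw [card_extremalVertex (by omega)]; omega
    exact Classical.inhabited_of_nonempty (Fintype.card_pos_iff.1 this)
  have h := (isEmptyBraid_extremalGraph (n := n) (by omega)).holeCount_le
    (by unfold numClusters; omega) fun j hj => by
      rw [clusterCard_extremalGraph hj, clusterSize]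
      split_ifs <;> omega
  rw [prod_clusterCard_extremalGraph (by omega)] at h
  have : numClusters n ≤ n := by unfold numClusters; omega
  omega

end OptimalBraids

/-! ### Deleting vertices that lie in few holes -/

section VertexDeletion

open scoped Classical

variable {V : Type u} [Fintype V] {G : SimpleGraph V}

theorem holeCount_le_holesThrough_add (v : V) :
    holeCount G ≤ holesThrough G Finset.univ v + holeCount (G.induce {x | x ≠ v}) := by
  rw [holesThrough_univ, holeCount, holeCount]
  have h1 : {S | IsHole G S} ⊆ {S | IsHole G S ∧ v ∈ S} ∪ {S | IsHole G S ∧ v ∉ S} := by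
    intro S hS
    by_cases hv : v ∈ S
    · exact Or.inl ⟨hS, hv⟩
    · exact Or.inr ⟨hS, hv⟩
  refine (Set.ncard_le_ncard h1 (Set.toFinite _)).trans ((Set.ncard_union_le _ _).trans
    (Nat.add_le_add_left ?_ _))
  refine Set.ncard_le_ncard_of_injOn (fun S => Subtype.val ⁻¹' S) ?_ ?_ (Set.toFinite _)
  · rintro S ⟨⟨m, hm, ⟨i⟩⟩, hv⟩
    have hne : ∀ x ∈ S, x ≠ v := fun x hx h => hv (h ▸ hx)
    refine ⟨m, hm, ⟨RelIso.trans (s := (G.induce S).Adj) ⟨⟨fun x => ⟨x.1.1, x.2⟩,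
      fun y => ⟨⟨y.1, hne _ y.2⟩, y.2⟩, fun _ => rfl, fun _ => rfl⟩, Iff.rfl⟩ i⟩⟩
  · rintro S ⟨-, hv⟩ S' ⟨-, hv'⟩ h
    ext x
    by_cases hx : x = v
    · rw [hx]
      exact iff_of_false hv hv'
    · exact Set.ext_iff.1 h ⟨x, hx⟩

theorem card_ne (v : V) : Fintype.card {x | x ≠ v} = Fintype.card V - 1 := by
  refine (Fintype.card_subtype _).trans ?_
  simp only [Set.mem_ofPred_eq]
  rw [Finset.filter_ne', Finset.card_erase_of_mem (Finset.mem_univ _), Finset.card_univ]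

/-- Large graphs with many holes in which every vertex lies in many holes. -/
theorem holeCount_lt_or_iso_of_holesThrough : ∃ N : ℕ, ∀ (V : Type u) [Fintype V]
    (G : SimpleGraph V), N ≤ Fintype.card V → maxProd (Fintype.card V) ≤ holeCount G →
    (∀ v, holeCount G ≤ 5 * holesThrough G Finset.univ v) →
    holeCount G < holeCount (extremalGraph (Fintype.card V)) ∨
      Nonempty (G ≃g extremalGraph (Fintype.card V)) := by
  obtain ⟨n₁, h₁⟩ := exists_isSegment.{u} 30 10
  obtain ⟨n₂, h₂⟩ := exists_isBraid_of_isSegment.{u}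
  refine ⟨n₁ + n₂ + 30, fun V _ G hn hM h5 => ?_⟩
  have : Inhabited V := by
    have : 0 < Fintype.card V := by omega
    exact Classical.inhabited_of_nonempty (Fintype.card_pos_iff.1 this)
  obtain ⟨S, hS⟩ := h₁ V G (by omega) (degree_le_of_holesThrough hM h5) (card_mul_maxProd_le hM h5)
  obtain ⟨K, f, hf, hs, hp⟩ := h₂ V G S (by omega) hS hM
  exact hf.holeCount_lt_or_iso (by omega) hs hp

/-- A ratio of at least 16/15 between the number of holes and `maxProd` is impossible if every
vertex lies in a fifth of the holes. So some vertex lies in fewer, and deleting it raises the ratio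
by the factor 16/15. After t deletions the general bound 15 applies. -/
theorem holeCount_mul_pow_le : ∃ N : ℕ, ∀ (t : ℕ) (V : Type u) [Fintype V] (G : SimpleGraph V),
    N + t ≤ Fintype.card V → 16 * maxProd (Fintype.card V) ≤ 15 * holeCount G →
    16 ^ t * holeCount G ≤ 15 ^ (t + 1) * maxProd (Fintype.card V) := by
  obtain ⟨N, hN⟩ := holeCount_lt_or_iso_of_holesThrough.{u}
  obtain ⟨n₂, hn₂⟩ := exists_pow_four_lt_maxProd
  refine ⟨N + n₂ + 15, fun t => ?_⟩
  induction t with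
  | zero =>
    intro V _ G hn _
    have : Inhabited V := by
      have : 0 < Fintype.card V := by omega
      exact Classical.inhabited_of_nonempty (Fintype.card_pos_iff.1 this)
    simpa using holeCount_le (G := G)
  | succ t ih =>
    intro V _ G hn hG
    obtain ⟨n, hnV⟩ : ∃ n, n = Fintype.card V := ⟨_, rfl⟩
    have hpos := maxProd_pos n
    by_cases h5 : ∀ v, holeCount G ≤ 5 * holesThrough G Finset.univ v
    · exfalso
      have h1 : holeCount G ≤ holeCount (extremalGraph (Fintype.card V)) := by
        rcases hN V G (by omega) (by omega) h5 with h | ⟨⟨e⟩⟩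
        · exact h.le
        · exact (holeCount_congr e).le
      have h2 := holeCount_extremalGraph_le (n := Fintype.card V) (by omega)
      have h3 := hn₂ (Fintype.card V) (by omega)
      have h4 : maxProd (Fintype.card V - 21) ≤ maxProd (Fintype.card V) := maxProd_mono (by omega)
      rw [← hnV] at hn hG h1 h2 h3 h4
      -- Makes the at most 132 n holes of length four negligible, through n^4 and the bound on
      -- `maxProd (n - 21)`.
      have h6 : 15 ^ 3 * n ≤ n ^ 3 * n := Nat.mul_le_mul_right n (Nat.pow_le_pow_left (by omega) 3)
      rw [← pow_succ, show 3 + 1 = 4 from rfl] at h6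
      omega
    · push Not at h5
      obtain ⟨v, hv⟩ := h5
      have h1 := holeCount_le_holesThrough_add (G := G) v
      have h2 := four_mul_maxProd_le (n := n - 1) (by omega)
      have hc := card_ne v
      have h3 := ih {x | x ≠ v} (G.induce {x | x ≠ v}) (by omega)
      rw [hc] at h3
      rw [← hnV] at hn hG h3 ⊢
      rw [Nat.sub_add_cancel (by omega)] at h2
      have h4 := h3 (by omega)
      set h' := holeCount (G.induce {x | x ≠ v})
      calc 16 ^ (t + 1) * holeCount G = 16 ^ t * (16 * holeCount G) := by ring
        _ ≤ 16 ^ t * (20 * h') := Nat.mul_le_mul_left _ (by omega)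
        _ = 20 * (16 ^ t * h') := by ring
        _ ≤ 20 * (15 ^ (t + 1) * maxProd (n - 1)) := Nat.mul_le_mul_left _ h4
        _ = 15 ^ (t + 1) * 5 * (4 * maxProd (n - 1)) := by ring
        _ ≤ 15 ^ (t + 1) * 5 * (3 * maxProd n) := Nat.mul_le_mul_left _ h2
        _ = _ := by ring

/-- The choice of 42 deletions suffices because (16/15)^43 > 15. -/
theorem fifteen_mul_holeCount_lt : ∃ N : ℕ, ∀ (V : Type u) [Fintype V] (G : SimpleGraph V),
    N ≤ Fintype.card V → 15 * holeCount G < 16 * maxProd (Fintype.card V) := by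
  obtain ⟨N, hN⟩ := holeCount_mul_pow_le.{u}
  refine ⟨N + 42, fun V _ G hn => ?_⟩
  by_contra! h
  have h1 := hN 42 V G hn h
  have hpos := maxProd_pos (Fintype.card V)
  norm_num at h1
  omega

end VertexDeletion

/-! ### Conclusion -/

theorem corollary1p3 :
    ∃ n₀ : ℕ, 8 ≤ n₀ ∧ ∀ n : ℕ, n₀ ≤ n →
      Fintype.card (ExtremalVertex n) = n ∧
      ∀ (V : Type u) [Fintype V], Fintype.card V = n → ∀ G : SimpleGraph V,
        holeCount G ≤ holeCount (extremalGraph n) ∧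
        (holeCount G = holeCount (extremalGraph n) ↔ Nonempty (G ≃g extremalGraph n)) := by
  obtain ⟨N, hN⟩ := holeCount_lt_or_iso_of_holesThrough.{u}
  obtain ⟨N', hN'⟩ := fifteen_mul_holeCount_lt.{u}
  refine ⟨N + N' + 15, by omega, fun n hn => ⟨card_extremalVertex (by omega), ?_⟩⟩
  rintro V _ rfl G
  have key : holeCount G < holeCount (extremalGraph (Fintype.card V)) ∨
      Nonempty (G ≃g extremalGraph (Fintype.card V)) := by
    have hM := maxProd_le_holeCount_extremalGraph (n := Fintype.card V) (by omega)
    by_cases hG : maxProd (Fintype.card V) ≤ holeCount G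
    · refine hN V G (by omega) hG fun v => ?_
      -- Deleting v would leave more than (4/5) * maxProd n holes. This is at least (16/15) *
      -- maxProd (n - 1), contrary to the bound for large graphs.
      by_contra! hv
      classical
      have h1 := holeCount_le_holesThrough_add (G := G) v
      have h2 := four_mul_maxProd_le (n := Fintype.card V - 1) (by omega)
      have hc := card_ne v
      have h3 := hN' {x | x ≠ v} (G.induce {x | x ≠ v}) (by omega)
      rw [hc] at h3
      rw [Nat.sub_add_cancel (by omega)] at h2
      omega
    · left
      omega
  rcases key with h | ⟨⟨e⟩⟩
  · refine ⟨h.le, fun heq => absurd heq h.ne, ?_⟩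
    rintro ⟨e⟩
    exact holeCount_congr e
  · have heq := holeCount_congr e
    exact ⟨heq.le, fun _ => ⟨e⟩, fun _ => heq⟩
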